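/- Consider $n\ge 1$ robots in the Euclidean plane with starting positions $p_1,\dots,p_n$ and maximum speeds $v_1,\dots,v_n$, where the unit of time is chosen so that every speed is at least $1$ (for example, the slowest robot has speed $1$), a source $S$ and a destination $D$. A trajectory of robot $i$ is a map $f_i:[0,\infty)\to\mathbb R^2$ with $f_i(0)=p_i$ and $|f_i(s)-f_i(t)|\le v_i|s-t|$ for all $s,t\ge 0$. A robot obtains the message by being at $S$, or by being at the same point at the same time as a robot that has the message, and then keeps it (the message may be replicated). The message is delivered at the time when a robot that has it is at $D$. Let $\mathrm{Opt}_{Eucl}$ be the infimum of the delivery times over all choices of trajectories, and let $\Delta$ be the diameter of $\{S,D,p_1,\dots,p_n\}$. There are a constant $C$ and a single algorithm on a unit-cost real random access machine (arithmetic operations and comparisons of real numbers and of natural numbers, indirect addressing, no roots and no rounding) such that, for all such data with arbitrary $n\ge1$ and every $\varepsilon'>0$, the algorithm with input $n$, $(v_i)$, $(p_i)$, $S$, $D$, $\varepsilon'$ halts and outputs (as lists of timed waypoints of polygonal paths) trajectories for the $n$ robots that deliver the message from $S$ to $D$ within time $$\sqrt2\cdot \mathrm{Opt}_{Eucl}+\varepsilon'.$$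 Moreover, whenever $\varepsilon'\le\Delta$ and $n\Delta/\varepsilon'\ge 2$, it halts after at most $$C\, n^3\left(\frac{\Delta}{\varepsilon'}\right)^2\log\left(\frac{n\Delta}{\varepsilon'}\right)$$ steps. -/

import Mathlib

noncomputable section

namespace PonyExpress

/-! ## Robots, trajectories and delivery -/

/-- The Euclidean plane. -/
abbrev Plane : Type := EuclideanSpace ℝ (Fin 2)

/-- `f i t` is the location of robot `i` at time `t ≥ 0`. Robot `i` starts at `p i` and never moves
faster than its maximum speed `v i`. -/
def IsSchedule {n : ℕ} (v : Fin n → ℝ) (p : Fin n → Plane) (f : Fin n → ℝ → Plane) : Prop :=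
  ∀ i, f i 0 = p i ∧ ∀ s t, 0 ≤ s → 0 ≤ t → dist (f i s) (f i t) ≤ v i * |s - t|

/-- `Informed f S i t`: at time `t` robot `i` has the message. A robot obtains it at the source `S`
or from a robot at the same location at the same time, and keeps it (messages are replicated). -/
inductive Informed {n : ℕ} (f : Fin n → ℝ → Plane) (S : Plane) : Fin n → ℝ → Prop
  | pickup (i : Fin n) (t : ℝ) : 0 ≤ t → f i t = S → Informed f S i t
  | keep (i : Fin n) (s t : ℝ) : Informed f S i s → s ≤ t → Informed f S i t
  | meet (i j : Fin n) (t : ℝ) : Informed f S i t → f i t = f j t → Informed f S j t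

/-- Some robot is at the destination `D` with the message at time `t`. -/
def DeliversAt {n : ℕ} (f : Fin n → ℝ → Plane) (S D : Plane) (t : ℝ) : Prop :=
  ∃ i, Informed f S i t ∧ f i t = D

/-- The optimal Euclidean delivery time, over all trajectories of the robots. -/
def optEucl {n : ℕ} (v : Fin n → ℝ) (p : Fin n → Plane) (S D : Plane) : ℝ :=
  sInf {t | ∃ f, IsSchedule v p f ∧ DeliversAt f S D t}

/-- The diameter of the point set consisting of `S`, `D` and the starting positions. -/
def diameter {n : ℕ} (p : Fin n → Plane) (S D : Plane) : ℝ :=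
  Metric.diam ({S, D} ∪ Set.range p)

/-- The polygonal trajectory which is at `P` at time `t₀`, passes through the listed
(time, point)-pairs, moving uniformly on a segment between consecutive ones, and then stays. -/
def polygonal (t₀ : ℝ) (P : Plane) : List (ℝ × Plane) → ℝ → Plane
  | [], _ => P
  | w :: l, t =>
    if t ≤ w.1 then AffineMap.lineMap P w.2 ((t - t₀) / (w.1 - t₀)) else polygonal w.1 w.2 l t

/-! ## A real random access machine

The memory consists of arrays of natural numbers and arrays of real numbers (a program uses finitely
many of them). The unit-cost operations are reading and writing a cell whose address is computed,
`+`, truncated `-` and `*` on natural numbers, the four arithmetic operations on real numbers,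
conversion of a natural number to a real number, and comparisons. There are no roots, no rounding
and no real constants other than those obtained from natural numbers. -/

/-- The memory: `nat a k` and `real a k` are the `k`-th cells of the `a`-th arrays. -/
structure Memory where
  nat : ℕ → ℕ → ℕ
  real : ℕ → ℕ → ℝ

def Memory.writeNat (m : Memory) (a k x : ℕ) : Memory :=
  { m with nat := Function.update m.nat a (Function.update (m.nat a) k x) }

def Memory.writeReal (m : Memory) (a k : ℕ) (x : ℝ) : Memory :=
  { m with real := Function.update m.real a (Function.update (m.real a) k x) }

inductive NatExpr
  | lit (k : ℕ)
  | read (a : ℕ) (index : NatExpr)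
  | add (x y : NatExpr)
  | sub (x y : NatExpr)
  | mul (x y : NatExpr)

def NatExpr.eval (m : Memory) : NatExpr → ℕ
  | .lit k => k
  | .read a i => m.nat a (i.eval m)
  | .add x y => x.eval m + y.eval m
  | .sub x y => x.eval m - y.eval m
  | .mul x y => x.eval m * y.eval m

/-- The number of operations performed in evaluating an expression. -/
def NatExpr.cost : NatExpr → ℕ
  | .lit _ => 1
  | .read _ i => i.cost + 1
  | .add x y => x.cost + y.cost + 1
  | .sub x y => x.cost + y.cost + 1
  | .mul x y => x.cost + y.cost + 1

inductive RealExpr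
  | ofNat (x : NatExpr)
  | read (a : ℕ) (index : NatExpr)
  | add (x y : RealExpr)
  | sub (x y : RealExpr)
  | mul (x y : RealExpr)
  | div (x y : RealExpr)

def RealExpr.eval (m : Memory) : RealExpr → ℝ
  | .ofNat x => (x.eval m : ℝ)
  | .read a i => m.real a (i.eval m)
  | .add x y => x.eval m + y.eval m
  | .sub x y => x.eval m - y.eval m
  | .mul x y => x.eval m * y.eval m
  | .div x y => x.eval m / y.eval m

def RealExpr.cost : RealExpr → ℕ
  | .ofNat x => x.cost + 1
  | .read _ i => i.cost + 1
  | .add x y => x.cost + y.cost + 1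
  | .sub x y => x.cost + y.cost + 1
  | .mul x y => x.cost + y.cost + 1
  | .div x y => x.cost + y.cost + 1

inductive Test
  | natLt (x y : NatExpr)
  | realLt (x y : RealExpr)
  | not (b : Test)
  | and (b c : Test)

def Test.Holds (m : Memory) : Test → Prop
  | .natLt x y => x.eval m < y.eval m
  | .realLt x y => x.eval m < y.eval m
  | .not b => ¬ b.Holds m
  | .and b c => b.Holds m ∧ c.Holds m

def Test.cost : Test → ℕ
  | .natLt x y => x.cost + y.cost + 1
  | .realLt x y => x.cost + y.cost + 1
  | .not b => b.cost + 1
  | .and b c => b.cost + c.cost + 1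

inductive Program
  | skip
  | setNat (a : ℕ) (index value : NatExpr)
  | setReal (a : ℕ) (index : NatExpr) (value : RealExpr)
  | seq (P Q : Program)
  | cond (b : Test) (P Q : Program)
  | loop (b : Test) (P : Program)

/-- `Runs P m m' k`: started in memory `m`, the program `P` halts after `k` steps in memory `m'`.
`loop b P` repeats `P` as long as `b` holds. -/
inductive Runs : Program → Memory → Memory → ℕ → Prop
  | skip (m : Memory) : Runs .skip m m 1
  | setNat (a : ℕ) (i e : NatExpr) (m : Memory) :
      Runs (.setNat a i e) m (m.writeNat a (i.eval m) (e.eval m)) (i.cost + e.cost + 1)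
  | setReal (a : ℕ) (i : NatExpr) (e : RealExpr) (m : Memory) :
      Runs (.setReal a i e) m (m.writeReal a (i.eval m) (e.eval m)) (i.cost + e.cost + 1)
  | seq {P Q : Program} {m₁ m₂ m₃ : Memory} {j k : ℕ} :
      Runs P m₁ m₂ j → Runs Q m₂ m₃ k → Runs (.seq P Q) m₁ m₃ (j + k)
  | condTrue {b : Test} {P Q : Program} {m m' : Memory} {k : ℕ} :
      b.Holds m → Runs P m m' k → Runs (.cond b P Q) m m' (b.cost + k + 1)
  | condFalse {b : Test} {P Q : Program} {m m' : Memory} {k : ℕ} :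
      ¬ b.Holds m → Runs Q m m' k → Runs (.cond b P Q) m m' (b.cost + k + 1)
  | loopDone {b : Test} {P : Program} {m : Memory} :
      ¬ b.Holds m → Runs (.loop b P) m m (b.cost + 1)
  | loopStep {b : Test} {P : Program} {m₁ m₂ m₃ : Memory} {j k : ℕ} :
      b.Holds m₁ → Runs P m₁ m₂ j → Runs (.loop b P) m₂ m₃ k →
        Runs (.loop b P) m₁ m₃ (b.cost + j + k + 1)

/-! ## Input and output of the algorithm -/

/-- The array of real numbers given by a finite sequence, padded with zeros. -/
def pad {n : ℕ} (x : Fin n → ℝ) (k : ℕ) : ℝ := if h : k < n then x ⟨k, h⟩ else 0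

/-- The initial memory. Natural array `0` holds `n` in its first cell. Real array `0` holds `ε` and
the coordinates of `S` and `D`; the real arrays `1`, `2`, `3` hold the speeds and the two coordinates
of the starting positions. All other cells are zero. -/
def input {n : ℕ} (v : Fin n → ℝ) (p : Fin n → Plane) (S D : Plane) (ε : ℝ) : Memory where
  nat a k := if a = 0 ∧ k = 0 then n else 0
  real a := match a with
    | 0 => pad ![ε, S 0, S 1, D 0, D 1]
    | 1 => pad v
    | 2 => pad fun i => p i 0
    | 3 => pad fun i => p i 1
    | _ => fun _ => 0

/-- The waypoints of robot `i` in the output. Cell `i` of natural array `1` is the number of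
waypoints of robot `i`. The times and the two coordinates of the waypoints of robot `0`, followed by
those of robot `1`, and so on, are in the real arrays `4`, `5`, `6`. -/
def waypoints (m : Memory) (i : ℕ) : List (ℝ × Plane) :=
  (List.range (m.nat 1 i)).map fun k =>
    let c := (∑ j ∈ Finset.range i, m.nat 1 j) + k
    (m.real 4 c, !₂[m.real 5 c, m.real 6 c])

/-- The trajectories described by the output. -/
def output {n : ℕ} (p : Fin n → Plane) (m : Memory) (i : Fin n) : ℝ → Plane :=
  polygonal 0 (p i) (waypoints m i)

end PonyExpress

end

/-!
The Euclidean delivery problem is solved up to the factor `√2` and an additive error `ε` by a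
dynamic program over the points of a grid of mesh `δ = ε / (4 * n)` centred at the source, on which
distances are measured in the taxicab metric. That metric exceeds the Euclidean one by a factor of
at most `√2` and needs no roots.

*The table.* Order the robots by increasing speed and let `A k` give, for every grid point, the
earliest time at which the first `k` robots can bring the message there, each of them carrying it at
most once (`IsTable`). One more robot, of speed `v`, goes straight to some grid point, waits for the
message unless that point is the source, and carries it on. So `A (k + 1)` is the minimum of `A k`
and the taxicab distance transform, with weight `1 / v`, of the pickup times (`IsRound`). The
transform is computed by one forward and one backward sweep over the grid (`le_of_two_sweeps`), so
that a round takes a number of steps proportional to the number of grid points, and no priority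
queue is needed.

*Lower bound.* In an arbitrary schedule, whoever is informed can be thought of as accompanied by a
carrier at least as fast, to which the table attributes the message. When an informed robot meets
one that comes later in the order than the carrier, the carrier is replaced, at the cost of one
snapping error of `2 * δ`. Since the rank of the carrier increases, at most `n` such errors add up
(`IsTable.exists_carrier`). No extremal schedule has to be normalized for this. Positions outside
the grid do no harm, because snapping clamps them to the grid and clamping is a contraction.

*Upper bound.* Following the recorded sources back from the grid point next to the destination gives
two waypoints for every robot used, namely its pickup point and the pickup point of the next robot
(or the destination), where it waits. By induction on the rounds, the message is handed over as
planned (`exists_informed_of_plan`), and the plan delivers within `√2 * optEucl + ε` (`plan_spec`).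

*The machine.* Correctness and step counts are proved together in the form `Reaches P m K Q`:
started in `m`, the program `P` halts within `K` steps in a memory satisfying `Q`. Loop-free
programs are evaluated (`Program.result`), loops are treated by invariants (`Reaches.loop`,
`Reaches.forLoop`, `Reaches.gridLoop`), and what a program leaves unchanged is read off from the
targets of its assignments (`Agree`). Rounding to the grid and the size of the grid are obtained by
counting.
-/

noncomputable section

namespace PonyExpress

/-! ### The taxicab metric and polygonal trajectories -/

/-- The taxicab distance in the plane. -/
def taxi (x y : Plane) : ℝ := |x 0 - y 0| + |x 1 - y 1|

theorem taxi_nonneg (x y : Plane) : 0 ≤ taxi x y := by unfold taxi; positivity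

theorem taxi_self (x : Plane) : taxi x x = 0 := by simp [taxi]

theorem taxi_comm (x y : Plane) : taxi x y = taxi y x := by
  simp only [taxi, abs_sub_comm]

theorem taxi_triangle (x y z : Plane) : taxi x z ≤ taxi x y + taxi y z := by
  unfold taxi
  linarith [abs_sub_le (x 0) (y 0) (z 0), abs_sub_le (x 1) (y 1) (z 1)]

theorem dist_le_taxi (x y : Plane) : dist x y ≤ taxi x y := by
  rw [EuclideanSpace.dist_eq, Fin.sum_univ_two, Real.dist_eq, Real.dist_eq]
  apply Real.sqrt_le_iff.2 ⟨taxi_nonneg x y, ?_⟩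
  unfold taxi
  nlinarith [abs_nonneg (x 0 - y 0), abs_nonneg (x 1 - y 1)]

theorem taxi_le_sqrt_two_mul_dist (x y : Plane) : taxi x y ≤ √2 * dist x y := by
  rw [EuclideanSpace.dist_eq, Fin.sum_univ_two, Real.dist_eq, Real.dist_eq,
    ← Real.sqrt_mul (by norm_num)]
  apply Real.le_sqrt_of_sq_le
  unfold taxi
  nlinarith [sq_nonneg (|x 0 - y 0| - |x 1 - y 1|)]

theorem abs_coord_le_dist (x y : Plane) (j : Fin 2) : |x j - y j| ≤ dist x y := by
  rw [dist_eq_norm]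
  exact PiLp.norm_apply_le (x - y) j

/-- A list of waypoints that a robot of speed `v` starting from `P` at time `t₀` can follow. -/
def Feasible (v : ℝ) : ℝ → Plane → List (ℝ × Plane) → Prop
  | _, _, [] => True
  | t₀, P, w :: l => t₀ ≤ w.1 ∧ dist P w.2 ≤ v * (w.1 - t₀) ∧ Feasible v w.1 w.2 l

theorem polygonal_start {v t₀ : ℝ} {P : Plane} {l : List (ℝ × Plane)} (h : Feasible v t₀ P l) :
    polygonal t₀ P l t₀ = P := by
  cases l with
  | nil => rfl
  | cons w l => simp [polygonal, h.1]

/-- Reaching a waypoint: at time `w.1` the trajectory is at `w.2`, and from then on it is the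
trajectory through the remaining waypoints. -/
theorem polygonal_cons_of_le {v t₀ t : ℝ} {P : Plane} {w : ℝ × Plane} {l : List (ℝ × Plane)}
    (h : Feasible v t₀ P (w :: l)) (ht : w.1 ≤ t) :
    polygonal t₀ P (w :: l) t = polygonal w.1 w.2 l t := by
  obtain ⟨h1, h2, h3⟩ := h
  rcases ht.lt_or_eq with ht | ht
  · simp [polygonal, ht.not_ge]
  · subst ht
    rw [polygonal_start h3]
    simp only [polygonal, le_refl, if_true]
    rcases h1.lt_or_eq with h1 | h1
    · rw [div_self (by linarith), AffineMap.lineMap_apply_one]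
    · -- a waypoint due at the current time coincides with the current position
      rw [← h1, sub_self, mul_zero] at h2
      rw [dist_le_zero.1 h2, AffineMap.lineMap_same_apply]

theorem dist_polygonal_le {v : ℝ} (hv : 0 ≤ v) {l : List (ℝ × Plane)} :
    ∀ {t₀ : ℝ} {P : Plane}, Feasible v t₀ P l → ∀ {s t : ℝ}, t₀ ≤ s → s ≤ t →
      dist (polygonal t₀ P l s) (polygonal t₀ P l t) ≤ v * (t - s) := by
  induction l with
  | nil =>
    intro t₀ P _ s t _ hst
    simpa [polygonal] using mul_nonneg hv (sub_nonneg.2 hst)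
  | cons w l ih =>
    intro t₀ P h
    -- both times on the first segment
    have key : ∀ {s t : ℝ}, t₀ ≤ s → s ≤ t → t ≤ w.1 →
        dist (polygonal t₀ P (w :: l) s) (polygonal t₀ P (w :: l) t) ≤ v * (t - s) := by
      intro s t hs hst ht
      simp only [polygonal, ht, hst.trans ht, if_true]
      rw [dist_lineMap_lineMap, Real.dist_eq, ← sub_div, abs_div]
      rcases h.1.lt_or_eq with h1 | h1
      · rw [abs_of_nonpos (by linarith), abs_of_pos (by linarith), div_mul_eq_mul_div,
          div_le_iff₀ (by linarith)]
        nlinarith [h.2.1]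
      · rw [← h1]; simp; nlinarith
    intro s t hs hst
    rcases le_total t w.1 with ht | ht
    · exact key hs hst ht
    rcases le_total s w.1 with hs' | hs'
    · calc _ ≤ dist (polygonal t₀ P (w :: l) s) (polygonal t₀ P (w :: l) w.1) +
            dist (polygonal t₀ P (w :: l) w.1) (polygonal t₀ P (w :: l) t) := dist_triangle _ _ _
        _ ≤ v * (w.1 - s) + v * (t - w.1) := by
          refine add_le_add (key hs hs' le_rfl) ?_
          rw [polygonal_cons_of_le h le_rfl, polygonal_cons_of_le h ht]
          exact ih h.2.2 le_rfl ht
        _ = _ := by ring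
    · rw [polygonal_cons_of_le h hs', polygonal_cons_of_le h ht]
      exact ih h.2.2 hs' hst

theorem isSchedule_polygonal {n : ℕ} {v : Fin n → ℝ} {p : Fin n → Plane}
    {l : Fin n → List (ℝ × Plane)} (hv : ∀ i, 0 ≤ v i) (h : ∀ i, Feasible (v i) 0 (p i) (l i)) :
    IsSchedule v p fun i => polygonal 0 (p i) (l i) := by
  refine fun i => ⟨polygonal_start (h i), fun s t hs ht => ?_⟩
  rcases le_total s t with hst | hst
  · rw [abs_of_nonpos (by linarith), neg_sub]
    exact dist_polygonal_le (hv i) (h i) hs hst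
  · rw [abs_of_nonneg (by linarith), dist_comm]
    exact dist_polygonal_le (hv i) (h i) ht hst

/-! ### The grid -/

/-- The coordinate of the `q`-th of `2 * M + 1` lines of mesh `δ` centred at `s`. -/
def gridCoord (s δ : ℝ) (M q : ℕ) : ℝ := s + ((q : ℝ) - M) * δ

/-- The grid point in row `r` and column `q`; the source `S` is in row `M` and column `M`. -/
def gridPt (S : Plane) (δ : ℝ) (M r q : ℕ) : Plane :=
  !₂[gridCoord (S 0) δ M q, gridCoord (S 1) δ M r]

theorem gridPt_center (S : Plane) (δ : ℝ) (M : ℕ) : gridPt S δ M M M = S := by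
  ext j; fin_cases j <;> simp [gridPt, gridCoord]

/-- The last grid line that is not beyond `a`, where `a` is first clamped to the grid. -/
def snap (s δ : ℝ) (M : ℕ) (a : ℝ) : ℕ := min ⌊(a - (s - M * δ)) / δ⌋₊ (2 * M)

theorem snap_lt (s δ : ℝ) (M : ℕ) (a : ℝ) : snap s δ M a < 2 * M + 1 :=
  Nat.lt_succ_of_le (min_le_right _ _)

theorem abs_gridCoord_sub (s δ : ℝ) (hδ : 0 ≤ δ) (M q q' : ℕ) :
    |gridCoord s δ M q - gridCoord s δ M q'| = |(q : ℝ) - q'| * δ := by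
  rw [← abs_of_nonneg hδ, ← abs_mul, abs_of_nonneg hδ]; unfold gridCoord; ring_nf

theorem snap_eq {s δ : ℝ} (hδ : 0 < δ) {M q : ℕ} {a : ℝ} (ha : a ≤ s + M * δ)
    (h1 : gridCoord s δ M q ≤ a) (h2 : a < gridCoord s δ M (q + 1)) : snap s δ M a = q := by
  unfold gridCoord at h1 h2
  push_cast at h2
  have : ⌊(a - (s - M * δ)) / δ⌋₊ = q := by
    rw [Nat.floor_eq_iff (div_nonneg (by nlinarith [(Nat.cast_nonneg q : (0:ℝ) ≤ q)]) hδ.le),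
      le_div_iff₀ hδ, div_lt_iff₀ hδ]
    constructor <;> linarith
  rw [snap, this, min_eq_left]
  have : (q : ℝ) * δ ≤ (2 * M : ℝ) * δ := by linarith
  exact_mod_cast le_of_mul_le_mul_right this hδ

/-- Snapping moves a point of the square covered by the grid by at most `δ`, and clamping does not
increase the distance to such a point. -/
theorem abs_sub_gridCoord_snap_le {s δ : ℝ} (hδ : 0 < δ) {M : ℕ} {a : ℝ} (ha : |a - s| ≤ M * δ)
    (b : ℝ) : |a - gridCoord s δ M (snap s δ M b)| ≤ |a - b| + δ := by
  obtain ⟨h1, h2⟩ := abs_le.1 ha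
  set u := (b - (s - M * δ)) / δ with hu
  have hb : b = s - M * δ + u * δ := by rw [hu]; field_simp; ring
  have hc : gridCoord s δ M (snap s δ M b) = s - M * δ + (snap s δ M b : ℝ) * δ := by
    unfold gridCoord; ring
  have hf1 : u < (⌊u⌋₊ : ℝ) + 1 := Nat.lt_floor_add_one u
  rw [hc, abs_le]
  have hn := neg_abs_le (a - b)
  have hl := le_abs_self (a - b)
  rcases le_total ⌊u⌋₊ (2 * M) with h | h
  · have hs : snap s δ M b = ⌊u⌋₊ := min_eq_left h
    rw [hs]
    constructor
    · rcases le_total 0 u with h0 | h0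
      · have := Nat.floor_le h0
        nlinarith
      · rw [Nat.floor_of_nonpos h0, Nat.cast_zero]; nlinarith [abs_nonneg (a - b)]
    · nlinarith
  · have hs : snap s δ M b = 2 * M := min_eq_right h
    have h0 : 0 ≤ u ∨ ⌊u⌋₊ = 0 := by
      rcases le_total 0 u with h0 | h0
      · exact Or.inl h0
      · exact Or.inr (Nat.floor_of_nonpos h0)
    have hM : (2 * M : ℝ) ≤ ⌊u⌋₊ := by exact_mod_cast h
    rw [hs]; push_cast
    refine ⟨?_, by nlinarith [abs_nonneg (a - b)]⟩
    rcases h0 with h0 | h0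
    · have := Nat.floor_le h0
      nlinarith
    · rw [h0, Nat.cast_zero] at hM
      have : (0:ℝ) ≤ M := Nat.cast_nonneg M
      have : (M:ℝ) = 0 := by linarith
      rw [this] at h1 h2 ⊢
      nlinarith [abs_nonneg (a - b)]

theorem snap_mono {s δ : ℝ} (hδ : 0 < δ) {M : ℕ} : Monotone (snap s δ M) := by
  intro a b hab
  unfold snap
  gcongr

theorem abs_snap_sub_snap_le {s δ : ℝ} (hδ : 0 < δ) {M : ℕ} (a b : ℝ) :
    |gridCoord s δ M (snap s δ M a) - gridCoord s δ M (snap s δ M b)| ≤ |a - b| + δ := by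
  have main : ∀ a b, a ≤ b → ((snap s δ M b : ℝ) - snap s δ M a) * δ ≤ b - a + δ := by
    intro a b hab
    rcases (snap_mono hδ hab : snap s δ M a ≤ snap s δ M b).lt_or_eq with h | h
    swap
    · rw [h]; linarith
    have ha : snap s δ M a = ⌊(a - (s - M * δ)) / δ⌋₊ :=
      min_eq_left (by unfold snap at h; omega)
    have hb : snap s δ M b ≤ ⌊(b - (s - M * δ)) / δ⌋₊ := min_le_left _ _
    have h1 := Nat.lt_floor_add_one ((a - (s - M * δ)) / δ)
    have h2 : ((snap s δ M b : ℕ) : ℝ) ≤ (b - (s - M * δ)) / δ := by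
      have h0 : 0 ≤ (b - (s - M * δ)) / δ := by
        by_contra h0
        rw [Nat.floor_of_nonpos (by linarith)] at hb
        omega
      exact (Nat.cast_le.2 hb).trans (Nat.floor_le h0)
    rw [← ha, div_lt_iff₀ hδ] at h1
    rw [le_div_iff₀ hδ] at h2
    nlinarith
  rw [abs_gridCoord_sub _ _ hδ.le]
  rcases le_total a b with h | h
  · have hm : (snap s δ M a : ℝ) ≤ snap s δ M b := by exact_mod_cast snap_mono hδ h
    rw [abs_of_nonpos (by linarith), abs_of_nonpos (by linarith), neg_sub, neg_sub]
    exact main a b h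
  · have hm : (snap s δ M b : ℝ) ≤ snap s δ M a := by exact_mod_cast snap_mono hδ h
    rw [abs_of_nonneg (by linarith), abs_of_nonneg (by linarith)]
    exact main b a h

/-- The grid point obtained by snapping both coordinates. -/
def snapPt (S : Plane) (δ : ℝ) (M : ℕ) (x : Plane) : Plane :=
  gridPt S δ M (snap (S 1) δ M (x 1)) (snap (S 0) δ M (x 0))

theorem taxi_snapPt_snapPt_le (S : Plane) {δ : ℝ} (hδ : 0 < δ) (M : ℕ) (x y : Plane) :
    taxi (snapPt S δ M x) (snapPt S δ M y) ≤ taxi x y + 2 * δ := by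
  have h0 := abs_snap_sub_snap_le (s := S 0) (M := M) hδ (x 0) (y 0)
  have h1 := abs_snap_sub_snap_le (s := S 1) (M := M) hδ (x 1) (y 1)
  simp only [taxi, snapPt, gridPt, PiLp.toLp_apply, Matrix.cons_val_zero, Matrix.cons_val_one]
  linarith

/-- The square covered by the grid. -/
def InSquare (S : Plane) (δ : ℝ) (M : ℕ) (x : Plane) : Prop :=
  |x 0 - S 0| ≤ M * δ ∧ |x 1 - S 1| ≤ M * δ

theorem taxi_snapPt_le {S : Plane} {δ : ℝ} (hδ : 0 < δ) {M : ℕ} {x : Plane}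
    (hx : InSquare S δ M x) (y : Plane) : taxi x (snapPt S δ M y) ≤ taxi x y + 2 * δ := by
  have h0 := abs_sub_gridCoord_snap_le hδ hx.1 (y 0)
  have h1 := abs_sub_gridCoord_snap_le hδ hx.2 (y 1)
  simp only [taxi, snapPt, gridPt, PiLp.toLp_apply, Matrix.cons_val_zero, Matrix.cons_val_one]
  linarith

/-! ### One round of the dynamic program -/

/-- The earliest time at which a robot of speed `v` starting from `P` can have the message at the
grid point in row `r` and column `q`, if it goes there first and `A` is the table of the times at
which previous robots bring the message to the grid points. At the source it need not wait. -/
def pickupTime (S : Plane) (δ : ℝ) (M : ℕ) (v : ℝ) (P : Plane) (A : ℕ → ℕ → ℝ) (r q : ℕ) : ℝ :=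
  if r = M ∧ q = M then taxi P (gridPt S δ M r q) / v
  else max (A r q) (taxi P (gridPt S δ M r q) / v)

theorem pickupTime_le_max (S : Plane) (δ : ℝ) (M : ℕ) (v : ℝ) (P : Plane) (A : ℕ → ℕ → ℝ)
    (r q : ℕ) :
    pickupTime S δ M v P A r q ≤ max (A r q) (taxi P (gridPt S δ M r q) / v) := by
  unfold pickupTime
  split_ifs
  · exact le_max_right _ _
  · exact le_rfl

theorem taxi_div_le_pickupTime (S : Plane) (δ : ℝ) (M : ℕ) (v : ℝ) (P : Plane) (A : ℕ → ℕ → ℝ)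
    (r q : ℕ) : taxi P (gridPt S δ M r q) / v ≤ pickupTime S δ M v P A r q := by
  unfold pickupTime
  split_ifs
  · exact le_rfl
  · exact le_max_right _ _

/-- `A'` arises from the table `A` of arrival times on the grid by admitting one more robot, of
speed `v` and starting position `P`. Where `A'` improves on `A`, the robot brings the message from
the grid point in row `a r q` and column `b r q`. -/
structure IsRound (S : Plane) (δ : ℝ) (M : ℕ) (v : ℝ) (P : Plane) (A A' : ℕ → ℕ → ℝ)
    (a b : ℕ → ℕ → ℕ) : Prop where
  le_old : ∀ r < 2 * M + 1, ∀ q < 2 * M + 1, A' r q ≤ A r q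
  le_pickup : ∀ r < 2 * M + 1, ∀ q < 2 * M + 1, ∀ r' < 2 * M + 1, ∀ q' < 2 * M + 1,
    A' r q ≤ pickupTime S δ M v P A r' q' + taxi (gridPt S δ M r' q') (gridPt S δ M r q) / v
  source : ∀ r < 2 * M + 1, ∀ q < 2 * M + 1, A' r q < A r q →
    a r q < 2 * M + 1 ∧ b r q < 2 * M + 1 ∧
    pickupTime S δ M v P A (a r q) (b r q) +
      taxi (gridPt S δ M (a r q) (b r q)) (gridPt S δ M r q) / v ≤ A' r q

/-- The tables of arrival times on the grid, where `A k` admits the robots `o 0`, …, `o (k - 1)`.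
Initially no robot has the message, which is expressed by a time exceeding those needed by a single
robot. -/
structure IsTable {n : ℕ} (v : Fin n → ℝ) (p : Fin n → Plane) (S : Plane) (δ : ℝ) (M : ℕ)
    (o : Fin n ≃ Fin n) (A : ℕ → ℕ → ℕ → ℝ) (a b : ℕ → ℕ → ℕ → ℕ) : Prop where
  init : ∀ r < 2 * M + 1, ∀ q < 2 * M + 1, A 0 r q = 4 * M * δ + 1
  round : ∀ k : Fin n, IsRound S δ M (v (o k)) (p (o k)) (A k) (A (k + 1)) (a k) (b k)

namespace IsTable

variable {n : ℕ} {v : Fin n → ℝ} {p : Fin n → Plane} {S D : Plane} {δ : ℝ} {M : ℕ}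
  {o : Fin n ≃ Fin n} {A : ℕ → ℕ → ℕ → ℝ} {a b : ℕ → ℕ → ℕ → ℕ}

theorem antitone (h : IsTable v p S δ M o A a b) {r q : ℕ} (hr : r < 2 * M + 1)
    (hq : q < 2 * M + 1) {k l : ℕ} (hkl : k ≤ l) (hl : l ≤ n) : A l r q ≤ A k r q := by
  induction l, hkl using Nat.le_induction with
  | base => exact le_rfl
  | succ l hkl ih => exact ((h.round ⟨l, hl⟩).le_old r hr q hq).trans (ih (by omega))

theorem snap_self (s : ℝ) (hδ : 0 < δ) : snap s δ M s = M := by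
  apply snap_eq hδ
  · nlinarith [(Nat.cast_nonneg M : (0:ℝ) ≤ M)]
  · simp [gridCoord]
  · simp [gridCoord]; linarith

/-! ### The dynamic program is not slower than any schedule by much more than the factor `√2` -/

/-- Carrying: if robot `o k` can have the message at `z` (up to snapping) by time `√2 * s + E`, then
the table knows this for every point the robot reaches from `z`. -/
theorem le_of_carrier (h : IsTable v p S δ M o A a b) (hδ : 0 < δ) (hv : ∀ i, 1 ≤ v i) {k : Fin n}
    {l : ℕ} (hkl : (k : ℕ) + 1 ≤ l) (hl : l ≤ n) {z x : Plane} {s t E : ℝ}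
    (hz : pickupTime S δ M (v (o k)) (p (o k)) (A k) (snap (S 1) δ M (z 1)) (snap (S 0) δ M (z 0))
      ≤ √2 * s + E)
    (hx : dist z x ≤ v (o k) * (t - s)) :
    A l (snap (S 1) δ M (x 1)) (snap (S 0) δ M (x 0)) ≤ √2 * t + (E + 2 * δ) := by
  have hv0 : 0 < v (o k) := by linarith [hv (o k)]
  have h1 := (h.antitone (snap_lt (S 1) δ M (x 1)) (snap_lt (S 0) δ M (x 0)) hkl hl)
  have h2 := (h.round k).le_pickup _ (snap_lt (S 1) δ M (x 1)) _ (snap_lt (S 0) δ M (x 0))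
    _ (snap_lt (S 1) δ M (z 1)) _ (snap_lt (S 0) δ M (z 0))
  have h3 : taxi (snapPt S δ M z) (snapPt S δ M x) / v (o k) ≤ √2 * (t - s) + 2 * δ := by
    rw [div_le_iff₀ hv0]
    have := taxi_snapPt_snapPt_le S hδ M z x
    have := taxi_le_sqrt_two_mul_dist z x
    have := mul_le_mul_of_nonneg_left hx (Real.sqrt_nonneg 2)
    nlinarith [hv (o k)]
  unfold snapPt at h3
  linarith

/-- The heart of the lower bound. Whoever is informed could be accompanied by a carrier `o k` that
is at least as fast and to which the table attributes the message, up to the factor `√2` and an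
additive error growing with `k` only. A meeting either leaves the carrier in place or replaces it by
a robot later in the order, so at most `n` snapping errors add up. -/
theorem exists_carrier (h : IsTable v p S δ M o A a b) (hδ : 0 < δ) (hv : ∀ i, 1 ≤ v i)
    (ho : Monotone (v ∘ o)) (hp : ∀ i, InSquare S δ M (p i)) {f : Fin n → ℝ → Plane}
    (hf : IsSchedule v p f) {i : Fin n} {t : ℝ} (hi : Informed f S i t) :
    0 ≤ t ∧ ∃ k : Fin n, o.symm i ≤ k ∧ ∃ (s : ℝ) (z : Plane), s ≤ t ∧
      pickupTime S δ M (v (o k)) (p (o k)) (A k) (snap (S 1) δ M (z 1)) (snap (S 0) δ M (z 0))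
        ≤ √2 * s + 2 * δ * k ∧ dist z (f i t) ≤ v (o k) * (t - s) := by
  have hstart : ∀ i t, 0 ≤ t → taxi (p i) (f i t) ≤ v i * (√2 * t) := by
    intro i t ht
    have h1 := (hf i).2 0 t le_rfl ht
    rw [(hf i).1, zero_sub, abs_neg, abs_of_nonneg ht] at h1
    calc _ ≤ √2 * dist (p i) (f i t) := taxi_le_sqrt_two_mul_dist _ _
      _ ≤ √2 * (v i * t) := by gcongr
      _ = _ := by ring
  induction hi with
  | pickup i t ht hS =>
    refine ⟨ht, o.symm i, le_rfl, t, S, le_rfl, ?_, by simp [hS]⟩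
    have hv0 : 0 < v i := by linarith [hv i]
    rw [snap_self _ hδ, snap_self _ hδ, pickupTime, if_pos ⟨rfl, rfl⟩, gridPt_center,
      Equiv.apply_symm_apply, div_le_iff₀ hv0]
    have h1 := hstart i t ht
    rw [hS] at h1
    have : 0 ≤ 2 * δ * ((o.symm i : ℕ) : ℝ) := by positivity
    nlinarith
  | keep i s t _ hst ih =>
    obtain ⟨hs, k, hk, s', z, hs', hz, hd⟩ := ih
    refine ⟨hs.trans hst, k, hk, s', z, hs'.trans hst, hz, ?_⟩
    have h1 := (hf i).2 s t hs (hs.trans hst)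
    rw [abs_of_nonpos (by linarith)] at h1
    have h2 : v i ≤ v (o k) := by simpa using ho hk
    calc dist z (f i t) ≤ dist z (f i s) + dist (f i s) (f i t) := dist_triangle _ _ _
      _ ≤ v (o k) * (s - s') + v (o k) * (t - s) := by
        refine add_le_add hd (h1.trans ?_)
        rw [neg_sub]
        exact mul_le_mul_of_nonneg_right h2 (sub_nonneg.2 hst)
      _ = _ := by ring
  | meet i j t _ hij ih =>
    obtain ⟨ht, k, hk, s, z, hs, hz, hd⟩ := ih
    refine ⟨ht, ?_⟩
    rcases le_or_gt (o.symm j) k with hjk | hjk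
    · exact ⟨k, hjk, s, z, hs, hz, hij ▸ hd⟩
    refine ⟨o.symm j, le_rfl, t, f j t, le_rfl, ?_, by simp⟩
    have hkj : (k : ℕ) + 1 ≤ (o.symm j : ℕ) := hjk
    have hcast : (k : ℝ) + 1 ≤ ((o.symm j : ℕ) : ℝ) := by exact_mod_cast hkj
    have hk0 : (0:ℝ) ≤ k := Nat.cast_nonneg _
    have h1 := h.le_of_carrier hδ hv hkj (o.symm j).2.le hz hd
    rw [hij] at h1
    refine (pickupTime_le_max _ _ _ _ _ _ _ _).trans (max_le ?_ ?_)
    · nlinarith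
    · rw [Equiv.apply_symm_apply, div_le_iff₀ (by linarith [hv j])]
      have h2 := taxi_snapPt_le hδ (hp j) (f j t)
      have h3 := hstart j t ht
      have h4 : 2 * δ * 1 ≤ 2 * δ * ((o.symm j : ℕ) : ℝ) := by
        apply mul_le_mul_of_nonneg_left _ (by positivity); linarith
      unfold snapPt at h2
      nlinarith [hv j]

theorem le_of_deliversAt (h : IsTable v p S δ M o A a b) (hδ : 0 < δ) (hv : ∀ i, 1 ≤ v i)
    (ho : Monotone (v ∘ o)) (hp : ∀ i, InSquare S δ M (p i)) {f : Fin n → ℝ → Plane}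
    (hf : IsSchedule v p f) {t : ℝ} (ht : DeliversAt f S D t) :
    A n (snap (S 1) δ M (D 1)) (snap (S 0) δ M (D 0)) ≤ √2 * t + 2 * δ * n := by
  obtain ⟨i, hi, hD⟩ := ht
  obtain ⟨-, k, -, s, z, -, hz, hd⟩ := h.exists_carrier hδ hv ho hp hf hi
  rw [hD] at hd
  have hk : (k : ℝ) + 1 ≤ n := by exact_mod_cast k.2
  have := h.le_of_carrier hδ hv (Nat.succ_le_of_lt k.2) le_rfl hz hd
  nlinarith

/-- The first robot alone can bring the message to every grid point before the initial value of the
table. -/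
theorem lt_init (h : IsTable v p S δ M o A a b) (hδ : 0 < δ) (hn : 1 ≤ n) (hv : ∀ i, 1 ≤ v i)
    (hp : ∀ i, InSquare S δ M (p i)) {r q : ℕ} (hr : r < 2 * M + 1) (hq : q < 2 * M + 1) :
    A n r q < 4 * M * δ + 1 := by
  have h1 := h.antitone hr hq hn le_rfl
  have h2 := (h.round ⟨0, hn⟩).le_pickup r hr q hq M (by omega) M (by omega)
  set i := o ⟨0, hn⟩
  have hv0 : 0 < v i := by linarith [hv i]
  rw [pickupTime, if_pos ⟨rfl, rfl⟩, gridPt_center, ← add_div, le_div_iff₀ hv0] at h2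
  have h3 : taxi (p i) S ≤ 2 * M * δ := by
    have := (hp i).1; have := (hp i).2; unfold taxi; linarith
  have hc : ∀ s q, q < 2 * M + 1 → |s - gridCoord s δ M q| ≤ M * δ := by
    intro s q hq
    have hq' : (q : ℝ) ≤ 2 * M := by exact_mod_cast Nat.le_of_lt_succ hq
    have hq0 : (0:ℝ) ≤ q := Nat.cast_nonneg q
    unfold gridCoord
    rw [abs_le]; constructor <;> nlinarith
  have h4 : taxi S (gridPt S δ M r q) ≤ 2 * M * δ := by
    have := hc (S 0) q hq; have := hc (S 1) r hr
    simp only [taxi, gridPt, PiLp.toLp_apply, Matrix.cons_val_zero, Matrix.cons_val_one]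
    linarith
  have hM : 0 ≤ 4 * M * δ := by positivity
  by_contra! hcon
  have : (4 * M * δ + 1) * 1 ≤ A (0 + 1) r q * v i := by
    apply mul_le_mul _ (hv i) (by norm_num) <;> linarith
  simp only [zero_add] at *
  linarith

end IsTable

/-! ### Reconstruction of a schedule -/

/-- The state of the backtracking: a grid point, given by row and column, and the place to which the
message has to be brought via that grid point. -/
structure BackState where
  row : ℕ
  col : ℕ
  goal : Plane

/-- Going back by one round. If that round improved the time of the current grid point, its robot is
used, and the message has to be brought to the grid point where it picks up the message. -/
def BackState.prev (S : Plane) (δ : ℝ) (M : ℕ) (A A' : ℕ → ℕ → ℝ) (a b : ℕ → ℕ → ℕ)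
    (x : BackState) : BackState :=
  if A' x.row x.col < A x.row x.col then
    ⟨a x.row x.col, b x.row x.col, gridPt S δ M (a x.row x.col) (b x.row x.col)⟩
  else x

/-- The state after the rounds `n - 1`, …, `n - j` have been undone. -/
def backtrack (n : ℕ) (S : Plane) (δ : ℝ) (M : ℕ) (A : ℕ → ℕ → ℕ → ℝ) (a b : ℕ → ℕ → ℕ → ℕ)
    (x : BackState) : ℕ → BackState
  | 0 => x
  | j + 1 => (backtrack n S δ M A a b x j).prev S δ M (A (n - 1 - j)) (A (n - 1 - j + 1))
      (a (n - 1 - j)) (b (n - 1 - j))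

/-- The waypoints of the robot of a round, when `x` is the state before the round is undone: if the
robot is used, it picks up the message as late as it can and brings it to the goal via the grid
point; otherwise it stays at its starting position `P`. -/
def roundWaypoints (S : Plane) (δ : ℝ) (M : ℕ) (v : ℝ) (P : Plane) (A A' : ℕ → ℕ → ℝ)
    (a b : ℕ → ℕ → ℕ) (x : BackState) : List (ℝ × Plane) :=
  if A' x.row x.col < A x.row x.col then
    [(A' x.row x.col -
        taxi (gridPt S δ M (a x.row x.col) (b x.row x.col)) (gridPt S δ M x.row x.col) / v,
      gridPt S δ M (a x.row x.col) (b x.row x.col)),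
     (A' x.row x.col + taxi (gridPt S δ M x.row x.col) x.goal / v, x.goal)]
  else [(0, P), (0, P)]

theorem feasible_roundWaypoints {S : Plane} {δ : ℝ} {M : ℕ} {v : ℝ} (hv : 0 < v) {P : Plane}
    {A A' : ℕ → ℕ → ℝ} {a b : ℕ → ℕ → ℕ} (h : IsRound S δ M v P A A' a b) {x : BackState}
    (hr : x.row < 2 * M + 1) (hq : x.col < 2 * M + 1) :
    Feasible v 0 P (roundWaypoints S δ M v P A A' a b x) := by
  unfold roundWaypoints
  split_ifs with hlt
  swap
  · simp [Feasible]
  obtain ⟨-, -, h1⟩ := h.source _ hr _ hq hlt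
  have h2 := taxi_div_le_pickupTime S δ M v P A (a x.row x.col) (b x.row x.col)
  set y := gridPt S δ M (a x.row x.col) (b x.row x.col)
  set g := gridPt S δ M x.row x.col
  have h3 : 0 ≤ taxi P y / v := div_nonneg (taxi_nonneg _ _) hv.le
  have h4 : 0 ≤ taxi y g / v := div_nonneg (taxi_nonneg _ _) hv.le
  have h5 : 0 ≤ taxi g x.goal / v := div_nonneg (taxi_nonneg _ _) hv.le
  refine ⟨by simp only; linarith, ?_, by simp only; linarith, ?_, trivial⟩
  · calc dist P y ≤ taxi P y := dist_le_taxi _ _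
      _ = v * (taxi P y / v) := by field_simp
      _ ≤ _ := by apply mul_le_mul_of_nonneg_left _ hv.le; simp only; linarith
  · calc dist y x.goal ≤ taxi y x.goal := dist_le_taxi _ _
      _ ≤ taxi y g + taxi g x.goal := taxi_triangle _ _ _
      _ = _ := by simp only; field_simp; ring

section Backtrack

variable {n : ℕ} {v : Fin n → ℝ} {p : Fin n → Plane} {S D : Plane} {δ : ℝ} {M : ℕ}
  {o : Fin n ≃ Fin n} {A : ℕ → ℕ → ℕ → ℝ} {a b : ℕ → ℕ → ℕ → ℕ}

theorem backtrack_lt (h : IsTable v p S δ M o A a b) {x : BackState} (hr : x.row < 2 * M + 1)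
    (hq : x.col < 2 * M + 1) {j : ℕ} (hj : j ≤ n) :
    (backtrack n S δ M A a b x j).row < 2 * M + 1 ∧
      (backtrack n S δ M A a b x j).col < 2 * M + 1 := by
  induction j with
  | zero => exact ⟨hr, hq⟩
  | succ j ih =>
    obtain ⟨h1, h2⟩ := ih (by omega)
    simp only [backtrack, BackState.prev]
    split_ifs with hlt
    · obtain ⟨h3, h4, -⟩ := (h.round ⟨n - 1 - j, by omega⟩).source _ h1 _ h2 hlt
      exact ⟨h3, h4⟩
    · exact ⟨h1, h2⟩

/-- The waypoints of all robots, when the backtracking starts from the state `x`. -/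
def planWaypoints (v : Fin n → ℝ) (p : Fin n → Plane) (S : Plane) (δ : ℝ) (M : ℕ)
    (o : Fin n ≃ Fin n) (A : ℕ → ℕ → ℕ → ℝ) (a b : ℕ → ℕ → ℕ → ℕ) (x : BackState) (i : Fin n) :
    List (ℝ × Plane) :=
  roundWaypoints S δ M (v i) (p i) (A (o.symm i)) (A (o.symm i + 1)) (a (o.symm i)) (b (o.symm i))
    (backtrack n S δ M A a b x (n - 1 - o.symm i))

theorem feasible_planWaypoints (h : IsTable v p S δ M o A a b) (hv : ∀ i, 1 ≤ v i) {x : BackState}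
    (hr : x.row < 2 * M + 1) (hq : x.col < 2 * M + 1) (i : Fin n) :
    Feasible (v i) 0 (p i) (planWaypoints v p S δ M o A a b x i) := by
  obtain ⟨h1, h2⟩ := backtrack_lt h hr hq (j := n - 1 - o.symm i) (by omega)
  have h3 := h.round (o.symm i)
  rw [Equiv.apply_symm_apply] at h3
  exact feasible_roundWaypoints (by linarith [hv i]) h3 h1 h2

/-- In the reconstructed schedule, the message reaches the goal of every state of the backtracking
within the time that the table gives for its grid point and the way from there to the goal. -/
theorem exists_informed_of_plan (h : IsTable v p S δ M o A a b) (hv : ∀ i, 1 ≤ v i) {x : BackState}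
    (hr : x.row < 2 * M + 1) (hq : x.col < 2 * M + 1) {k : ℕ} (hk : k ≤ n) :
    let y := backtrack n S δ M A a b x (n - k)
    let f := fun i => polygonal 0 (p i) (planWaypoints v p S δ M o A a b x i)
    A k y.row y.col < 4 * M * δ + 1 →
    ∃ i τ, Informed f S i τ ∧ τ ≤ A k y.row y.col + taxi (gridPt S δ M y.row y.col) y.goal ∧
      ∀ t, τ ≤ t → f i t = y.goal := by
  intro y f
  induction k with
  | zero =>
    intro hlt
    obtain ⟨h1, h2⟩ := backtrack_lt h hr hq (j := n - 0) (by omega)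
    exact absurd (h.init _ h1 _ h2) hlt.ne
  | succ k ih =>
    intro hlt
    obtain ⟨hyr, hyq⟩ := backtrack_lt h hr hq (j := n - (k + 1)) (by omega)
    change y.row < _ at hyr
    change y.col < _ at hyq
    have hprev : backtrack n S δ M A a b x (n - k) =
        y.prev S δ M (A k) (A (k + 1)) (a k) (b k) := by
      have e1 : n - k = (n - (k + 1)) + 1 := by omega
      have e2 : n - 1 - (n - (k + 1)) = k := by omega
      rw [e1, backtrack, e2]
    specialize ih (by omega)
    simp only [hprev] at ih
    by_cases hused : A (k + 1) y.row y.col < A k y.row y.col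
    swap
    · have heq : A (k + 1) y.row y.col = A k y.row y.col :=
        le_antisymm ((h.round ⟨k, hk⟩).le_old _ hyr _ hyq) (not_lt.1 hused)
      rw [BackState.prev, if_neg hused] at ih
      rw [heq] at hlt ⊢
      exact ih hlt
    rw [BackState.prev, if_pos hused] at ih
    set i := o ⟨k, hk⟩ with hi
    have hv0 : 0 < v i := by linarith [hv i]
    obtain ⟨hsr, hsq, hs⟩ := (h.round ⟨k, hk⟩).source _ hyr _ hyq hused
    have hfeas := feasible_planWaypoints h hv hr hq i
    have hplan : planWaypoints v p S δ M o A a b x i =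
        roundWaypoints S δ M (v i) (p i) (A k) (A (k + 1)) (a k) (b k) y := by
      have e : n - 1 - k = n - (k + 1) := by omega
      simp only [planWaypoints, hi, Equiv.symm_apply_apply, e, y]
    have hfi : ∀ t, f i t = polygonal 0 (p i) (planWaypoints v p S δ M o A a b x i) t :=
      fun _ => rfl
    rw [hplan] at hfeas
    simp only [hplan] at hfi
    rw [roundWaypoints, if_pos hused] at hfeas hfi
    set c := gridPt S δ M (a k y.row y.col) (b k y.row y.col) with hc
    set g := gridPt S δ M y.row y.col with hg
    set t₁ := A (k + 1) y.row y.col - taxi c g / v i with ht₁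
    set t₂ := A (k + 1) y.row y.col + taxi g y.goal / v i with ht₂
    simp only at hs
    have hat : f i t₁ = c := by
      rw [hfi, polygonal_cons_of_le hfeas le_rfl, polygonal_start hfeas.2.2]
    have ht₁' : pickupTime S δ M (v i) (p i) (A k) (a k y.row y.col) (b k y.row y.col) ≤ t₁ := by
      rw [ht₁]; linarith
    have h0 : 0 ≤ t₁ := hfeas.1
    have hle : t₁ ≤ t₂ := hfeas.2.2.1
    have hinf : Informed f S i t₁ := by
      by_cases hcen : a k y.row y.col = M ∧ b k y.row y.col = M
      · refine .pickup i t₁ h0 ?_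
        rw [hat, hc, hcen.1, hcen.2, gridPt_center]
      · rw [pickupTime, if_neg hcen] at ht₁'
        have h1 : A k (a k y.row y.col) (b k y.row y.col) ≤ t₁ := (le_max_left _ _).trans ht₁'
        have h2 : t₁ ≤ A (k + 1) y.row y.col := by
          have : 0 ≤ taxi c g / v i := div_nonneg (taxi_nonneg _ _) hv0.le
          linarith
        obtain ⟨j, τ, hj, hτ, hstay⟩ := ih (by linarith)
        rw [taxi_self, add_zero] at hτ
        have hτ' : τ ≤ t₁ := hτ.trans h1
        exact .meet j i t₁ (.keep j τ t₁ hj hτ') ((hstay t₁ hτ').trans hat.symm)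
    refine ⟨i, t₂, .keep i t₁ t₂ hinf hle, ?_, fun t ht => ?_⟩
    · have : taxi g y.goal / v i ≤ taxi g y.goal := div_le_self (taxi_nonneg _ _) (hv i)
      rw [ht₂]; linarith
    · rw [hfi, polygonal_cons_of_le hfeas (hle.trans ht), polygonal_cons_of_le hfeas.2.2 ht]
      rfl

/-- Correctness of the output, up to the running time. -/
theorem plan_spec (h : IsTable v p S δ M o A a b) (hδ : 0 < δ) (hn : 1 ≤ n) (hv : ∀ i, 1 ≤ v i)
    (ho : Monotone (v ∘ o)) (hp : ∀ i, InSquare S δ M (p i)) (hD : InSquare S δ M D) :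
    let f := fun i => polygonal 0 (p i) (planWaypoints v p S δ M o A a b
      ⟨snap (S 1) δ M (D 1), snap (S 0) δ M (D 0), D⟩ i)
    IsSchedule v p f ∧
      ∃ t, t ≤ √2 * optEucl v p S D + 2 * δ * (n + 1) ∧ DeliversAt f S D t := by
  intro f
  have hr := snap_lt (S 1) δ M (D 1)
  have hq := snap_lt (S 0) δ M (D 0)
  have hf : IsSchedule v p f := isSchedule_polygonal (fun i => by linarith [hv i])
    fun i => feasible_planWaypoints h hv hr hq i
  refine ⟨hf, ?_⟩
  obtain ⟨i, τ, hi, hτ, hstay⟩ := exists_informed_of_plan h hv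
    (x := ⟨snap (S 1) δ M (D 1), snap (S 0) δ M (D 0), D⟩) hr hq le_rfl
    (by simpa [backtrack] using h.lt_init hδ hn hv hp hr hq)
  simp only [Nat.sub_self, backtrack] at hτ hstay
  have hdel : DeliversAt f S D τ := ⟨i, hi, hstay τ le_rfl⟩
  refine ⟨τ, ?_, hdel⟩
  have h1 : taxi (gridPt S δ M (snap (S 1) δ M (D 1)) (snap (S 0) δ M (D 0))) D ≤ 2 * δ := by
    have := taxi_snapPt_le hδ hD D
    rw [taxi_self, taxi_comm] at this
    unfold snapPt at this
    linarith
  have hs : 0 < √2 := by positivity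
  have h2 : (τ - 2 * δ * (n + 1)) / √2 ≤ optEucl v p S D := by
    refine le_csInf ⟨τ, f, hf, hdel⟩ ?_
    rintro t ⟨f', hf', ht⟩
    rw [div_le_iff₀ hs]
    have := h.le_of_deliversAt hδ hv ho hp hf' ht
    linarith
  rw [div_le_iff₀ hs] at h2
  linarith

end Backtrack

/-! ### Ordering the robots by speed -/

/-- The order of the indices by the values of `x`, ties being broken by the index. -/
def Precedes (x : ℕ → ℝ) (j i : ℕ) : Prop := x j < x i ∨ (¬ x i < x j ∧ j < i)

open Classical in
/-- The number of indices preceding `i` among the first `N`. -/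
def rankBelow (x : ℕ → ℝ) (i N : ℕ) : ℕ := ((Finset.range N).filter fun j => Precedes x j i).card

open Classical in
theorem rankBelow_succ (x : ℕ → ℝ) (i N : ℕ) :
    rankBelow x i (N + 1) = rankBelow x i N + if Precedes x N i then 1 else 0 := by
  unfold rankBelow
  rw [Finset.range_add_one, Finset.filter_insert]
  split_ifs
  · rw [Finset.card_insert_of_notMem (by simp)]
  · rfl

theorem Precedes.irrefl (x : ℕ → ℝ) (i : ℕ) : ¬ Precedes x i i := by simp [Precedes]

theorem Precedes.trans {x : ℕ → ℝ} {i j k : ℕ} (h : Precedes x i j) (h' : Precedes x j k) :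
    Precedes x i k := by
  unfold Precedes at *
  rcases h with h | ⟨h, h1⟩ <;> rcases h' with h' | ⟨h', h1'⟩
  · left; linarith
  · left; linarith
  · left; linarith
  · right; exact ⟨by linarith, by omega⟩

theorem Precedes.total {x : ℕ → ℝ} {i j : ℕ} (h : i ≠ j) : Precedes x i j ∨ Precedes x j i := by
  unfold Precedes
  rcases lt_trichotomy (x i) (x j) with hx | hx | hx
  · exact .inl (.inl hx)
  · rcases h.lt_or_gt with h | h
    · exact .inl (.inr ⟨hx.not_gt, h⟩)
    · exact .inr (.inr ⟨hx.not_lt, h⟩)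
  · exact .inr (.inl hx)

theorem Precedes.rankBelow_lt {x : ℕ → ℝ} {i j N : ℕ} (h : Precedes x i j) (hi : i < N) :
    rankBelow x i N < rankBelow x j N := by
  classical
  apply Finset.card_lt_card
  rw [Finset.ssubset_iff_of_subset]
  · exact ⟨i, by simp [hi, h], by simp [Precedes.irrefl]⟩
  · intro k hk
    simp only [Finset.mem_filter] at hk ⊢
    exact ⟨hk.1, hk.2.trans h⟩

theorem rankBelow_lt (x : ℕ → ℝ) {i N : ℕ} (hi : i < N) : rankBelow x i N < N := by
  classical
  calc _ < (Finset.range N).card := by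
        apply Finset.card_lt_card
        rw [Finset.ssubset_iff_of_subset (Finset.filter_subset _ _)]
        exact ⟨i, by simp [hi], by simp [Precedes.irrefl]⟩
    _ = N := Finset.card_range N

theorem pad_coe {n : ℕ} (x : Fin n → ℝ) (i : Fin n) : pad x i = x i := by simp [pad]

/-- Counting the preceding robots sorts the robots by speed. -/
theorem exists_speed_order {n : ℕ} (v : Fin n → ℝ) :
    ∃ o : Fin n ≃ Fin n, Monotone (v ∘ o) ∧ ∀ i, (o.symm i : ℕ) = rankBelow (pad v) i n := by
  let g : Fin n → Fin n := fun i => ⟨rankBelow (pad v) i n, rankBelow_lt _ i.2⟩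
  have hg : Function.Injective g := by
    intro i j hij
    by_contra hne
    have hij' : rankBelow (pad v) i n = rankBelow (pad v) j n := congrArg Fin.val hij
    rcases Precedes.total (x := pad v) (fun h => hne (Fin.ext h)) with h | h
    · exact (h.rankBelow_lt i.2).ne hij'
    · exact (h.rankBelow_lt j.2).ne' hij'
  let e := Equiv.ofBijective g (Finite.injective_iff_bijective.1 hg)
  refine ⟨e.symm, fun k l hkl => ?_, fun i => rfl⟩
  by_contra! hlt
  have h1 : Precedes (pad v) (e.symm l) (e.symm k) := by
    left; rw [pad_coe, pad_coe]; exact hlt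
  have h2 := h1.rankBelow_lt (e.symm l).2
  have h3 : ∀ i, rankBelow (pad v) (e.symm i) n = (i : ℕ) := fun i =>
    congrArg Fin.val (e.apply_symm_apply i)
  rw [h3, h3] at h2
  exact absurd hkl (not_le.2 h2)

/-! ### Reasoning about programs -/

/-- The arrays of natural numbers that a program may write. -/
def Program.natWrites : Program → List ℕ
  | .skip => []
  | .setNat a _ _ => [a]
  | .setReal _ _ _ => []
  | .seq P Q => P.natWrites ++ Q.natWrites
  | .cond _ P Q => P.natWrites ++ Q.natWrites
  | .loop _ P => P.natWrites

/-- The arrays of real numbers that a program may write. -/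
def Program.realWrites : Program → List ℕ
  | .skip => []
  | .setNat _ _ _ => []
  | .setReal a _ _ => [a]
  | .seq P Q => P.realWrites ++ Q.realWrites
  | .cond _ P Q => P.realWrites ++ Q.realWrites
  | .loop _ P => P.realWrites

/-- The memories `m` and `m'` agree on all arrays that do not occur in `P` as the target of an
assignment. -/
structure Agree (P : Program) (m m' : Memory) : Prop where
  nat : ∀ a, a ∉ P.natWrites → m'.nat a = m.nat a
  real : ∀ a, a ∉ P.realWrites → m'.real a = m.real a

theorem Agree.refl (P : Program) (m : Memory) : Agree P m m := ⟨fun _ _ => rfl, fun _ _ => rfl⟩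

theorem Agree.trans {P : Program} {m m' m'' : Memory} (h : Agree P m m') (h' : Agree P m' m'') :
    Agree P m m'' :=
  ⟨fun a ha => (h'.nat a ha).trans (h.nat a ha), fun a ha => (h'.real a ha).trans (h.real a ha)⟩

theorem Agree.mono {P Q : Program} {m m' : Memory} (h : Agree P m m')
    (h1 : P.natWrites ⊆ Q.natWrites) (h2 : P.realWrites ⊆ Q.realWrites) : Agree Q m m' :=
  ⟨fun a ha => h.nat a fun h => ha (h1 h), fun a ha => h.real a fun h => ha (h2 h)⟩

theorem Runs.agree {P : Program} {m m' : Memory} {k : ℕ} (h : Runs P m m' k) : Agree P m m' := by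
  induction h with
  | skip m => exact .refl _ _
  | setNat a i e m =>
    refine ⟨fun b hb => ?_, fun _ _ => rfl⟩
    simp only [Program.natWrites, List.mem_singleton] at hb
    simp [Memory.writeNat, hb]
  | setReal a i e m =>
    refine ⟨fun _ _ => rfl, fun b hb => ?_⟩
    simp only [Program.realWrites, List.mem_singleton] at hb
    simp [Memory.writeReal, hb]
  | seq _ _ h1 h2 =>
    exact (h1.mono (List.subset_append_left _ _) (List.subset_append_left _ _)).trans
      (h2.mono (List.subset_append_right _ _) (List.subset_append_right _ _))
  | condTrue _ _ h => exact h.mono (List.subset_append_left _ _) (List.subset_append_left _ _)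
  | condFalse _ _ h => exact h.mono (List.subset_append_right _ _) (List.subset_append_right _ _)
  | loopDone _ => exact .refl _ _
  | loopStep _ _ _ h1 h2 => exact ⟨fun a ha => (h2.nat a ha).trans (h1.nat a ha),
      fun a ha => (h2.real a ha).trans (h1.real a ha)⟩

/-- Started in `m`, the program `P` halts within `K` steps in a memory satisfying `Q`. -/
def Reaches (P : Program) (m : Memory) (K : ℕ) (Q : Memory → Prop) : Prop :=
  ∃ m' k, Runs P m m' k ∧ k ≤ K ∧ Q m'

namespace Reaches

variable {P P' : Program} {m : Memory} {K L : ℕ} {Q R : Memory → Prop}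

theorem mono (h : Reaches P m K Q) (hK : K ≤ L) (hQ : ∀ m', Agree P m m' → Q m' → R m') :
    Reaches P m L R := by
  obtain ⟨m', k, h1, h2, h3⟩ := h
  exact ⟨m', k, h1, h2.trans hK, hQ m' h1.agree h3⟩

theorem seq (h : Reaches P m K Q) (h' : ∀ m', Agree P m m' → Q m' → Reaches P' m' L R) :
    Reaches (.seq P P') m (K + L) R := by
  obtain ⟨m', k, h1, h2, h3⟩ := h
  obtain ⟨m'', l, h4, h5, h6⟩ := h' m' h1.agree h3
  exact ⟨m'', k + l, h1.seq h4, by omega, h6⟩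

/-- A loop terminates if each iteration preserves the invariant `I` and decreases `μ`. -/
theorem loop {b : Test} {I : Memory → Prop} {μ : Memory → ℕ} (h0 : I m)
    (h : ∀ m', Agree (.loop b P) m m' → I m' → b.Holds m' →
      Reaches P m' K fun m'' => I m'' ∧ μ m'' < μ m') :
    Reaches (.loop b P) m ((μ m + 1) * (K + b.cost + 1)) fun m' => I m' ∧ ¬ b.Holds m' := by
  have key : ∀ N m', Agree (.loop b P) m m' → I m' → μ m' ≤ N →
      Reaches (.loop b P) m' ((N + 1) * (K + b.cost + 1)) fun m' => I m' ∧ ¬ b.Holds m' := by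
    intro N
    induction N with
    | zero =>
      intro m' hA hI hμ
      by_cases hb : b.Holds m'
      · obtain ⟨_, _, _, _, _, h4⟩ := h m' hA hI hb
        omega
      · exact ⟨m', _, .loopDone hb, by omega, hI, hb⟩
    | succ N ih =>
      intro m' hA hI hμ
      by_cases hb : b.Holds m'
      · obtain ⟨m'', k, h1, h2, h3, h4⟩ := h m' hA hI hb
        obtain ⟨m₃, l, h5, h6, h7⟩ := ih m'' (hA.trans (h1.agree.mono (List.Subset.refl _)
          (List.Subset.refl _))) h3 (by omega)
        refine ⟨m₃, _, .loopStep hb h1 h5, ?_, h7⟩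
        rw [Nat.succ_mul (N + 1)]
        omega
      · exact ⟨m', _, .loopDone hb, by nlinarith, hI, hb⟩
  exact key _ m (.refl _ _) h0 le_rfl

end Reaches

/-- Programs without loops. -/
def Program.LoopFree : Program → Prop
  | .seq P Q => P.LoopFree ∧ Q.LoopFree
  | .cond _ P Q => P.LoopFree ∧ Q.LoopFree
  | .loop _ _ => False
  | _ => True

open Classical in
/-- The memory after running a loop-free program. -/
def Program.result : Program → Memory → Memory
  | .skip, m => m
  | .setNat a i e, m => m.writeNat a (i.eval m) (e.eval m)
  | .setReal a i e, m => m.writeReal a (i.eval m) (e.eval m)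
  | .seq P Q, m => Q.result (P.result m)
  | .cond b P Q, m => if b.Holds m then P.result m else Q.result m
  | .loop _ _, m => m

theorem Program.result_seq (P Q : Program) (m : Memory) :
    (Program.seq P Q).result m = Q.result (P.result m) := rfl

theorem Program.result_cond {b : Test} {P Q : Program} {m : Memory} {p : Prop} [Decidable p]
    (h : b.Holds m ↔ p) :
    (Program.cond b P Q).result m = if p then P.result m else Q.result m := by
  by_cases hp : p
  · rw [if_pos hp, Program.result, if_pos (h.2 hp)]
  · rw [if_neg hp, Program.result, if_neg fun hb => hp (h.1 hb)]

/-- A bound for the number of steps of a loop-free program. -/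
def Program.cost : Program → ℕ
  | .skip => 1
  | .setNat _ i e => i.cost + e.cost + 1
  | .setReal _ i e => i.cost + e.cost + 1
  | .seq P Q => P.cost + Q.cost
  | .cond b P Q => b.cost + (P.cost + Q.cost) + 1
  | .loop _ _ => 0

theorem Program.LoopFree.exists_runs {P : Program} (h : P.LoopFree) (m : Memory) :
    ∃ k ≤ P.cost, Runs P m (P.result m) k := by
  induction P generalizing m with
  | skip => exact ⟨_, le_rfl, .skip m⟩
  | setNat a i e => exact ⟨_, le_rfl, .setNat a i e m⟩
  | setReal a i e => exact ⟨_, le_rfl, .setReal a i e m⟩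
  | seq P Q hP hQ =>
    obtain ⟨k, hk, h1⟩ := hP h.1 m
    obtain ⟨l, hl, h2⟩ := hQ h.2 (P.result m)
    exact ⟨k + l, add_le_add hk hl, h1.seq h2⟩
  | cond b P Q hP hQ =>
    by_cases hb : b.Holds m
    · obtain ⟨k, hk, h1⟩ := hP h.1 m
      refine ⟨_, ?_, by simpa only [Program.result, if_pos hb] using Runs.condTrue (Q := Q) hb h1⟩
      simp only [Program.cost]; omega
    · obtain ⟨k, hk, h1⟩ := hQ h.2 m
      refine ⟨_, ?_, by simpa only [Program.result, if_neg hb] using Runs.condFalse (P := P) hb h1⟩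
      simp only [Program.cost]; omega
  | loop b P => exact absurd h not_false

theorem Program.LoopFree.reaches {P : Program} (h : P.LoopFree) {m : Memory} {Q : Memory → Prop}
    (hQ : Q (P.result m)) : Reaches P m P.cost Q := by
  obtain ⟨k, hk, h1⟩ := h.exists_runs m
  exact ⟨_, k, h1, hk, hQ⟩

theorem Program.LoopFree.agree {P : Program} (h : P.LoopFree) (m : Memory) :
    Agree P m (P.result m) := by
  obtain ⟨k, -, h1⟩ := h.exists_runs m
  exact h1.agree

/-- A scalar variable of type `ℕ`, kept in cell `0` of an array of its own. -/
abbrev NatExpr.var (a : ℕ) : NatExpr := .read a (.lit 0)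

/-- A scalar variable of type `ℝ`, kept in cell `0` of an array of its own. -/
abbrev RealExpr.var (a : ℕ) : RealExpr := .read a (.lit 0)

/-- `forLoop x e P` runs `P` for the values `0`, …, `e - 1` of the variable `x`. -/
def forLoop (x : ℕ) (e : NatExpr) (P : Program) : Program :=
  .seq (.setNat x (.lit 0) (.lit 0))
    (.loop (.natLt (.var x) e) (.seq P (.setNat x (.lit 0) (.add (.var x) (.lit 1)))))

theorem Reaches.forLoop {x : ℕ} {e : NatExpr} {P : Program} {m : Memory} {T K : ℕ}
    {I : ℕ → Memory → Prop} (hx : x ∉ P.natWrites)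
    (he : ∀ m', Agree (forLoop x e P) m m' → e.eval m' = T)
    (h0 : I 0 (m.writeNat x 0 0))
    (hstep : ∀ j m', j < T → Agree (PonyExpress.forLoop x e P) m m' → m'.nat x 0 = j → I j m' →
      Reaches P m' K fun m'' => I (j + 1) (m''.writeNat x 0 (j + 1))) :
    Reaches (PonyExpress.forLoop x e P) m ((T + 1) * (K + e.cost + 10) + 3) (I T) := by
  have hw : x ∈ (PonyExpress.forLoop x e P).natWrites := by
    simp [PonyExpress.forLoop, Program.natWrites]
  have hA0 : Agree (PonyExpress.forLoop x e P) m (m.writeNat x 0 0) :=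
    ⟨fun a ha => by
      have : a ≠ x := fun h => ha (h ▸ hw)
      simp [Memory.writeNat, this], fun _ _ => rfl⟩
  have h1 : Reaches (.setNat x (.lit 0) (.lit 0)) m 3 fun m' => m' = m.writeNat x 0 0 :=
    ⟨_, _, .setNat x (.lit 0) (.lit 0) m, le_rfl, rfl⟩
  refine (h1.seq (L := (T + 1) * ((K + 6) + (e.cost + 3) + 1)) fun m₁ _ hm₁ => ?_).mono
    ?_ fun _ _ h => h
  · subst hm₁
    have h2 := Reaches.loop (b := .natLt (.var x) e)
      (P := .seq P (.setNat x (.lit 0) (.add (.var x) (.lit 1)))) (m := m.writeNat x 0 0)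
      (K := K + 6) (I := fun m' => m'.nat x 0 ≤ T ∧ I (m'.nat x 0) m')
      (μ := fun m' => T - m'.nat x 0)
      ⟨by simp [Memory.writeNat], by simpa [Memory.writeNat] using h0⟩ ?_
    · refine h2.mono ?_ ?_
      · refine Nat.mul_le_mul (by simp [Memory.writeNat]) ?_
        simp only [Test.cost, NatExpr.cost]; omega
      · rintro m' hA ⟨⟨h3, h4⟩, h5⟩
        have hA' : Agree (PonyExpress.forLoop x e P) m m' := hA0.trans
          (hA.mono (by simp [PonyExpress.forLoop, Program.natWrites])
            (by simp [PonyExpress.forLoop, Program.realWrites]))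
        simp only [Test.Holds, NatExpr.eval, he m' hA', not_lt] at h5
        rwa [le_antisymm h3 h5] at h4
    · rintro m' hA ⟨h3, h4⟩ hb
      have hA' : Agree (PonyExpress.forLoop x e P) m m' := hA0.trans
        (hA.mono (by simp [PonyExpress.forLoop, Program.natWrites])
          (by simp [PonyExpress.forLoop, Program.realWrites]))
      simp only [Test.Holds, NatExpr.eval, he m' hA'] at hb
      refine (hstep _ m' hb hA' rfl h4).seq fun m₂ hA₂ h5 => ?_
      refine ⟨_, _, .setNat x (.lit 0) (.add (.var x) (.lit 1)) m₂, by simp [NatExpr.cost], ?_⟩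
      have h6 : m₂.nat x 0 = m'.nat x 0 := by rw [hA₂.nat x hx]
      simp only [NatExpr.eval, h6]
      refine ⟨⟨by simpa [Memory.writeNat] using hb, by simpa [Memory.writeNat] using h5⟩, ?_⟩
      simp only [Memory.writeNat, Function.update_self]
      omega
  · have : (T + 1) * ((K + 6) + (e.cost + 3) + 1) ≤ (T + 1) * (K + e.cost + 10) :=
      Nat.mul_le_mul_left _ (by omega)
    omega

/-! ### Loops over the grid -/

/-- Runs `P` for all rows `0`, …, `W - 1` in variable `6` and all columns `0`, …, `W - 1` in
variable `7`, where the width `W` is in variable `3`. -/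
def gridLoop (P : Program) : Program := forLoop 6 (.var 3) (forLoop 7 (.var 3) P)

theorem Reaches.gridLoop {P : Program} {m : Memory} {W K : ℕ} {I : ℕ → ℕ → Memory → Prop}
    (hP : ∀ a ∈ [3, 6, 7], a ∉ P.natWrites) (hW : m.nat 3 0 = W)
    (hI : ∀ r q m' a y, I r q m' → a = 6 ∨ a = 7 → I r q (m'.writeNat a 0 y))
    (hrow : ∀ r m', I r W m' → I (r + 1) 0 m')
    (h0 : I 0 0 m)
    (hstep : ∀ r q m', r < W → q < W → Agree (gridLoop P) m m' → m'.nat 6 0 = r → m'.nat 7 0 = q →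
      I r q m' → Reaches P m' K (I r (q + 1))) :
    Reaches (PonyExpress.gridLoop P) m ((W + 1) ^ 2 * (K + 30)) (I W 0) := by
  have h3 : ∀ m', Agree (PonyExpress.gridLoop P) m m' → m'.nat 3 0 = W := by
    intro m' hA
    rw [hA.nat 3 (by
      have := hP 3 (by simp)
      simp [PonyExpress.gridLoop, PonyExpress.forLoop, Program.natWrites, this]), hW]
  have hsubN : (PonyExpress.forLoop 7 (.var 3) P).natWrites ⊆
      (PonyExpress.gridLoop P).natWrites := by
    intro a
    simp only [PonyExpress.gridLoop, PonyExpress.forLoop, Program.natWrites, List.mem_append]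
    tauto
  have hsubR : (PonyExpress.forLoop 7 (.var 3) P).realWrites ⊆
      (PonyExpress.gridLoop P).realWrites := by
    intro a
    simp only [PonyExpress.gridLoop, PonyExpress.forLoop, Program.realWrites, List.mem_append]
    tauto
  refine (Reaches.forLoop (T := W) (K := (W + 1) * (K + 2 + 10) + 3) (I := fun r => I r 0)
    (by
      have := hP 6 (by simp)
      simp [PonyExpress.forLoop, Program.natWrites, this])
    (fun m' hA => h3 m' hA) (hI _ _ _ _ _ h0 (.inl rfl)) ?_).mono ?_ fun _ _ h => h
  · intro r m₁ hr hA₁ hr₁ hI₁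
    refine (Reaches.forLoop (T := W) (K := K) (e := .var 3) (I := I r) (x := 7) (m := m₁)
      (P := P) (hP 7 (by simp)) ?_ (hI _ _ _ _ _ hI₁ (.inr rfl)) ?_).mono le_rfl fun m₂ _ h =>
        hI _ _ _ _ _ (hrow r _ h) (.inl rfl)
    · intro m₂ hA₂
      exact h3 m₂ (hA₁.trans (hA₂.mono hsubN hsubR))
    · intro q m₂ hq hA₂ hq₂ hI₂
      refine (hstep r q m₂ hr hq (hA₁.trans (hA₂.mono hsubN hsubR)) ?_ hq₂ hI₂).mono le_rfl
        fun _ _ h => hI _ _ _ _ _ h (.inr rfl)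
      · rw [hA₂.nat 6 (by
          have := hP 6 (by simp)
          simp [PonyExpress.forLoop, Program.natWrites, this]), hr₁]
  · simp only [NatExpr.cost]
    nlinarith

/-- The cell of a matrix with `W` columns in row `r` and column `q`. -/
def ix (W r q : ℕ) : ℕ := r * W + q

theorem ix_inj {W r q r' q' : ℕ} (hq : q < W) (hq' : q' < W) (h : ix W r q = ix W r' q') :
    r = r' ∧ q = q' := by
  unfold ix at h
  have hW : 0 < W := by omega
  have h1 : r = r' := by
    have := congrArg (· / W) h
    simpa [Nat.mul_comm _ W, Nat.mul_add_div hW, Nat.div_eq_of_lt hq,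
      Nat.div_eq_of_lt hq'] using this
  subst h1
  exact ⟨rfl, by omega⟩

theorem ix_lt {W r q R : ℕ} (hr : r < R) (hq : q < W) : ix W r q < R * W := by
  unfold ix
  calc r * W + q < r * W + W := by omega
    _ = (r + 1) * W := by ring
    _ ≤ R * W := Nat.mul_le_mul_right _ hr

/-- The cell of the table of round `k` for the grid point in row `r` and column `q`. -/
def tix (W k r q : ℕ) : ℕ := ix W (ix W k r) q

theorem tix_inj {W k r q k' r' q' : ℕ} (hr : r < W) (hr' : r' < W) (hq : q < W) (hq' : q' < W)
    (h : tix W k r q = tix W k' r' q') : k = k' ∧ r = r' ∧ q = q' := by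
  obtain ⟨h1, h2⟩ := ix_inj hq hq' h
  obtain ⟨h3, h4⟩ := ix_inj hr hr' h1
  exact ⟨h3, h4, h2⟩

/-! ### Expressions for grid points and cells

The program uses the following memory besides the arrays for input and output. Variables and arrays
of natural numbers: `2` for `M`, `3` for the width `2 * M + 1` of the grid, `4` for the order of the
robots, `5`, `6`, `7` for loop counters, `8` and `9` for the rows and columns of the sources in the
current round, `10` and `11` for those in all rounds, `12` for the current robot, `13` and `14` for
the current row and column of the backtracking, `15` for ranks, `16`, `17`, `20`, `21`, `22` for
auxiliary values. Variables and arrays of real numbers: `7` for the mesh `δ`, `8` for the arrival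
times of the current round, `9` for those of all rounds, `10` and `11` for auxiliary values, `12`
and `13` for the goal of the backtracking. -/

/-- The horizontal coordinate of column `q`. -/
def coordX (q : NatExpr) : RealExpr :=
  .add (.read 0 (.lit 1)) (.mul (.sub (.ofNat q) (.ofNat (.var 2))) (.var 7))

/-- The vertical coordinate of row `r`. -/
def coordY (r : NatExpr) : RealExpr :=
  .add (.read 0 (.lit 2)) (.mul (.sub (.ofNat r) (.ofNat (.var 2))) (.var 7))

/-- The cell of row `r` and column `q`. -/
def cellE (r q : NatExpr) : NatExpr := .add (.mul r (.var 3)) q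

/-- The cell of row `r` and column `q` in the table of round `k`. -/
def tableE (k r q : NatExpr) : NatExpr := cellE (cellE k r) q

/-- The memory contains the parameters of the grid. -/
structure GridCtx (S : Plane) (δ : ℝ) (M : ℕ) (m : Memory) : Prop where
  sourceX : m.real 0 1 = S 0
  sourceY : m.real 0 2 = S 1
  half : m.nat 2 0 = M
  width : m.nat 3 0 = 2 * M + 1
  mesh : m.real 7 0 = δ

section

variable {S : Plane} {δ : ℝ} {M : ℕ} {m m' : Memory}

theorem GridCtx.congr (h : GridCtx S δ M m) (hn : ∀ a ∈ [2, 3], m'.nat a = m.nat a)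
    (hr : ∀ a ∈ [0, 7], m'.real a = m.real a) : GridCtx S δ M m' where
  sourceX := by rw [hr 0 (by decide), h.sourceX]
  sourceY := by rw [hr 0 (by decide), h.sourceY]
  half := by rw [hn 2 (by decide), h.half]
  width := by rw [hn 3 (by decide), h.width]
  mesh := by rw [hr 7 (by decide), h.mesh]

theorem GridCtx.eval_coordX (h : GridCtx S δ M m) (q : NatExpr) :
    (coordX q).eval m = gridCoord (S 0) δ M (q.eval m) := by
  simp [coordX, RealExpr.eval, NatExpr.eval, h.sourceX, h.half, h.mesh, gridCoord]

theorem GridCtx.eval_coordY (h : GridCtx S δ M m) (r : NatExpr) :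
    (coordY r).eval m = gridCoord (S 1) δ M (r.eval m) := by
  simp [coordY, RealExpr.eval, NatExpr.eval, h.sourceY, h.half, h.mesh, gridCoord]

theorem GridCtx.eval_cellE (h : GridCtx S δ M m) (r q : NatExpr) :
    (cellE r q).eval m = ix (2 * M + 1) (r.eval m) (q.eval m) := by
  simp [cellE, NatExpr.eval, h.width, ix]

theorem GridCtx.eval_tableE (h : GridCtx S δ M m) (k r q : NatExpr) :
    (tableE k r q).eval m = tix (2 * M + 1) (k.eval m) (r.eval m) (q.eval m) := by
  rw [tableE, h.eval_cellE, h.eval_cellE, tix]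

end

/-- Stores `|x - y|` in the real variable `a`. -/
def absDiff (a : ℕ) (x y : RealExpr) : Program :=
  .cond (.realLt x y) (.setReal a (.lit 0) (.sub y x)) (.setReal a (.lit 0) (.sub x y))

theorem result_absDiff (a : ℕ) (x y : RealExpr) (m : Memory) :
    (absDiff a x y).result m = m.writeReal a 0 |x.eval m - y.eval m| := by
  rw [absDiff, Program.result_cond (p := x.eval m < y.eval m) Iff.rfl]
  simp only [Program.result, RealExpr.eval, NatExpr.eval]
  split_ifs with h
  · rw [abs_of_neg (by linarith), neg_sub]
  · rw [abs_of_nonneg (by linarith)]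

/-- Stores the taxicab distance of `(x, y)` and `(x', y')` in the real variable `10`. -/
def distTo (x y x' y' : RealExpr) : Program :=
  .seq (absDiff 10 x x') (.seq (absDiff 11 y y') (.setReal 10 (.lit 0) (.add (.var 10) (.var 11))))

theorem result_distTo {x y x' y' : RealExpr} {m : Memory}
    (hy : ∀ z, y.eval (m.writeReal 10 0 z) = y.eval m)
    (hy' : ∀ z, y'.eval (m.writeReal 10 0 z) = y'.eval m) :
    (distTo x y x' y').result m = (m.writeReal 11 0 |y.eval m - y'.eval m|).writeReal 10 0
      (|x.eval m - x'.eval m| + |y.eval m - y'.eval m|) := by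
  simp only [distTo, Program.result, result_absDiff, hy, hy', NatExpr.eval, RealExpr.eval]
  simp only [Memory.writeReal]
  congr 1
  funext a
  by_cases ha : a = 10
  · subst ha; funext c; by_cases hc : c = 0 <;> simp [Function.update, hc]
  · by_cases ha' : a = 11
    · subst ha'; simp
    · simp [ha, ha']

/-! ### One round of the program -/

/-- The memory contains the data of round `k`, whose robot has speed `v` and starts from `P`. -/
structure RoundCtx (S : Plane) (δ : ℝ) (M : ℕ) (v : ℝ) (P : Plane) (k : ℕ) (m : Memory) : Prop
    extends GridCtx S δ M m where
  round : m.nat 5 0 = k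
  speed : m.real 1 (m.nat 12 0) = v
  posX : m.real 2 (m.nat 12 0) = P 0
  posY : m.real 3 (m.nat 12 0) = P 1

/-- The speed of the current robot. -/
abbrev speedE : RealExpr := .read 1 (.var 12)

/-- The pickup time of the current robot at the current grid point becomes its first arrival time,
with that grid point as its source. -/
def initCell : Program :=
  .seq (distTo (.read 2 (.var 12)) (.read 3 (.var 12)) (coordX (.var 7)) (coordY (.var 6)))
  (.seq
    (.cond
      (.and (.natLt (.lit 0) (.add (.add (.sub (.var 6) (.var 2)) (.sub (.var 2) (.var 6)))
          (.add (.sub (.var 7) (.var 2)) (.sub (.var 2) (.var 7)))))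
        (.realLt (.div (.var 10) speedE) (.read 9 (tableE (.var 5) (.var 6) (.var 7)))))
      (.setReal 8 (cellE (.var 6) (.var 7)) (.read 9 (tableE (.var 5) (.var 6) (.var 7))))
      (.setReal 8 (cellE (.var 6) (.var 7)) (.div (.var 10) speedE)))
    (.seq (.setNat 8 (cellE (.var 6) (.var 7)) (.var 6))
      (.setNat 9 (cellE (.var 6) (.var 7)) (.var 7))))

/-- Replaces the arrival time in cell `c` (variable `20`) by that of the adjacent cell `c'`
(variable `21`) plus the time for one step, if this is an improvement; the source is passed on as
well. -/
def relax : Program :=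
  .cond (.realLt (.add (.read 8 (.var 21)) (.div (.var 7) speedE)) (.read 8 (.var 20)))
    (.seq (.setReal 8 (.var 20) (.add (.read 8 (.var 21)) (.div (.var 7) speedE)))
      (.seq (.setNat 8 (.var 20) (.read 8 (.var 21))) (.setNat 9 (.var 20) (.read 9 (.var 21)))))
    .skip

/-- Relaxation of cell `c` from cell `c'`. -/
def relaxFrom (c c' : NatExpr) : Program :=
  .seq (.setNat 20 (.lit 0) c) (.seq (.setNat 21 (.lit 0) c') relax)

/-- Relaxation of the current cell from the previous column and the previous row, where rows and
columns are renumbered by `φ`. -/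
def sweepCell (φ : NatExpr → NatExpr) : Program :=
  .seq
    (.cond (.natLt (.lit 0) (.var 7))
      (relaxFrom (cellE (φ (.var 6)) (φ (.var 7)))
        (cellE (φ (.var 6)) (φ (.sub (.var 7) (.lit 1)))))
      .skip)
    (.cond (.natLt (.lit 0) (.var 6))
      (relaxFrom (cellE (φ (.var 6)) (φ (.var 7)))
        (cellE (φ (.sub (.var 6) (.lit 1))) (φ (.var 7))))
      .skip)

/-- The reversal of the numbering of rows or columns. -/
def flipE (e : NatExpr) : NatExpr := .sub (.mul (.lit 2) (.var 2)) e

/-- Enters the minimum of the old and the new arrival time, and the source, into the table. -/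
def storeCell : Program :=
  .seq (.setNat 10 (tableE (.var 5) (.var 6) (.var 7)) (.read 8 (cellE (.var 6) (.var 7))))
  (.seq (.setNat 11 (tableE (.var 5) (.var 6) (.var 7)) (.read 9 (cellE (.var 6) (.var 7))))
  (.cond (.realLt (.read 8 (cellE (.var 6) (.var 7)))
      (.read 9 (tableE (.var 5) (.var 6) (.var 7))))
    (.setReal 9 (tableE (.add (.var 5) (.lit 1)) (.var 6) (.var 7))
      (.read 8 (cellE (.var 6) (.var 7))))
    (.setReal 9 (tableE (.add (.var 5) (.lit 1)) (.var 6) (.var 7))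
      (.read 9 (tableE (.var 5) (.var 6) (.var 7))))))

/-- One round of the dynamic program, for the robot of rank `k` (variable `5`): the arrival times
are the taxicab distance transform of the pickup times, computed by a forward and a backward sweep.
-/
def roundProgram : Program :=
  .seq (.setNat 12 (.lit 0) (.read 4 (.var 5)))
  (.seq (gridLoop initCell)
  (.seq (gridLoop (sweepCell id))
  (.seq (gridLoop (sweepCell flipE)) (gridLoop storeCell))))

section

variable {S : Plane} {δ : ℝ} {M : ℕ} {v : ℝ} {P : Plane} {k : ℕ} {m m' : Memory}

theorem RoundCtx.congr (h : RoundCtx S δ M v P k m)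
    (hn : ∀ a ∈ [2, 3, 5, 12], m'.nat a = m.nat a)
    (hr : ∀ a ∈ [0, 1, 2, 3, 7], m'.real a = m.real a) : RoundCtx S δ M v P k m' where
  toGridCtx := h.toGridCtx.congr (fun a ha => hn a (by revert ha; revert a; decide))
    (fun a ha => hr a (by revert ha; revert a; decide))
  round := by rw [hn 5 (by decide), h.round]
  speed := by rw [hr 1 (by decide), hn 12 (by decide), h.speed]
  posX := by rw [hr 2 (by decide), hn 12 (by decide), h.posX]
  posY := by rw [hr 3 (by decide), hn 12 (by decide), h.posY]

theorem RoundCtx.of_agree {Q : Program} (h : RoundCtx S δ M v P k m) (hA : Agree Q m m')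
    (hn : ∀ a ∈ [2, 3, 5, 12], a ∉ Q.natWrites)
    (hr : ∀ a ∈ [0, 1, 2, 3, 7], a ∉ Q.realWrites) : RoundCtx S δ M v P k m' :=
  h.congr (fun a ha => hA.nat a (hn a ha)) fun a ha => hA.real a (hr a ha)

theorem initCell_spec (h : RoundCtx S δ M v P k m) {r q : ℕ} (hr : m.nat 6 0 = r)
    (hq : m.nat 7 0 = q) :
    (initCell.result m).real 8 = Function.update (m.real 8) (ix (2 * M + 1) r q)
        (pickupTime S δ M v P (fun r q => m.real 9 (tix (2 * M + 1) k r q)) r q) ∧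
      (initCell.result m).nat 8 = Function.update (m.nat 8) (ix (2 * M + 1) r q) r ∧
      (initCell.result m).nat 9 = Function.update (m.nat 9) (ix (2 * M + 1) r q) q := by
  set d := taxi P (gridPt S δ M r q) with hd
  obtain ⟨d', hm₁⟩ : ∃ d', (distTo (.read 2 (.var 12)) (.read 3 (.var 12)) (coordX (.var 7))
      (coordY (.var 6))).result m = (m.writeReal 11 0 d').writeReal 10 0 d := by
    rw [result_distTo (fun _ => rfl) (fun _ => rfl)]
    refine ⟨|P 1 - gridCoord (S 1) δ M r|, ?_⟩
    rw [h.eval_coordX, h.eval_coordY]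
    simp only [RealExpr.eval, NatExpr.eval, h.posX, h.posY, hr, hq, hd, taxi, gridPt,
      PiLp.toLp_apply, Matrix.cons_val_zero, Matrix.cons_val_one]
  set m₁ := (m.writeReal 11 0 d').writeReal 10 0 d with hm₁'
  have h1 : RoundCtx S δ M v P k m₁ := h.congr (fun _ _ => rfl) (by
    intro a ha
    have : a ≠ 10 ∧ a ≠ 11 := by revert ha; revert a; decide
    simp [m₁, Memory.writeReal, this])
  have h10 : m₁.real 10 0 = d := by simp [m₁, Memory.writeReal]
  have h8 : m₁.real 8 = m.real 8 := by simp [m₁, Memory.writeReal]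
  have h9 : m₁.real 9 = m.real 9 := by simp [m₁, Memory.writeReal]
  have hn : m₁.nat = m.nat := rfl
  have hcell : ∀ m₂ : Memory, m₂.nat 6 = m.nat 6 → m₂.nat 7 = m.nat 7 → m₂.nat 3 = m.nat 3 →
      (cellE (.var 6) (.var 7)).eval m₂ = ix (2 * M + 1) r q := by
    intro m₂ h6 h7 h3
    simp [cellE, NatExpr.eval, h6, h7, h3, hr, hq, h.width, ix]
  have hc₁ := hcell m₁ rfl rfl rfl
  have ht₁ : (tableE (.var 5) (.var 6) (.var 7)).eval m₁ = tix (2 * M + 1) k r q := by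
    rw [h1.eval_tableE]
    simp only [NatExpr.eval, h1.round, hn, hr, hq]
  have hoff : 0 < r - M + (M - r) + (q - M + (M - q)) ↔ ¬ (r = M ∧ q = M) := by omega
  have hs₁ : m₁.real 1 (m.nat 12 0) = v := h1.speed
  have e0 : (initCell.result m) =
      ((m₁.writeReal 8 (ix (2 * M + 1) r q)
        (pickupTime S δ M v P (fun r q => m.real 9 (tix (2 * M + 1) k r q)) r q)).writeNat 8
          (ix (2 * M + 1) r q) r).writeNat 9 (ix (2 * M + 1) r q) q := by
    rw [initCell, Program.result_seq, hm₁, Program.result_seq, Program.result_cond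
      (p := ¬ (r = M ∧ q = M) ∧ d / v < m.real 9 (tix (2 * M + 1) k r q)) (by
        simp only [Test.Holds, NatExpr.eval, RealExpr.eval, h10, hs₁, ht₁, hn, hr, hq, h.half,
          hoff, h9])]
    have e1 : (if ¬ (r = M ∧ q = M) ∧ d / v < m.real 9 (tix (2 * M + 1) k r q) then
          (Program.setReal 8 (cellE (.var 6) (.var 7))
            (.read 9 (tableE (.var 5) (.var 6) (.var 7)))).result m₁
        else (Program.setReal 8 (cellE (.var 6) (.var 7)) (.div (.var 10) speedE)).result m₁) =
        m₁.writeReal 8 (ix (2 * M + 1) r q)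
          (pickupTime S δ M v P (fun r q => m.real 9 (tix (2 * M + 1) k r q)) r q) := by
      unfold pickupTime
      rw [← hd]
      simp only [Program.result, RealExpr.eval, hc₁, ht₁, h9, NatExpr.eval, h10, h1.speed]
      split_ifs with h2 h3 h3
      · exact absurd h3 h2.1
      · rw [max_eq_left h2.2.le]
      · rfl
      · rw [max_eq_right (not_lt.1 fun hlt => h2 ⟨h3, hlt⟩)]
    rw [e1]
    generalize pickupTime S δ M v P _ r q = X
    have e2 := hcell (m₁.writeReal 8 (ix (2 * M + 1) r q) X) rfl rfl rfl
    have e3 := hcell ((m₁.writeReal 8 (ix (2 * M + 1) r q) X).writeNat 8 (ix (2 * M + 1) r q) r)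
      rfl rfl rfl
    have e4 : (NatExpr.var 6).eval (m₁.writeReal 8 (ix (2 * M + 1) r q) X) = r := hr
    have e5 : (NatExpr.var 7).eval ((m₁.writeReal 8 (ix (2 * M + 1) r q) X).writeNat 8
      (ix (2 * M + 1) r q) r) = q := hq
    simp only [Program.result, e2, e3, e4, e5]
  rw [e0]
  simp [Memory.writeReal, Memory.writeNat, hn, h8]

end

section

variable {S : Plane} {δ : ℝ} {M : ℕ} {v : ℝ} {P : Plane} {k : ℕ} {m m' : Memory}

/-- The effect of relaxing cell `C` from cell `C'` with step time `w`. -/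
structure Relaxed (w : ℝ) (C C' : ℕ) (m m' : Memory) : Prop where
  le_old : m'.real 8 C ≤ m.real 8 C
  le_adj : m'.real 8 C ≤ m.real 8 C' + w
  other : ∀ c, c ≠ C → m'.real 8 c = m.real 8 c ∧ m'.nat 8 c = m.nat 8 c ∧ m'.nat 9 c = m.nat 9 c
  cases : (m'.real 8 C = m.real 8 C ∧ m'.nat 8 C = m.nat 8 C ∧ m'.nat 9 C = m.nat 9 C) ∨
    (m'.real 8 C = m.real 8 C' + w ∧ m'.nat 8 C = m.nat 8 C' ∧ m'.nat 9 C = m.nat 9 C')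

theorem relaxFrom_spec (h : RoundCtx S δ M v P k m) {c c' : NatExpr} {C C' : ℕ}
    (hc : c.eval m = C) (hc' : ∀ z, c'.eval (m.writeNat 20 0 z) = C') :
    Relaxed (δ / v) C C' m ((relaxFrom c c').result m) := by
  set m₁ := (m.writeNat 20 0 C).writeNat 21 0 C' with hm₁
  have h20 : m₁.nat 20 0 = C := by simp [m₁, Memory.writeNat]
  have h21 : m₁.nat 21 0 = C' := by simp [m₁, Memory.writeNat]
  have hs : m₁.real 1 (m₁.nat 12 0) = v := h.speed
  have hd : m₁.real 7 0 = δ := h.mesh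
  have h8 : m₁.real 8 = m.real 8 := rfl
  have hn8 : m₁.nat 8 = m.nat 8 := rfl
  have hn9 : m₁.nat 9 = m.nat 9 := rfl
  have e : (relaxFrom c c').result m = relax.result m₁ := by
    simp only [relaxFrom, Program.result, hc, hc', NatExpr.eval]
    rfl
  rw [e, relax, Program.result_cond (p := m.real 8 C' + δ / v < m.real 8 C) (by
    simp only [Test.Holds, RealExpr.eval, NatExpr.eval, h20, h21, hs, hd, h8])]
  split_ifs with hlt
  · have e2 : (Program.seq (.setReal 8 (.var 20) (.add (.read 8 (.var 21)) (.div (.var 7) speedE)))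
        (.seq (.setNat 8 (.var 20) (.read 8 (.var 21)))
          (.setNat 9 (.var 20) (.read 9 (.var 21))))).result m₁ =
        ((m₁.writeReal 8 C (m.real 8 C' + δ / v)).writeNat 8 C (m.nat 8 C')).writeNat 9 C
          (m.nat 9 C') := by
      simp only [Program.result, RealExpr.eval, NatExpr.eval, h20, h21, hs, hd, h8]
      simp [Memory.writeReal, Memory.writeNat, h20, h21, hn8, hn9]
    rw [e2]
    constructor
    · simpa [Memory.writeReal, Memory.writeNat] using hlt.le
    · simp [Memory.writeReal, Memory.writeNat]
    · intro c hne
      simp [Memory.writeReal, Memory.writeNat, hne, h8, hn8, hn9]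
    · right
      simp [Memory.writeReal, Memory.writeNat]
  · exact ⟨le_rfl, not_lt.1 hlt, fun c _ => ⟨rfl, rfl, rfl⟩, .inl ⟨rfl, rfl, rfl⟩⟩

/-- The arrival times of the current round are attained by way of the recorded sources, when `g` are
the pickup times. -/
def Attained (S : Plane) (δ : ℝ) (M : ℕ) (v : ℝ) (g : ℕ → ℕ → ℝ) (m : Memory) : Prop :=
  ∀ r < 2 * M + 1, ∀ q < 2 * M + 1,
    let c := ix (2 * M + 1) r q
    m.nat 8 c < 2 * M + 1 ∧ m.nat 9 c < 2 * M + 1 ∧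
      g (m.nat 8 c) (m.nat 9 c) + taxi (gridPt S δ M (m.nat 8 c) (m.nat 9 c)) (gridPt S δ M r q) / v
        ≤ m.real 8 c

theorem Relaxed.attained {g : ℕ → ℕ → ℝ} {r q r' q' : ℕ}
    (h : Relaxed (δ / v) (ix (2 * M + 1) r q) (ix (2 * M + 1) r' q') m m')
    (hm : Attained S δ M v g m) (hv : 0 < v) (hq : q < 2 * M + 1) (hr' : r' < 2 * M + 1)
    (hq' : q' < 2 * M + 1) (hadj : taxi (gridPt S δ M r' q') (gridPt S δ M r q) = δ) :
    Attained S δ M v g m' := by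
  intro r₀ hr₀ q₀ hq₀
  simp only
  by_cases hc : ix (2 * M + 1) r₀ q₀ = ix (2 * M + 1) r q
  swap
  · obtain ⟨h1, h2, h3⟩ := h.other _ hc
    rw [h1, h2, h3]
    exact hm r₀ hr₀ q₀ hq₀
  obtain ⟨rfl, rfl⟩ := ix_inj hq₀ hq hc
  rcases h.cases with ⟨h1, h2, h3⟩ | ⟨h1, h2, h3⟩
  · rw [h1, h2, h3]
    exact hm _ hr₀ _ hq₀
  · rw [h1, h2, h3]
    obtain ⟨h4, h5, h6⟩ := hm _ hr' _ hq'
    refine ⟨h4, h5, ?_⟩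
    have h7 := taxi_triangle (gridPt S δ M (m.nat 8 (ix (2 * M + 1) r' q'))
      (m.nat 9 (ix (2 * M + 1) r' q'))) (gridPt S δ M r' q') (gridPt S δ M r₀ q₀)
    rw [hadj] at h7
    have h8 := div_le_div_of_nonneg_right h7 hv.le
    rw [add_div] at h8
    linarith

theorem taxi_gridPt (S : Plane) {δ : ℝ} (hδ : 0 ≤ δ) (M r q r' q' : ℕ) :
    taxi (gridPt S δ M r q) (gridPt S δ M r' q') =
      (|(q : ℝ) - q'| + |(r : ℝ) - r'|) * δ := by
  simp only [taxi, gridPt, PiLp.toLp_apply, Matrix.cons_val_zero, Matrix.cons_val_one,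
    abs_gridCoord_sub _ _ hδ]
  ring

/-- A renumbering of rows and columns that is either the identity or the reversal, together with an
expression for it. -/
structure IsRenumbering (M : ℕ) (φ : NatExpr → NatExpr) (ψ : ℕ → ℕ) : Prop where
  eval : ∀ m e, m.nat 2 0 = M → (φ e).eval m = ψ (e.eval m)
  lt : ∀ x < 2 * M + 1, ψ x < 2 * M + 1
  inj : ∀ x < 2 * M + 1, ∀ y < 2 * M + 1, ψ x = ψ y → x = y
  adj : ∀ x < 2 * M + 1, 0 < x → |(ψ (x - 1) : ℝ) - ψ x| = 1

theorem isRenumbering_id (M : ℕ) : IsRenumbering M id id where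
  eval _ _ _ := rfl
  lt _ hx := hx
  inj _ _ _ _ h := h
  adj x _ hx0 := by
    obtain ⟨y, rfl⟩ : ∃ y, x = y + 1 := ⟨x - 1, by omega⟩
    simp

theorem isRenumbering_flip (M : ℕ) : IsRenumbering M flipE (2 * M - ·) where
  eval m e h := by simp [flipE, NatExpr.eval, h]
  lt _ hx := by omega
  inj x hx y hy h := by
    have h' : 2 * M - x = 2 * M - y := h
    omega
  adj x hx hx0 := by
    obtain ⟨y, rfl⟩ : ∃ y, x = y + 1 := ⟨x - 1, by omega⟩
    simp only [Nat.add_sub_cancel]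
    rw [Nat.cast_sub (by omega), Nat.cast_sub (by omega)]
    push_cast; ring_nf; simp

/-- After a sweep, the arrival times increase by at most `w` per step in the direction of the
sweep. -/
def SweepClosed (M : ℕ) (w : ℝ) (ψ : ℕ → ℕ) (h : ℕ → ℝ) (r q : ℕ) : Prop :=
  (0 < q → h (ix (2 * M + 1) (ψ r) (ψ q)) ≤ h (ix (2 * M + 1) (ψ r) (ψ (q - 1))) + w) ∧
  (0 < r → h (ix (2 * M + 1) (ψ r) (ψ q)) ≤ h (ix (2 * M + 1) (ψ (r - 1)) (ψ q)) + w)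

theorem sweepCell_spec {φ : NatExpr → NatExpr} {ψ : ℕ → ℕ} (hφ : IsRenumbering M φ ψ)
    {g : ℕ → ℕ → ℝ} (hv : 0 < v) (hδ : 0 ≤ δ) (h : RoundCtx S δ M v P k m) {r q : ℕ}
    (hr : m.nat 6 0 = r) (hq : m.nat 7 0 = q) (hrW : r < 2 * M + 1) (hqW : q < 2 * M + 1)
    (hm : Attained S δ M v g m) :
    let m' := (sweepCell φ).result m
    Attained S δ M v g m' ∧
      m'.real 8 (ix (2 * M + 1) (ψ r) (ψ q)) ≤ m.real 8 (ix (2 * M + 1) (ψ r) (ψ q)) ∧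
      (∀ c, c ≠ ix (2 * M + 1) (ψ r) (ψ q) → m'.real 8 c = m.real 8 c) ∧
      SweepClosed M (δ / v) ψ (m'.real 8) r q := by
  intro m'
  set W := 2 * M + 1 with hW
  set C := ix W (ψ r) (ψ q) with hC
  have hcell : ∀ (m₂ : Memory) (e e' : NatExpr), m₂.nat 2 = m.nat 2 → m₂.nat 3 = m.nat 3 →
      (cellE (φ e) (φ e')).eval m₂ = ix W (ψ (e.eval m₂)) (ψ (e'.eval m₂)) := by
    intro m₂ e e' h2 h3
    simp [cellE, NatExpr.eval, h3, h.width, hφ.eval m₂ _ (by rw [h2, h.half]), ix, hW]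
  -- the first relaxation
  obtain ⟨m₁, hm₁, h1, hA1, h2, h3, h4, h5⟩ : ∃ m₁, (Program.cond (.natLt (.lit 0) (.var 7))
      (relaxFrom (cellE (φ (.var 6)) (φ (.var 7)))
        (cellE (φ (.var 6)) (φ (.sub (.var 7) (.lit 1)))))
      .skip).result m = m₁ ∧ RoundCtx S δ M v P k m₁ ∧ (m₁.nat 6 = m.nat 6 ∧ m₁.nat 7 = m.nat 7 ∧
        m₁.nat 2 = m.nat 2 ∧ m₁.nat 3 = m.nat 3) ∧
      Attained S δ M v g m₁ ∧ m₁.real 8 C ≤ m.real 8 C ∧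
      (∀ c, c ≠ C → m₁.real 8 c = m.real 8 c) ∧
      (0 < q → m₁.real 8 C ≤ m.real 8 (ix W (ψ r) (ψ (q - 1))) + δ / v) := by
    refine ⟨_, rfl, ?_⟩
    rw [Program.result_cond (p := 0 < q) (by simp [Test.Holds, NatExpr.eval, hq])]
    split_ifs with hq0
    swap
    · exact ⟨h, ⟨rfl, rfl, rfl, rfl⟩, hm, le_rfl, fun _ _ => rfl, fun h => absurd h hq0⟩
    have hR := relaxFrom_spec (S := S) (P := P) (k := k) h (c := cellE (φ (.var 6)) (φ (.var 7)))
      (c' := cellE (φ (.var 6)) (φ (.sub (.var 7) (.lit 1)))) (C := C)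
      (C' := ix W (ψ r) (ψ (q - 1))) (by rw [hcell m _ _ rfl rfl]; simp [NatExpr.eval, hr, hq, hC])
      (fun z => by
        rw [hcell (m.writeNat 20 0 z) _ _ rfl rfl]
        have e6 : (NatExpr.var 6).eval (m.writeNat 20 0 z) = r := hr
        have e7 : (NatExpr.sub (.var 7) (.lit 1)).eval (m.writeNat 20 0 z) = q - 1 := by
          rw [← hq]; rfl
        rw [e6, e7])
    have hag := (show (relaxFrom (cellE (φ (.var 6)) (φ (.var 7)))
      (cellE (φ (.var 6)) (φ (.sub (.var 7) (.lit 1))))).LoopFree from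
        ⟨trivial, trivial, ⟨trivial, trivial, trivial⟩, trivial⟩).agree m
    refine ⟨h.of_agree hag (by simp [relaxFrom, relax, Program.natWrites])
        (by simp [relaxFrom, relax, Program.realWrites]),
      ⟨hag.nat 6 (by simp [relaxFrom, relax, Program.natWrites]),
       hag.nat 7 (by simp [relaxFrom, relax, Program.natWrites]),
       hag.nat 2 (by simp [relaxFrom, relax, Program.natWrites]),
       hag.nat 3 (by simp [relaxFrom, relax, Program.natWrites])⟩,
      hR.attained hm hv (hφ.lt q hqW) (hφ.lt r hrW) (hφ.lt _ (by omega)) ?_,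
      hR.le_old, fun c hc => (hR.other c hc).1, fun _ => hR.le_adj⟩
    rw [taxi_gridPt _ hδ, hφ.adj q hqW hq0]; simp
  -- the second relaxation
  obtain ⟨hm₂, h6, h7, h8⟩ : Attained S δ M v g m' ∧ m'.real 8 C ≤ m₁.real 8 C ∧
      (∀ c, c ≠ C → m'.real 8 c = m₁.real 8 c) ∧
      (0 < r → m'.real 8 C ≤ m₁.real 8 (ix W (ψ (r - 1)) (ψ q)) + δ / v) := by
    obtain ⟨a6, a7, a2, a3⟩ := hA1
    have hm' : m' = (Program.cond (.natLt (.lit 0) (.var 6))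
      (relaxFrom (cellE (φ (.var 6)) (φ (.var 7)))
        (cellE (φ (.sub (.var 6) (.lit 1))) (φ (.var 7))))
      .skip).result m₁ := by rw [← hm₁]; rfl
    rw [hm', Program.result_cond (p := 0 < r) (by simp [Test.Holds, NatExpr.eval, a6, hr])]
    split_ifs with hr0
    swap
    · exact ⟨h2, le_rfl, fun _ _ => rfl, fun h => absurd h hr0⟩
    have hR := relaxFrom_spec (S := S) (P := P) (k := k) h1 (c := cellE (φ (.var 6)) (φ (.var 7)))
      (c' := cellE (φ (.sub (.var 6) (.lit 1))) (φ (.var 7))) (C := C)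
      (C' := ix W (ψ (r - 1)) (ψ q))
      (by rw [hcell m₁ _ _ a2 a3]; simp [NatExpr.eval, a6, a7, hr, hq, hC])
      (fun z => by
        rw [hcell (m₁.writeNat 20 0 z) _ _ (by rw [← a2]; rfl) (by rw [← a3]; rfl)]
        have e6 : (NatExpr.sub (.var 6) (.lit 1)).eval (m₁.writeNat 20 0 z) = r - 1 := by
          rw [← hr, ← a6]; rfl
        have e7 : (NatExpr.var 7).eval (m₁.writeNat 20 0 z) = q := by
          rw [← hq, ← a7]; rfl
        rw [e6, e7])
    refine ⟨hR.attained h2 hv (hφ.lt q hqW) (hφ.lt _ (by omega)) (hφ.lt q hqW) ?_,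
      hR.le_old, fun c hc => (hR.other c hc).1, fun _ => hR.le_adj⟩
    rw [taxi_gridPt _ hδ, hφ.adj r hrW hr0]; simp
  refine ⟨hm₂, h6.trans h3, fun c hc => (h7 c hc).trans (h4 c hc), fun hq0 => ?_, fun hr0 => ?_⟩
  · have hne : ix W (ψ r) (ψ (q - 1)) ≠ C := by
      intro he
      have := (ix_inj (hφ.lt _ (by omega)) (hφ.lt _ hqW) he).2
      have := hφ.inj _ (by omega) _ hqW this
      omega
    rw [← hW, h7 _ hne, h4 _ hne]
    exact h6.trans (h5 hq0)
  · have hne : ix W (ψ (r - 1)) (ψ q) ≠ C := by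
      intro he
      have := (ix_inj (hφ.lt _ hqW) (hφ.lt _ hqW) he).1
      have := hφ.inj _ (by omega) _ hrW this
      omega
    rw [← hW, h7 _ hne]
    exact h8 hr0

theorem sweep_reaches {φ : NatExpr → NatExpr} {ψ : ℕ → ℕ} (hφ : IsRenumbering M φ ψ)
    {g : ℕ → ℕ → ℝ} (hv : 0 < v) (hδ : 0 ≤ δ) (h : RoundCtx S δ M v P k m)
    (hm : Attained S δ M v g m)
    (hw : ∀ a ∈ [2, 3, 5, 6, 7, 12], a ∉ (sweepCell φ).natWrites)
    (hw' : ∀ a ∈ [0, 1, 2, 3, 7], a ∉ (sweepCell φ).realWrites)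
    (hf : (sweepCell φ).LoopFree) :
    Reaches (gridLoop (sweepCell φ)) m ((2 * M + 1 + 1) ^ 2 * ((sweepCell φ).cost + 30)) fun m' =>
      Attained S δ M v g m' ∧ (∀ c, m'.real 8 c ≤ m.real 8 c) ∧
      ∀ r < 2 * M + 1, ∀ q < 2 * M + 1, SweepClosed M (δ / v) ψ (m'.real 8) r q := by
  have hwg : ∀ a ∈ [2, 3, 5, 12], a ∉ (gridLoop (sweepCell φ)).natWrites := by
    intro a ha
    have h2 : a ≠ 6 ∧ a ≠ 7 := by revert ha; revert a; decide
    have h1 := hw a (by simp only [List.mem_cons, List.not_mem_nil, or_false] at ha ⊢; tauto)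
    simp [gridLoop, forLoop, Program.natWrites, h1, h2]
  have hwg' : ∀ a ∈ [0, 1, 2, 3, 7], a ∉ (gridLoop (sweepCell φ)).realWrites := by
    intro a ha
    simp [gridLoop, forLoop, Program.realWrites, hw' a ha]
  refine (Reaches.gridLoop (P := sweepCell φ) (m := m) (W := 2 * M + 1) (K := (sweepCell φ).cost)
    (I := fun r q m' => Attained S δ M v g m' ∧ (∀ c, m'.real 8 c ≤ m.real 8 c) ∧
      ∀ r' < 2 * M + 1, ∀ q' < 2 * M + 1, r' < r ∨ (r' = r ∧ q' < q) →
        SweepClosed M (δ / v) ψ (m'.real 8) r' q')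
    (fun a ha => hw a (by revert ha; revert a; decide)) h.width ?_ ?_ ?_ ?_).mono le_rfl ?_
  · rintro r q m' a y h (rfl | rfl) <;> exact h
  · rintro r m' ⟨h1, h2, h3⟩
    exact ⟨h1, h2, fun r' hr' q' hq' hlt => h3 r' hr' q' hq' (by omega)⟩
  · exact ⟨hm, fun _ => le_rfl, fun r' _ q' _ hlt => by omega⟩
  · rintro r q m₁ hr hq hA hr₁ hq₁ ⟨h1, h2, h3⟩
    apply hf.reaches
    obtain ⟨h4, h5, h6, h7⟩ := sweepCell_spec hφ hv hδ (h.of_agree hA hwg hwg') hr₁ hq₁ hr hq h1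
    refine ⟨h4, fun c => ?_, fun r' hr' q' hq' hlt => ?_⟩
    · by_cases hc : c = ix (2 * M + 1) (ψ r) (ψ q)
      · rw [hc]; exact h5.trans (h2 _)
      · rw [h6 c hc]; exact h2 c
    · by_cases hrq : r' = r ∧ q' = q
      · rw [hrq.1, hrq.2]; exact h7
      -- the cells compared for an earlier cell are not modified any more
      have hne : ∀ r'' < 2 * M + 1, ∀ q'' < 2 * M + 1, ¬ (r'' = r ∧ q'' = q) →
          ix (2 * M + 1) (ψ r'') (ψ q'') ≠ ix (2 * M + 1) (ψ r) (ψ q) := by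
        intro r'' hr'' q'' hq'' hn he
        obtain ⟨e1, e2⟩ := ix_inj (hφ.lt _ hq'') (hφ.lt _ hq) he
        exact hn ⟨hφ.inj _ hr'' _ hr e1, hφ.inj _ hq'' _ hq e2⟩
      obtain ⟨h8, h9⟩ := h3 r' hr' q' hq' (by omega)
      refine ⟨fun h0 => ?_, fun h0 => ?_⟩
      · rw [h6 _ (hne r' hr' q' hq' hrq), h6 _ (hne r' hr' (q' - 1) (by omega) (by omega))]
        exact h8 h0
      · rw [h6 _ (hne r' hr' q' hq' hrq), h6 _ (hne (r' - 1) (by omega) q' hq' (by omega))]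
        exact h9 h0
  · rintro m' - ⟨h1, h2, h3⟩
    exact ⟨h1, h2, fun r hr q hq => h3 r hr q hq (.inl hr)⟩

end

section

variable {S : Plane} {δ : ℝ} {M : ℕ} {v : ℝ} {P : Plane} {k : ℕ} {m m' : Memory}

theorem le_of_sweepClosed {w : ℝ} {ψ : ℕ → ℕ} {h : ℕ → ℝ}
    (hc : ∀ r < 2 * M + 1, ∀ q < 2 * M + 1, SweepClosed M w ψ h r q) {r q : ℕ} (a b : ℕ)
    (hr : r + a < 2 * M + 1) (hq : q + b < 2 * M + 1) :
    h (ix (2 * M + 1) (ψ (r + a)) (ψ (q + b))) ≤ h (ix (2 * M + 1) (ψ r) (ψ q)) + (a + b) * w := by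
  induction a with
  | zero =>
    induction b with
    | zero => simp
    | succ b ih =>
      have h1 := ih (by omega)
      have h2 := (hc (r + 0) hr (q + (b + 1)) hq).1 (by omega)
      have e : q + (b + 1) - 1 = q + b := by omega
      rw [e] at h2
      push_cast at h1 ⊢
      linarith
  | succ a ih =>
    have h1 := ih (by omega)
    have h2 := (hc (r + (a + 1)) hr (q + b) hq).2 (by omega)
    have e : r + (a + 1) - 1 = r + a := by omega
    rw [e] at h2
    push_cast at h1 ⊢
    linarith

/-- Two sweeps suffice: from `(r', q')` the forward sweep reaches the componentwise maximum of `(r',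
q')` and `(r, q)`, from where the backward sweep reaches `(r, q)`, and these ways together are a
shortest taxicab path. -/
theorem le_of_two_sweeps (hδ : 0 ≤ δ) {h₁ h₂ : ℕ → ℝ}
    (hc₁ : ∀ r < 2 * M + 1, ∀ q < 2 * M + 1, SweepClosed M (δ / v) id h₁ r q)
    (hc₂ : ∀ r < 2 * M + 1, ∀ q < 2 * M + 1, SweepClosed M (δ / v) (2 * M - ·) h₂ r q)
    (hle : ∀ c, h₂ c ≤ h₁ c) {r q r' q' : ℕ} (hr : r < 2 * M + 1) (hq : q < 2 * M + 1)
    (hr' : r' < 2 * M + 1) (hq' : q' < 2 * M + 1) :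
    h₂ (ix (2 * M + 1) r q) ≤ h₁ (ix (2 * M + 1) r' q') +
      taxi (gridPt S δ M r' q') (gridPt S δ M r q) / v := by
  have h1 := le_of_sweepClosed hc₁ (r := r') (q := q') (max r r' - r') (max q q' - q')
    (by omega) (by omega)
  have h2 := le_of_sweepClosed hc₂ (r := 2 * M - max r r') (q := 2 * M - max q q')
    (max r r' - r) (max q q' - q) (by omega) (by omega)
  have e1 : r' + (max r r' - r') = max r r' := by omega
  have e2 : q' + (max q q' - q') = max q q' := by omega
  have e3 : 2 * M - (2 * M - max r r' + (max r r' - r)) = r := by omega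
  have e4 : 2 * M - (2 * M - max q q' + (max q q' - q)) = q := by omega
  have e5 : 2 * M - (2 * M - max r r') = max r r' := by omega
  have e6 : 2 * M - (2 * M - max q q') = max q q' := by omega
  simp only [id, e1, e2, e3, e4, e5, e6] at h1 h2
  have key : ∀ x y : ℕ, ((max x y - y : ℕ) : ℝ) + (max x y - x : ℕ) = |(y : ℝ) - x| := by
    intro x y
    rcases le_total x y with hxy | hxy
    · have : (x : ℝ) ≤ y := by exact_mod_cast hxy
      rw [max_eq_right hxy, abs_of_nonneg (by linarith), Nat.cast_sub hxy]; simp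
    · have : (y : ℝ) ≤ x := by exact_mod_cast hxy
      rw [max_eq_left hxy, abs_of_nonpos (by linarith), Nat.cast_sub hxy]; simp
  rw [taxi_gridPt _ hδ, ← key q q', ← key r r', mul_div_assoc]
  have := hle (ix (2 * M + 1) (max r r') (max q q'))
  linarith

theorem init_reaches (h : RoundCtx S δ M v P k m) :
    Reaches (gridLoop initCell) m ((2 * M + 1 + 1) ^ 2 * (initCell.cost + 30)) fun m' =>
      let g := pickupTime S δ M v P fun r q => m.real 9 (tix (2 * M + 1) k r q)
      Attained S δ M v g m' ∧
      ∀ r < 2 * M + 1, ∀ q < 2 * M + 1, m'.real 8 (ix (2 * M + 1) r q) ≤ g r q := by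
  set g := pickupTime S δ M v P fun r q => m.real 9 (tix (2 * M + 1) k r q) with hg
  refine (Reaches.gridLoop (P := initCell) (m := m) (W := 2 * M + 1) (K := initCell.cost)
    (I := fun r q m' => ∀ r' < 2 * M + 1, ∀ q' < 2 * M + 1, r' < r ∨ (r' = r ∧ q' < q) →
      m'.real 8 (ix (2 * M + 1) r' q') = g r' q' ∧ m'.nat 8 (ix (2 * M + 1) r' q') = r' ∧
      m'.nat 9 (ix (2 * M + 1) r' q') = q') (by decide) h.width ?_ ?_ ?_ ?_).mono le_rfl ?_
  · rintro r q m' a y h (rfl | rfl) <;> exact h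
  · intro r m' h1 r' hr' q' hq' hlt
    exact h1 r' hr' q' hq' (by omega)
  · intro r' _ q' _ hlt; omega
  · intro r q m₁ hr hq hA hr₁ hq₁ h1
    apply Program.LoopFree.reaches
    · simp [initCell, distTo, absDiff, Program.LoopFree]
    obtain ⟨h2, h3, h4⟩ := initCell_spec (h.of_agree hA (by decide) (by decide)) hr₁ hq₁
    rw [hA.real 9 (by decide), ← hg] at h2
    intro r' hr' q' hq' hlt
    rw [h2, h3, h4]
    by_cases hrq : r' = r ∧ q' = q
    · rw [hrq.1, hrq.2]; simp
    · have hne : ix (2 * M + 1) r' q' ≠ ix (2 * M + 1) r q := fun he => hrq (ix_inj hq' hq he)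
      simp only [Function.update_of_ne hne]
      exact h1 r' hr' q' hq' (by omega)
  · intro m' _ h1
    refine ⟨fun r hr q hq => ?_, fun r hr q hq => (h1 r hr q hq (.inl hr)).1.le⟩
    obtain ⟨h2, h3, h4⟩ := h1 r hr q hq (.inl hr)
    simp only [h2, h3, h4, taxi_self]
    exact ⟨hr, hq, by simp⟩

theorem storeCell_result (h : RoundCtx S δ M v P k m) {r q : ℕ} (hr : m.nat 6 0 = r)
    (hq : m.nat 7 0 = q) :
    storeCell.result m =
      ((m.writeNat 10 (tix (2 * M + 1) k r q) (m.nat 8 (ix (2 * M + 1) r q))).writeNat 11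
        (tix (2 * M + 1) k r q) (m.nat 9 (ix (2 * M + 1) r q))).writeReal 9
        (tix (2 * M + 1) (k + 1) r q)
        (min (m.real 8 (ix (2 * M + 1) r q)) (m.real 9 (tix (2 * M + 1) k r q))) := by
  have hcell : ∀ m₂ : Memory, (∀ a ∈ [3, 5, 6, 7], m₂.nat a = m.nat a) →
      (cellE (.var 6) (.var 7)).eval m₂ = ix (2 * M + 1) r q ∧
      (tableE (.var 5) (.var 6) (.var 7)).eval m₂ = tix (2 * M + 1) k r q ∧
      (tableE (.add (.var 5) (.lit 1)) (.var 6) (.var 7)).eval m₂ =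
        tix (2 * M + 1) (k + 1) r q := by
    intro m₂ hm
    simp [tableE, cellE, NatExpr.eval, hm 3, hm 5, hm 6, hm 7, hr, hq, h.width, h.round, ix, tix]
  obtain ⟨a1, a2, -⟩ := hcell m fun _ _ => rfl
  set m₁ := m.writeNat 10 (tix (2 * M + 1) k r q) (m.nat 8 (ix (2 * M + 1) r q)) with hm₁
  have hn₁ : ∀ a, a ≠ 10 → m₁.nat a = m.nat a := fun a ha => by simp [m₁, Memory.writeNat, ha]
  obtain ⟨b1, b2, -⟩ := hcell m₁ fun a ha => hn₁ a (by rintro rfl; revert ha; decide)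
  set m₂ := m₁.writeNat 11 (tix (2 * M + 1) k r q) (m.nat 9 (ix (2 * M + 1) r q)) with hm₂
  have hn₂ : ∀ a, a ≠ 10 → a ≠ 11 → m₂.nat a = m.nat a := fun a ha ha' => by
    rw [← hn₁ a ha]; simp [m₂, Memory.writeNat, ha']
  obtain ⟨c1, c2, c3⟩ := hcell m₂ fun a ha => hn₂ a (by rintro rfl; revert ha; decide)
    (by rintro rfl; revert ha; decide)
  have e1 : (Program.setNat 10 (tableE (.var 5) (.var 6) (.var 7))
      (.read 8 (cellE (.var 6) (.var 7)))).result m = m₁ := by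
    simp only [Program.result, NatExpr.eval, a1, a2, hm₁]
  have e2 : (Program.setNat 11 (tableE (.var 5) (.var 6) (.var 7))
      (.read 9 (cellE (.var 6) (.var 7)))).result m₁ = m₂ := by
    simp only [Program.result, NatExpr.eval, b1, b2, hm₂, hn₁ 9 (by decide)]
  have hreal : m₂.real = m.real := rfl
  rw [storeCell, Program.result_seq, e1, Program.result_seq, e2, Program.result_cond
    (p := m.real 8 (ix (2 * M + 1) r q) < m.real 9 (tix (2 * M + 1) k r q)) (by
      simp only [Test.Holds, RealExpr.eval, c1, c2, hreal])]
  simp only [Program.result, RealExpr.eval, c1, c2, c3, hreal]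
  split_ifs with hlt
  · rw [min_eq_left hlt.le]
  · rw [min_eq_right (not_lt.1 hlt)]

theorem tix_lt {W r q : ℕ} (k : ℕ) (hr : r < W) (hq : q < W) : tix W k r q < (k + 1) * W * W :=
  ix_lt (ix_lt (Nat.lt_succ_self k) hr) hq

theorem le_tix (W k r q : ℕ) : k * W * W ≤ tix W k r q := by
  unfold tix ix
  nlinarith [Nat.zero_le (r * W), Nat.zero_le q]

theorem store_reaches (h : RoundCtx S δ M v P k m) :
    Reaches (gridLoop storeCell) m ((2 * M + 1 + 1) ^ 2 * (storeCell.cost + 30)) fun m' =>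
      (∀ c < (k + 1) * (2 * M + 1) * (2 * M + 1), m'.real 9 c = m.real 9 c) ∧
      (∀ c < k * (2 * M + 1) * (2 * M + 1), m'.nat 10 c = m.nat 10 c ∧ m'.nat 11 c = m.nat 11 c) ∧
      ∀ r < 2 * M + 1, ∀ q < 2 * M + 1,
        m'.real 9 (tix (2 * M + 1) (k + 1) r q) =
          min (m.real 8 (ix (2 * M + 1) r q)) (m.real 9 (tix (2 * M + 1) k r q)) ∧
        m'.nat 10 (tix (2 * M + 1) k r q) = m.nat 8 (ix (2 * M + 1) r q) ∧
        m'.nat 11 (tix (2 * M + 1) k r q) = m.nat 9 (ix (2 * M + 1) r q) := by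
  refine (Reaches.gridLoop (P := storeCell) (m := m) (W := 2 * M + 1) (K := storeCell.cost)
    (I := fun r q m' =>
      (∀ c < (k + 1) * (2 * M + 1) * (2 * M + 1), m'.real 9 c = m.real 9 c) ∧
      (∀ c < k * (2 * M + 1) * (2 * M + 1), m'.nat 10 c = m.nat 10 c ∧ m'.nat 11 c = m.nat 11 c) ∧
      ∀ r' < 2 * M + 1, ∀ q' < 2 * M + 1, r' < r ∨ (r' = r ∧ q' < q) →
        m'.real 9 (tix (2 * M + 1) (k + 1) r' q') =
          min (m.real 8 (ix (2 * M + 1) r' q')) (m.real 9 (tix (2 * M + 1) k r' q')) ∧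
        m'.nat 10 (tix (2 * M + 1) k r' q') = m.nat 8 (ix (2 * M + 1) r' q') ∧
        m'.nat 11 (tix (2 * M + 1) k r' q') = m.nat 9 (ix (2 * M + 1) r' q'))
    (by decide) h.width ?_ ?_ ?_ ?_).mono le_rfl ?_
  · rintro r q m' a y h (rfl | rfl) <;> exact h
  · rintro r m' ⟨h1, h2, h3⟩
    exact ⟨h1, h2, fun r' hr' q' hq' hlt => h3 r' hr' q' hq' (by omega)⟩
  · exact ⟨fun _ _ => rfl, fun _ _ => ⟨rfl, rfl⟩, fun r' _ q' _ hlt => by omega⟩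
  · rintro r q m₁ hr hq hA hr₁ hq₁ ⟨h1, h2, h3⟩
    apply Program.LoopFree.reaches
    · simp [storeCell, Program.LoopFree]
    rw [storeCell_result (h.of_agree hA (by decide) (by decide)) hr₁ hq₁]
    rw [hA.nat 8 (by decide), hA.nat 9 (by decide), hA.real 8 (by decide),
      h1 _ (tix_lt k hr hq)]
    refine ⟨fun c hc => ?_, fun c hc => ?_, fun r' hr' q' hq' hlt => ?_⟩
    · have hne : c ≠ tix (2 * M + 1) (k + 1) r q :=
        (hc.trans_le (le_tix (2 * M + 1) (k + 1) r q)).ne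
      simpa [Memory.writeReal, Memory.writeNat, hne] using h1 c hc
    · have hne : c ≠ tix (2 * M + 1) k r q := (hc.trans_le (le_tix (2 * M + 1) k r q)).ne
      simpa [Memory.writeReal, Memory.writeNat, hne] using h2 c hc
    · by_cases hrq : r' = r ∧ q' = q
      · rw [hrq.1, hrq.2]; simp [Memory.writeReal, Memory.writeNat]
      · have hne : ∀ k', tix (2 * M + 1) k' r' q' ≠ tix (2 * M + 1) k' r q := fun k' he =>
          hrq (tix_inj hr' hr hq' hq he).2
        simpa [Memory.writeReal, Memory.writeNat, hne] using h3 r' hr' q' hq' (by omega)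
  · rintro m' - ⟨h1, h2, h3⟩
    exact ⟨h1, h2, fun r hr q hq => h3 r hr q hq (.inl hr)⟩

theorem IsRound.congr {A A' B B' : ℕ → ℕ → ℝ} {a b c d : ℕ → ℕ → ℕ}
    (h : IsRound S δ M v P A A' a b)
    (hc : ∀ r < 2 * M + 1, ∀ q < 2 * M + 1,
      B r q = A r q ∧ B' r q = A' r q ∧ c r q = a r q ∧ d r q = b r q) :
    IsRound S δ M v P B B' c d where
  le_old r hr q hq := by
    obtain ⟨h1, h2, -⟩ := hc r hr q hq
    rw [h1, h2]; exact h.le_old r hr q hq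
  le_pickup r hr q hq r' hr' q' hq' := by
    rw [(hc r hr q hq).2.1, pickupTime, (hc r' hr' q' hq').1]
    exact h.le_pickup r hr q hq r' hr' q' hq'
  source r hr q hq := by
    obtain ⟨h1, h2, h3, h4⟩ := hc r hr q hq
    rw [h1, h2, h3, h4]
    intro hlt
    obtain ⟨h5, h6, h7⟩ := h.source r hr q hq hlt
    refine ⟨h5, h6, ?_⟩
    rw [pickupTime, (hc _ h5 _ h6).1]
    exact h7

/-- The table of arrival times in the memory. -/
def arrival (M : ℕ) (m : Memory) (k r q : ℕ) : ℝ := m.real 9 (tix (2 * M + 1) k r q)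

/-- The table of source rows in the memory. -/
def sourceRow (M : ℕ) (m : Memory) (k r q : ℕ) : ℕ := m.nat 10 (tix (2 * M + 1) k r q)

/-- The table of source columns in the memory. -/
def sourceCol (M : ℕ) (m : Memory) (k r q : ℕ) : ℕ := m.nat 11 (tix (2 * M + 1) k r q)

/-- The constant in the number of steps of a round. -/
def roundCost : ℕ :=
  initCell.cost + (sweepCell id).cost + (sweepCell flipE).cost + storeCell.cost + 130

theorem roundProgram_reaches (h : GridCtx S δ M m) (hk : m.nat 5 0 = k)
    (hs : m.real 1 (m.nat 4 k) = v) (hX : m.real 2 (m.nat 4 k) = P 0)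
    (hY : m.real 3 (m.nat 4 k) = P 1) (hv : 0 < v) (hδ : 0 ≤ δ) :
    Reaches roundProgram m ((2 * M + 1 + 1) ^ 2 * roundCost) fun m' =>
      (∀ c < (k + 1) * (2 * M + 1) * (2 * M + 1), m'.real 9 c = m.real 9 c) ∧
      (∀ c < k * (2 * M + 1) * (2 * M + 1), m'.nat 10 c = m.nat 10 c ∧ m'.nat 11 c = m.nat 11 c) ∧
      IsRound S δ M v P (arrival M m' k) (arrival M m' (k + 1)) (sourceRow M m' k)
        (sourceCol M m' k) := by
  have hset : Reaches (.setNat 12 (.lit 0) (.read 4 (.var 5))) m 5 fun m' =>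
      m' = m.writeNat 12 0 (m.nat 4 k) :=
    ⟨_, _, .setNat 12 (.lit 0) (.read 4 (.var 5)) m, by simp [NatExpr.cost],
      by simp [NatExpr.eval, hk]⟩
  refine (hset.seq (L := (2 * M + 1 + 1) ^ 2 * (initCell.cost + 30) +
      ((2 * M + 1 + 1) ^ 2 * ((sweepCell id).cost + 30) +
      ((2 * M + 1 + 1) ^ 2 * ((sweepCell flipE).cost + 30) +
        (2 * M + 1 + 1) ^ 2 * (storeCell.cost + 30)))) fun m₀ _ hm₀ => ?_).mono ?_ fun _ _ h => h
  swap
  · have : 5 ≤ (2 * M + 1 + 1) ^ 2 * 10 := by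
      have : 1 ≤ (2 * M + 1 + 1) ^ 2 := Nat.one_le_pow _ _ (by omega)
      linarith
    calc _ ≤ (2 * M + 1 + 1) ^ 2 * 10 + ((2 * M + 1 + 1) ^ 2 * (initCell.cost + 30) +
      ((2 * M + 1 + 1) ^ 2 * ((sweepCell id).cost + 30) +
      ((2 * M + 1 + 1) ^ 2 * ((sweepCell flipE).cost + 30) +
        (2 * M + 1 + 1) ^ 2 * (storeCell.cost + 30)))) := Nat.add_le_add_right this _
      _ = _ := by unfold roundCost; ring
  have h₀ : RoundCtx S δ M v P k m₀ := by
    subst hm₀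
    exact { h with
      round := hk
      speed := hs
      posX := hX
      posY := hY }
  have h9 : m₀.real 9 = m.real 9 := by rw [hm₀]; rfl
  have h10 : m₀.nat 10 = m.nat 10 := by rw [hm₀]; rfl
  have h11 : m₀.nat 11 = m.nat 11 := by rw [hm₀]; rfl
  clear hm₀ hset
  set g := pickupTime S δ M v P fun r q => m₀.real 9 (tix (2 * M + 1) k r q) with hg
  refine (init_reaches h₀).seq fun m₁ hA₁ ⟨hatt₁, hle₁⟩ => ?_
  have hc₁ : RoundCtx S δ M v P k m₁ := h₀.of_agree hA₁ (by decide) (by decide)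
  refine (sweep_reaches (isRenumbering_id M) hv hδ hc₁ hatt₁ (by decide) (by decide)
    (by simp [sweepCell, relaxFrom, relax, Program.LoopFree])).seq
    fun m₂ hA₂ ⟨hatt₂, hle₂, hcl₂⟩ => ?_
  have hc₂ : RoundCtx S δ M v P k m₂ := hc₁.of_agree hA₂ (by decide) (by decide)
  refine (sweep_reaches (isRenumbering_flip M) hv hδ hc₂ hatt₂ (by decide) (by decide)
    (by simp [sweepCell, relaxFrom, relax, Program.LoopFree])).seq
    fun m₃ hA₃ ⟨hatt₃, hle₃, hcl₃⟩ => ?_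
  have hc₃ : RoundCtx S δ M v P k m₃ := hc₂.of_agree hA₃ (by decide) (by decide)
  have h9₃ : m₃.real 9 = m₀.real 9 := by
    rw [hA₃.real 9 (by decide), hA₂.real 9 (by decide), hA₁.real 9 (by decide)]
  have h10₃ : m₃.nat 10 = m₀.nat 10 := by
    rw [hA₃.nat 10 (by decide), hA₂.nat 10 (by decide), hA₁.nat 10 (by decide)]
  have h11₃ : m₃.nat 11 = m₀.nat 11 := by
    rw [hA₃.nat 11 (by decide), hA₂.nat 11 (by decide), hA₁.nat 11 (by decide)]
  refine (store_reaches hc₃).mono le_rfl fun m₄ _ ⟨h1, h2, h3⟩ => ?_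
  rw [h9₃, h9] at h1
  rw [h10₃, h11₃, h10, h11] at h2
  refine ⟨h1, h2, ?_⟩
  have hround : IsRound S δ M v P (fun r q => m₀.real 9 (tix (2 * M + 1) k r q))
      (fun r q => min (m₃.real 8 (ix (2 * M + 1) r q)) (m₀.real 9 (tix (2 * M + 1) k r q)))
      (fun r q => m₃.nat 8 (ix (2 * M + 1) r q)) (fun r q => m₃.nat 9 (ix (2 * M + 1) r q)) := by
    refine ⟨fun r _ q _ => min_le_right _ _, fun r hr q hq r' hr' q' hq' => ?_,
      fun r hr q hq hlt => ?_⟩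
    · refine (min_le_left _ _).trans
        ((le_of_two_sweeps (S := S) hδ hcl₂ hcl₃ hle₃ hr hq hr' hq').trans
        (add_le_add ((hle₂ _).trans (hle₁ r' hr' q' hq')) le_rfl))
    · obtain ⟨h4, h5, h6⟩ := hatt₃ r hr q hq
      refine ⟨h4, h5, h6.trans ?_⟩
      rw [min_eq_left]
      by_contra hcon
      rw [min_eq_right (not_le.1 hcon).le] at hlt
      exact lt_irrefl _ hlt
  refine hround.congr fun r hr q hq => ?_
  obtain ⟨h4, h5, h6⟩ := h3 r hr q hq
  rw [h9₃] at h4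
  refine ⟨?_, h4, h5, h6⟩
  rw [arrival, h1 _ (tix_lt k hr hq), h9]

end

/-! ### Preparations: mesh, size of the grid, order of the robots -/

/-- The memory contains the input. -/
structure InputCtx {n : ℕ} (v : Fin n → ℝ) (p : Fin n → Plane) (S D : Plane) (ε : ℝ) (m : Memory) :
    Prop where
  count : m.nat 0 0 = n
  eps : m.real 0 0 = ε
  sourceX : m.real 0 1 = S 0
  sourceY : m.real 0 2 = S 1
  destX : m.real 0 3 = D 0
  destY : m.real 0 4 = D 1
  speed : m.real 1 = pad v
  posX : ∀ i : Fin n, m.real 2 i = p i 0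
  posY : ∀ i : Fin n, m.real 3 i = p i 1

/-- The memory contains the input, the parameters of the grid and the order of the robots. -/
structure FullCtx {n : ℕ} (v : Fin n → ℝ) (p : Fin n → Plane) (S D : Plane) (ε δ : ℝ) (M : ℕ)
    (o : Fin n ≃ Fin n) (m : Memory) : Prop extends InputCtx v p S D ε m where
  half : m.nat 2 0 = M
  width : m.nat 3 0 = 2 * M + 1
  mesh : m.real 7 0 = δ
  order : ∀ k : Fin n, m.nat 4 k = o k

/-- Tests whether the grid does not yet cover the point `(x, y)`. -/
def growTest (x y : RealExpr) : Test :=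
  .not (.and
    (.and (.not (.realLt (.mul (.ofNat (.var 2)) (.var 7)) (.sub x (.read 0 (.lit 1)))))
      (.not (.realLt (.mul (.ofNat (.var 2)) (.var 7)) (.sub (.read 0 (.lit 1)) x))))
    (.and (.not (.realLt (.mul (.ofNat (.var 2)) (.var 7)) (.sub y (.read 0 (.lit 2)))))
      (.not (.realLt (.mul (.ofNat (.var 2)) (.var 7)) (.sub (.read 0 (.lit 2)) y)))))

/-- Enlarges the grid until it covers the point `(x, y)`. -/
def grow (x y : RealExpr) : Program :=
  .loop (growTest x y) (.setNat 2 (.lit 0) (.add (.var 2) (.lit 1)))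

/-- Enlarges the grid until it covers all relevant points. -/
def sizeProgram : Program :=
  .seq (grow (.read 0 (.lit 3)) (.read 0 (.lit 4)))
    (forLoop 5 (.var 0) (grow (.read 2 (.var 5)) (.read 3 (.var 5))))

/-- Tests whether robot `j` (variable `6`) precedes robot `i` (variable `5`). -/
def precedesTest : Test :=
  .not (.and (.not (.realLt (.read 1 (.var 6)) (.read 1 (.var 5))))
    (.not (.and (.not (.realLt (.read 1 (.var 5)) (.read 1 (.var 6)))) (.natLt (.var 6) (.var 5)))))

/-- Computes the rank of robot `i` (variable `5`) by counting. -/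
def countProgram : Program :=
  .seq (.setNat 15 (.lit 0) (.lit 0))
    (forLoop 6 (.var 0)
      (.cond precedesTest (.setNat 15 (.lit 0) (.add (.var 15) (.lit 1))) .skip))

/-- Sorts the robots by speed. -/
def orderProgram : Program :=
  forLoop 5 (.var 0) (.seq countProgram (.setNat 4 (.var 15) (.var 5)))

section

variable {n : ℕ} {v : Fin n → ℝ} {p : Fin n → Plane} {S D : Plane} {ε δ : ℝ} {M : ℕ}
  {o : Fin n ≃ Fin n} {m m' : Memory}

theorem inputCtx_input : InputCtx v p S D ε (input v p S D ε) where
  count := by simp [input]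
  eps := by simp [input, pad]
  sourceX := by simp [input, pad]
  sourceY := by simp [input, pad]
  destX := by simp [input, pad]
  destY := by simp [input, pad]
  speed := rfl
  posX i := pad_coe (fun i => p i 0) i
  posY i := pad_coe (fun i => p i 1) i

theorem InputCtx.congr (h : InputCtx v p S D ε m) (hn : m'.nat 0 = m.nat 0)
    (hr : ∀ a ∈ [0, 1, 2, 3], m'.real a = m.real a) : InputCtx v p S D ε m' where
  count := by rw [hn, h.count]
  eps := by rw [hr 0 (by decide), h.eps]
  sourceX := by rw [hr 0 (by decide), h.sourceX]
  sourceY := by rw [hr 0 (by decide), h.sourceY]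
  destX := by rw [hr 0 (by decide), h.destX]
  destY := by rw [hr 0 (by decide), h.destY]
  speed := by rw [hr 1 (by decide), h.speed]
  posX i := by rw [hr 2 (by decide), h.posX]
  posY i := by rw [hr 3 (by decide), h.posY]

theorem InputCtx.of_agree {Q : Program} (h : InputCtx v p S D ε m) (hA : Agree Q m m')
    (hn : 0 ∉ Q.natWrites) (hr : ∀ a ∈ [0, 1, 2, 3], a ∉ Q.realWrites) :
    InputCtx v p S D ε m' :=
  h.congr (hA.nat 0 hn) fun a ha => hA.real a (hr a ha)

theorem FullCtx.congr (h : FullCtx v p S D ε δ M o m) (hn : ∀ a ∈ [0, 2, 3, 4], m'.nat a = m.nat a)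
    (hr : ∀ a ∈ [0, 1, 2, 3, 7], m'.real a = m.real a) : FullCtx v p S D ε δ M o m' where
  toInputCtx := h.toInputCtx.congr (hn 0 (by decide)) fun a ha => hr a (by
    simp only [List.mem_cons, List.not_mem_nil, or_false] at ha ⊢; tauto)
  half := by rw [hn 2 (by decide), h.half]
  width := by rw [hn 3 (by decide), h.width]
  mesh := by rw [hr 7 (by decide), h.mesh]
  order k := by rw [hn 4 (by decide), h.order]

theorem FullCtx.of_agree {Q : Program} (h : FullCtx v p S D ε δ M o m) (hA : Agree Q m m')
    (hn : ∀ a ∈ [0, 2, 3, 4], a ∉ Q.natWrites) (hr : ∀ a ∈ [0, 1, 2, 3, 7], a ∉ Q.realWrites) :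
    FullCtx v p S D ε δ M o m' :=
  h.congr (fun a ha => hA.nat a (hn a ha)) fun a ha => hA.real a (hr a ha)

theorem FullCtx.gridCtx (h : FullCtx v p S D ε δ M o m) : GridCtx S δ M m :=
  ⟨h.sourceX, h.sourceY, h.half, h.width, h.mesh⟩

theorem InSquare.mono (hδ : 0 ≤ δ) {N : ℕ} (hMN : M ≤ N) {x : Plane} (h : InSquare S δ M x) :
    InSquare S δ N x := by
  have : (M : ℝ) * δ ≤ N * δ := by gcongr
  exact ⟨h.1.trans this, h.2.trans this⟩

theorem grow_reaches {x y : RealExpr} {X : Plane} {B : ℕ}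
    (hx : ∀ m', Agree (grow x y) m m' → x.eval m' = X 0 ∧ y.eval m' = X 1)
    (hS : m.real 0 1 = S 0 ∧ m.real 0 2 = S 1) (hm : m.real 7 0 = δ) (hB : InSquare S δ B X)
    (hMB : m.nat 2 0 ≤ B) :
    Reaches (grow x y) m ((B + 1) * ((growTest x y).cost + 10)) fun m' =>
      m.nat 2 0 ≤ m'.nat 2 0 ∧ m'.nat 2 0 ≤ B ∧ InSquare S δ (m'.nat 2 0) X := by
  have htest : ∀ m', Agree (grow x y) m m' →
      ((growTest x y).Holds m' ↔ ¬ InSquare S δ (m'.nat 2 0) X) := by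
    intro m' hA
    have h0 : m'.real 0 = m.real 0 := hA.real 0 (by simp [grow, Program.realWrites])
    have h7 : m'.real 7 = m.real 7 := hA.real 7 (by simp [grow, Program.realWrites])
    simp only [growTest, Test.Holds, RealExpr.eval, NatExpr.eval, hx m' hA, h0, h7, hS, hm,
      InSquare, abs_le, not_lt]
    rw [not_iff_not]
    constructor
    · rintro ⟨⟨h1, h2⟩, h3, h4⟩; exact ⟨⟨by linarith, h1⟩, by linarith, h3⟩
    · rintro ⟨⟨h1, h2⟩, h3, h4⟩; exact ⟨⟨h2, by linarith⟩, h4, by linarith⟩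
  refine (Reaches.loop (K := 6) (I := fun m' => m.nat 2 0 ≤ m'.nat 2 0 ∧ m'.nat 2 0 ≤ B)
    (μ := fun m' => B - m'.nat 2 0) ⟨le_rfl, hMB⟩ ?_).mono ?_ ?_
  · rintro m' hA ⟨h1, h2⟩ hb
    rw [htest m' hA] at hb
    have h3 : m'.nat 2 0 < B := by
      refine h2.lt_of_ne fun he => hb ?_
      rwa [he]
    refine ⟨_, _, .setNat 2 (.lit 0) (.add (.var 2) (.lit 1)) m', by simp [NatExpr.cost], ?_⟩
    simp only [NatExpr.eval, Memory.writeNat, Function.update_self]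
    omega
  · exact Nat.mul_le_mul (by omega) (by omega)
  · rintro m' hA ⟨⟨h1, h2⟩, h3⟩
    rw [htest m' hA, not_not] at h3
    exact ⟨h1, h2, h3⟩

/-- The constant in the number of steps for determining the size of the grid. -/
def sizeCost : ℕ :=
  (growTest (.read 0 (.lit 3)) (.read 0 (.lit 4))).cost +
    (growTest (.read 2 (.var 5)) (.read 3 (.var 5))).cost + 40

theorem sizeProgram_reaches {B : ℕ} (hδ : 0 < δ) (h : InputCtx v p S D ε m) (hm : m.real 7 0 = δ)
    (hB : ∀ i, InSquare S δ B (p i)) (hBD : InSquare S δ B D) (h0 : m.nat 2 0 = 0) :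
    Reaches sizeProgram m ((n + 1) * (B + 1) * sizeCost) fun m' =>
      m'.nat 2 0 ≤ B ∧ InSquare S δ (m'.nat 2 0) D ∧ ∀ i, InSquare S δ (m'.nat 2 0) (p i) := by
  have h1 := grow_reaches (m := m) (x := .read 0 (.lit 3)) (y := .read 0 (.lit 4)) (S := S)
    (X := D) (B := B) (fun m' hA => by
      simp only [RealExpr.eval, NatExpr.eval, hA.real 0 (by decide), h.destX, h.destY, and_self])
    ⟨h.sourceX, h.sourceY⟩ hm hBD (by omega)
  set c₁ := (growTest (.read 0 (.lit 3)) (.read 0 (.lit 4))).cost with hc₁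
  set c₂ := (growTest (.read 2 (.var 5)) (.read 3 (.var 5))).cost with hc₂
  refine (h1.seq (L := (n + 1) * ((B + 1) * (c₂ + 10) + 2 + 10) + 3) fun m₁ hA₁ hm₁ => ?_).mono ?_
    fun _ _ h => h
  · refine (Reaches.forLoop (T := n) (K := (B + 1) * (c₂ + 10)) (I := fun j m' =>
      m'.nat 2 0 ≤ B ∧ InSquare S δ (m'.nat 2 0) D ∧
        ∀ i : Fin n, (i : ℕ) < j → InSquare S δ (m'.nat 2 0) (p i)) (by decide) ?_ ?_ ?_).mono
      le_rfl fun m' _ ⟨h2, h3, h4⟩ => ⟨h2, h3, fun i => h4 i i.2⟩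
    · intro m' hA
      rw [← h.count, NatExpr.eval, NatExpr.eval, hA.nat 0 (by decide), hA₁.nat 0 (by decide)]
    · exact ⟨hm₁.2.1, hm₁.2.2, fun i hi => absurd hi (by omega)⟩
    · rintro j m₂ hj hA₂ hj₂ ⟨h2, h3, h4⟩
      have hin : InputCtx v p S D ε m₂ := (h.of_agree hA₁ (by decide) (by decide)).of_agree hA₂
        (by decide) (by decide)
      refine (grow_reaches (m := m₂) (S := S) (X := p ⟨j, hj⟩) (B := B) (fun m' hA => ?_)
        ⟨hin.sourceX, hin.sourceY⟩ ?_ (hB _) h2).mono le_rfl fun m' hA ⟨h5, h6, h7⟩ => ?_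
      · simp only [RealExpr.eval, NatExpr.eval, hA.real 2 (by decide), hA.real 3 (by decide),
          hA.nat 5 (by decide), hj₂]
        exact ⟨hin.posX ⟨j, hj⟩, hin.posY ⟨j, hj⟩⟩
      · rw [hA₂.real 7 (by decide), hA₁.real 7 (by decide), hm]
      · refine ⟨h6, h3.mono hδ.le h5, fun i hi => ?_⟩
        rcases Nat.lt_succ_iff_lt_or_eq.1 hi with hi | hi
        · exact (h4 i hi).mono hδ.le h5
        · obtain rfl : i = ⟨j, hj⟩ := Fin.ext hi
          exact h7
  · rw [show sizeCost = c₁ + c₂ + 40 from rfl]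
    clear_value c₁ c₂
    have h2 : 1 * (B + 1) ≤ (n + 1) * (B + 1) := Nat.mul_le_mul_right _ (by omega)
    have h3 : (n + 1) * 1 ≤ (n + 1) * (B + 1) := Nat.mul_le_mul_left _ (by omega)
    have h4 := Nat.mul_le_mul_right (c₁ + 10) h2
    calc _ = 1 * (B + 1) * (c₁ + 10) + ((n + 1) * (B + 1) * (c₂ + 10) + (n + 1) * 1 * 12 + 3) := by
          ring
      _ ≤ (n + 1) * (B + 1) * (c₁ + 10) + ((n + 1) * (B + 1) * (c₂ + 10) +
          (n + 1) * (B + 1) * 12 + (n + 1) * (B + 1) * 3) := by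
        gcongr
        nlinarith
      _ ≤ (n + 1) * (B + 1) * (c₁ + c₂ + 40) := by
        generalize (n + 1) * (B + 1) = X
        nlinarith

theorem precedesTest_holds (h : InputCtx v p S D ε m) :
    precedesTest.Holds m ↔ Precedes (pad v) (m.nat 6 0) (m.nat 5 0) := by
  simp only [precedesTest, Test.Holds, RealExpr.eval, NatExpr.eval, h.speed, Precedes]
  tauto

theorem countProgram_reaches (h : InputCtx v p S D ε m) {i : ℕ} (hi : m.nat 5 0 = i) :
    Reaches countProgram m ((n + 1) * (precedesTest.cost + 30)) fun m' =>
      m'.nat 15 0 = rankBelow (pad v) i n := by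
  have h1 : Reaches (.setNat 15 (.lit 0) (.lit 0)) m 3 fun m' => m' = m.writeNat 15 0 0 :=
    ⟨_, _, .setNat 15 (.lit 0) (.lit 0) m, le_rfl, rfl⟩
  set P : Program := .cond precedesTest (.setNat 15 (.lit 0) (.add (.var 15) (.lit 1))) .skip
    with hP
  have hcost : P.cost = precedesTest.cost + 8 := rfl
  refine (h1.seq (L := (n + 1) * (P.cost + 2 + 10) + 3) fun m₁ hA₁ hm₁ => ?_).mono ?_
    fun _ _ h => h
  · refine Reaches.forLoop (T := n) (K := P.cost)
      (I := fun j m' => m'.nat 15 0 = rankBelow (pad v) i j) (by decide) ?_ ?_ ?_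
    · intro m' hA
      rw [← h.count, NatExpr.eval, NatExpr.eval, hA.nat 0 (by decide), hA₁.nat 0 (by decide)]
    · rw [hm₁]; simp [Memory.writeNat, rankBelow]
    · rintro j m₂ hj hA₂ hj₂ h2
      have hin : InputCtx v p S D ε m₂ := (h.of_agree hA₁ (by decide) (by decide)).of_agree hA₂
        (by decide) (by decide)
      have hi₂ : m₂.nat 5 0 = i := by rw [hA₂.nat 5 (by decide), hA₁.nat 5 (by decide), hi]
      have hf : P.LoopFree := ⟨trivial, trivial⟩
      apply hf.reaches
      classical
      rw [Program.result_cond (precedesTest_holds hin), hj₂, hi₂, rankBelow_succ]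
      split_ifs
      · simp [Program.result, Memory.writeNat, NatExpr.eval, h2]
      · simpa [Program.result, Memory.writeNat] using h2
  · rw [hcost]; nlinarith

theorem orderProgram_reaches (h : InputCtx v p S D ε m) :
    Reaches orderProgram m ((n + 1) ^ 2 * (precedesTest.cost + 60)) fun m' =>
      ∀ i : Fin n, m'.nat 4 (rankBelow (pad v) i n) = i := by
  refine (Reaches.forLoop (T := n) (K := (n + 1) * (precedesTest.cost + 30) + 5)
    (I := fun j m' => ∀ i : Fin n, (i : ℕ) < j → m'.nat 4 (rankBelow (pad v) i n) = i)
    (by decide) ?_ ?_ ?_).mono ?_ fun m' _ h1 i => h1 i i.2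
  · intro m' hA
    rw [← h.count, NatExpr.eval, NatExpr.eval, hA.nat 0 (by decide)]
  · intro i hi; omega
  · rintro j m₁ hj hA₁ hj₁ h1
    refine (countProgram_reaches (h.of_agree hA₁ (by decide) (by decide)) hj₁).seq
      fun m₂ hA₂ h2 => ⟨_, _, .setNat 4 (.var 15) (.var 5) m₂, by simp [NatExpr.cost], ?_⟩
    have h4 : m₂.nat 4 = m₁.nat 4 := hA₂.nat 4 (by decide)
    have h5 : m₂.nat 5 0 = j := by rw [hA₂.nat 5 (by decide), hj₁]
    intro i hi
    simp only [NatExpr.eval, h2, h5, h4, Memory.writeNat]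
    rcases Nat.lt_succ_iff_lt_or_eq.1 hi with hi | hi
    · have hne : rankBelow (pad v) i n ≠ rankBelow (pad v) j n := by
        rcases Precedes.total (x := pad v) hi.ne with h6 | h6
        · exact (h6.rankBelow_lt i.2).ne
        · exact (h6.rankBelow_lt hj).ne'
      simpa [hne] using h1 i hi
    · subst hi; simp
  · simp only [NatExpr.cost]
    nlinarith

/-! ### The table -/

/-- Initialization of the table with a time that is larger than all times of interest. -/
def clearCell : Program :=
  .setReal 9 (tableE (.lit 0) (.var 6) (.var 7))
    (.add (.mul (.ofNat (.mul (.lit 4) (.var 2))) (.var 7)) (.ofNat (.lit 1)))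

/-- Computation of the table. -/
def tableProgram : Program := .seq (gridLoop clearCell) (forLoop 5 (.var 0) roundProgram)

theorem clear_reaches (h : GridCtx S δ M m) :
    Reaches (gridLoop clearCell) m ((2 * M + 1 + 1) ^ 2 * (clearCell.cost + 30)) fun m' =>
      ∀ r < 2 * M + 1, ∀ q < 2 * M + 1, arrival M m' 0 r q = 4 * M * δ + 1 := by
  refine (Reaches.gridLoop (P := clearCell) (m := m) (W := 2 * M + 1) (K := clearCell.cost)
    (I := fun r q m' => ∀ r' < 2 * M + 1, ∀ q' < 2 * M + 1, r' < r ∨ (r' = r ∧ q' < q) →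
      arrival M m' 0 r' q' = 4 * M * δ + 1) (by decide) h.width ?_ ?_ ?_ ?_).mono le_rfl ?_
  · rintro r q m' a y h (rfl | rfl) <;> exact h
  · intro r m' h1 r' hr' q' hq' hlt
    exact h1 r' hr' q' hq' (by omega)
  · intro r' _ q' _ hlt; omega
  · intro r q m₁ hr hq hA hr₁ hq₁ h1
    apply Program.LoopFree.reaches (P := clearCell) trivial
    have hg : GridCtx S δ M m₁ := h.congr
      (fun a ha => hA.nat a (by revert ha; revert a; decide))
      (fun a ha => hA.real a (by revert ha; revert a; decide))
    have e : clearCell.result m₁ = m₁.writeReal 9 (tix (2 * M + 1) 0 r q) (4 * M * δ + 1) := by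
      simp only [clearCell, Program.result, hg.eval_tableE]
      simp [NatExpr.eval, RealExpr.eval, hr₁, hq₁, hg.half, hg.mesh]
    rw [e]
    intro r' hr' q' hq' hlt
    by_cases hrq : r' = r ∧ q' = q
    · rw [hrq.1, hrq.2]; simp [arrival, Memory.writeReal]
    · have hne : tix (2 * M + 1) 0 r' q' ≠ tix (2 * M + 1) 0 r q := fun he =>
        hrq (tix_inj hr' hr hq' hq he).2
      simpa [arrival, Memory.writeReal, hne] using h1 r' hr' q' hq' (by omega)
  · exact fun m' _ h1 r hr q hq => h1 r hr q hq (.inl hr)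

theorem tableProgram_reaches (hv : ∀ i, 1 ≤ v i) (hδ : 0 ≤ δ) (h : FullCtx v p S D ε δ M o m) :
    Reaches tableProgram m ((n + 1) * (2 * M + 2) ^ 2 * (clearCell.cost + roundCost + 50)) fun m' =>
      IsTable v p S δ M o (arrival M m') (sourceRow M m') (sourceCol M m') := by
  refine ((clear_reaches h.gridCtx).seq
    (L := (n + 1) * ((2 * M + 1 + 1) ^ 2 * roundCost + 2 + 10) + 3)
    fun m₁ hA₁ h1 => ?_).mono ?_ fun _ _ h => h
  · refine (Reaches.forLoop (T := n) (K := (2 * M + 1 + 1) ^ 2 * roundCost)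
      (I := fun j m' => (∀ r < 2 * M + 1, ∀ q < 2 * M + 1, arrival M m' 0 r q = 4 * M * δ + 1) ∧
        ∀ k : Fin n, (k : ℕ) < j → IsRound S δ M (v (o k)) (p (o k)) (arrival M m' k)
          (arrival M m' (k + 1)) (sourceRow M m' k) (sourceCol M m' k)) (by decide) ?_ ?_ ?_).mono
      le_rfl fun m' _ ⟨h2, h3⟩ => ⟨h2, fun k => h3 k k.2⟩
    · intro m' hA
      rw [← h.count, NatExpr.eval, NatExpr.eval, hA.nat 0 (by decide), hA₁.nat 0 (by decide)]
    · exact ⟨h1, fun k hk => absurd hk (by omega)⟩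
    · rintro j m₂ hj hA₂ hj₂ ⟨h2, h3⟩
      have hin : FullCtx v p S D ε δ M o m₂ := (h.of_agree hA₁ (by decide) (by decide)).of_agree hA₂
        (by decide) (by decide)
      have ho : m₂.nat 4 j = o ⟨j, hj⟩ := hin.order ⟨j, hj⟩
      refine (roundProgram_reaches hin.gridCtx hj₂ (v := v (o ⟨j, hj⟩))
        (P := p (o ⟨j, hj⟩)) ?_ ?_ ?_
        (by linarith [hv (o ⟨j, hj⟩)]) hδ).mono le_rfl fun m₃ _ ⟨h4, h5, h6⟩ => ?_
      · rw [ho, hin.speed, pad_coe]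
      · rw [ho, hin.posX]
      · rw [ho, hin.posY]
      -- the entries of earlier rounds are not modified
      have hmono : ∀ k l : ℕ, k ≤ l → k * (2 * M + 1) * (2 * M + 1) ≤
          l * (2 * M + 1) * (2 * M + 1) := fun k l hkl => by gcongr
      refine ⟨fun r hr q hq => ?_, fun k hk => ?_⟩
      · rw [← h2 r hr q hq]
        exact h4 _ ((tix_lt 0 hr hq).trans_le (hmono _ _ (by omega)))
      · rcases Nat.lt_succ_iff_lt_or_eq.1 hk with hk | hk
        · refine (h3 k hk).congr fun r hr q hq => ?_
          have h7 := (tix_lt k hr hq).trans_le (hmono _ _ (by omega : (k : ℕ) + 1 ≤ j + 1))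
          have h8 := (tix_lt (k + 1) hr hq).trans_le
            (hmono _ _ (by omega : (k : ℕ) + 1 + 1 ≤ j + 1))
          have h9 := (tix_lt k hr hq).trans_le (hmono _ _ (by omega : (k : ℕ) + 1 ≤ j))
          exact ⟨h4 _ h7, h4 _ h8, (h5 _ h9).1, (h5 _ h9).2⟩
        · subst hk
          exact h6
  · have : 1 ≤ (2 * M + 2) ^ 2 := Nat.one_le_pow _ _ (by omega)
    have e : 2 * M + 1 + 1 = 2 * M + 2 := by omega
    rw [e]
    generalize (2 * M + 2) ^ 2 = U at *
    generalize clearCell.cost = a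
    generalize roundCost = b
    have h1 : (n + 1) * 1 ≤ (n + 1) * U := Nat.mul_le_mul_left _ this
    have h2 : 1 * U ≤ (n + 1) * U := Nat.mul_le_mul_right _ (by omega)
    have h3 := Nat.mul_le_mul_right (a + 30) h2
    nlinarith

end

/-! ### Output of the schedule -/

/-- The two waypoints that the memory contains for robot `i`. -/
def stops (m : Memory) (i : ℕ) : List (ℝ × Plane) :=
  [(m.real 4 (2 * i), !₂[m.real 5 (2 * i), m.real 6 (2 * i)]),
   (m.real 4 (2 * i + 1), !₂[m.real 5 (2 * i + 1), m.real 6 (2 * i + 1)])]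

theorem waypoints_eq_stops {n : ℕ} {m : Memory} (h : ∀ i : Fin n, m.nat 1 i = 2) (i : Fin n) :
    waypoints m i = stops m i := by
  have h1 : ∑ j ∈ Finset.range i, m.nat 1 j = 2 * i := by
    rw [Finset.sum_congr rfl fun j hj => h ⟨j, (Finset.mem_range.1 hj).trans i.2⟩]
    simp [mul_comm]
  simp only [waypoints, h1, h i, stops]
  rfl

/-- The cell of the first waypoint of robot `e`. -/
def firstStop (e : NatExpr) : NatExpr := .mul (.lit 2) e

/-- The cell of the second waypoint of robot `e`. -/
def secondStop (e : NatExpr) : NatExpr := .add (.mul (.lit 2) e) (.lit 1)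

/-- Gives the current robot two waypoints at its starting position. -/
def homeCell : Program :=
  .seq (.setNat 1 (.var 5) (.lit 2))
  (.seq (.setReal 5 (firstStop (.var 5)) (.read 2 (.var 5)))
  (.seq (.setReal 5 (secondStop (.var 5)) (.read 2 (.var 5)))
  (.seq (.setReal 6 (firstStop (.var 5)) (.read 3 (.var 5)))
    (.setReal 6 (secondStop (.var 5)) (.read 3 (.var 5))))))

/-- Determines the last grid line, given by the expression `c`, that is not beyond `d`, and stores
its number in the natural variable `a`. -/
def locate (a : ℕ) (d : RealExpr) (c : NatExpr → RealExpr) : Program :=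
  .seq (.setNat a (.lit 0) (.lit 0))
    (.loop (.not (.realLt d (c (.add (.var a) (.lit 1)))))
      (.setNat a (.lit 0) (.add (.var a) (.lit 1))))

/-- Stores a waypoint in cell `c` of the output arrays. -/
def visit (c : NatExpr) (t x y : RealExpr) : Program :=
  .seq (.setReal 4 c t) (.seq (.setReal 5 c x) (.setReal 6 c y))

/-- Loads the current robot and the row and column of its source. -/
def loadRobot : Program :=
  .seq (.setNat 12 (.lit 0) (.read 4 (.var 22)))
    (.seq (.setNat 16 (.lit 0) (.read 10 (.var 20))) (.setNat 17 (.lit 0) (.read 11 (.var 20))))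

/-- Outputs the first waypoint of the current robot. -/
def firstVisit : Program :=
  .seq (distTo (coordX (.var 17)) (coordY (.var 16)) (coordX (.var 14)) (coordY (.var 13)))
    (visit (firstStop (.var 12)) (.sub (.read 9 (.var 21)) (.div (.var 10) speedE))
      (coordX (.var 17)) (coordY (.var 16)))

/-- Outputs the second waypoint of the current robot. -/
def secondVisit : Program :=
  .seq (distTo (coordX (.var 14)) (coordY (.var 13)) (.var 12) (.var 13))
    (visit (secondStop (.var 12)) (.add (.read 9 (.var 21)) (.div (.var 10) speedE))
      (.var 12) (.var 13))

/-- Makes the source of the current robot the current grid point and the goal. -/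
def moveBack : Program :=
  .seq (.setNat 13 (.lit 0) (.var 16))
  (.seq (.setNat 14 (.lit 0) (.var 17))
  (.seq (.setReal 12 (.lit 0) (coordX (.var 17))) (.setReal 13 (.lit 0) (coordY (.var 16)))))

/-- Loads the number of the round to be undone and the cells of the current grid point in the tables
before and after that round. -/
def loadRound : Program :=
  .seq (.setNat 22 (.lit 0) (.sub (.sub (.var 0) (.lit 1)) (.var 5)))
  (.seq (.setNat 20 (.lit 0) (tableE (.var 22) (.var 13) (.var 14)))
    (.setNat 21 (.lit 0) (tableE (.add (.var 22) (.lit 1)) (.var 13) (.var 14))))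

/-- One step of the backtracking. -/
def backCell : Program :=
  .seq loadRound
    (.cond (.realLt (.read 9 (.var 21)) (.read 9 (.var 20)))
      (.seq loadRobot (.seq firstVisit (.seq secondVisit moveBack))) .skip)

/-- Output of the schedule by backtracking from the grid point next to the destination. -/
def planProgram : Program :=
  .seq (forLoop 5 (.var 0) homeCell)
  (.seq (locate 14 (.read 0 (.lit 3)) coordX)
  (.seq (locate 13 (.read 0 (.lit 4)) coordY)
  (.seq (.seq (.setReal 12 (.lit 0) (.read 0 (.lit 3))) (.setReal 13 (.lit 0) (.read 0 (.lit 4))))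
    (forLoop 5 (.var 0) backCell))))

/-- The memory contains the state `x` of the backtracking. -/
structure HasState (x : BackState) (m : Memory) : Prop where
  row : m.nat 13 0 = x.row
  col : m.nat 14 0 = x.col
  goalX : m.real 12 0 = x.goal 0
  goalY : m.real 13 0 = x.goal 1

section

variable {n : ℕ} {v : Fin n → ℝ} {p : Fin n → Plane} {S D : Plane} {ε δ : ℝ} {M : ℕ}
  {o : Fin n ≃ Fin n} {m m' : Memory}

theorem plane_eta (x : Plane) : !₂[x 0, x 1] = x := by
  ext j; fin_cases j <;> rfl

theorem home_reaches (h : InputCtx v p S D ε m) (h4 : m.real 4 = fun _ => 0) :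
    Reaches (forLoop 5 (.var 0) homeCell) m ((n + 1) * (homeCell.cost + 15)) fun m' =>
      (∀ i : Fin n, m'.nat 1 i = 2) ∧ ∀ i : Fin n, stops m' i = [(0, p i), (0, p i)] := by
  refine (Reaches.forLoop (T := n) (K := homeCell.cost) (I := fun j m' => m'.real 4 = m.real 4 ∧
    ∀ i : Fin n, (i : ℕ) < j → m'.nat 1 i = 2 ∧ m'.real 5 (2 * i) = p i 0 ∧
      m'.real 5 (2 * i + 1) = p i 0 ∧ m'.real 6 (2 * i) = p i 1 ∧ m'.real 6 (2 * i + 1) = p i 1)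
    (by decide) ?_ ?_ ?_).mono ?_ fun m' _ ⟨h1, h2⟩ => ⟨fun i => (h2 i i.2).1, fun i => ?_⟩
  · intro m' hA
    rw [← h.count, NatExpr.eval, NatExpr.eval, hA.nat 0 (by decide)]
  · exact ⟨rfl, fun i hi => absurd hi (by omega)⟩
  · rintro j m₁ hj hA₁ hj₁ ⟨h1, h2⟩
    have hin : InputCtx v p S D ε m₁ := h.of_agree hA₁ (by decide) (by decide)
    have hX := hin.posX ⟨j, hj⟩
    have hY := hin.posY ⟨j, hj⟩
    simp only at hX hY
    apply Program.LoopFree.reaches (P := homeCell) ⟨trivial, trivial, trivial, trivial, trivial⟩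
    refine ⟨by simpa [homeCell, Program.result, Memory.writeReal, Memory.writeNat] using h1,
      fun i hi => ?_⟩
    have e1 : homeCell.result m₁ = ((((m₁.writeNat 1 j 2).writeReal 5 (2 * j)
        (p ⟨j, hj⟩ 0)).writeReal 5 (2 * j + 1) (p ⟨j, hj⟩ 0)).writeReal 6 (2 * j) (p ⟨j, hj⟩ 1)).writeReal 6 (2 * j + 1)
        (p ⟨j, hj⟩ 1) := by
      simp [homeCell, firstStop, secondStop, Program.result, RealExpr.eval, NatExpr.eval,
        Memory.writeReal, Memory.writeNat, hj₁, hX, hY]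
    rw [e1]
    rcases Nat.lt_succ_iff_lt_or_eq.1 hi with hi | hi
    · have n1 : (i : ℕ) ≠ j := by omega
      have n3 : 2 * (i : ℕ) ≠ 2 * j + 1 := by omega
      have n4 : 2 * (i : ℕ) + 1 ≠ 2 * j := by omega
      simpa [Memory.writeReal, Memory.writeNat, n1, n3, n4] using h2 i hi
    · obtain rfl : i = ⟨j, hj⟩ := Fin.ext hi
      simp [Memory.writeReal, Memory.writeNat]
  · exact (Nat.add_le_add_left (by omega : 3 ≤ (n + 1) * 3) _).trans
      (by simp only [NatExpr.cost]; nlinarith)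
  · obtain ⟨-, h5, h6, h7, h8⟩ := h2 i i.2
    simp only [stops, h5, h6, h7, h8, h1, h4, plane_eta]

theorem locate_reaches {a : ℕ} {d : RealExpr} {c : NatExpr → RealExpr} {s x : ℝ} (hδ : 0 < δ)
    (hx : |x - s| ≤ M * δ)
    (hd : ∀ m', Agree (locate a d c) m m' → d.eval m' = x ∧
      (c (.add (.var a) (.lit 1))).eval m' = gridCoord s δ M (m'.nat a 0 + 1)) :
    Reaches (locate a d c) m
      ((2 * M + 2) * ((Test.realLt d (c (.add (.var a) (.lit 1)))).cost + 15)) fun m' =>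
      m'.nat a 0 = snap s δ M x := by
  obtain ⟨hx1, hx2⟩ := abs_le.1 hx
  have h1 : Reaches (.setNat a (.lit 0) (.lit 0)) m 3 fun m' => m' = m.writeNat a 0 0 :=
    ⟨_, _, .setNat a (.lit 0) (.lit 0) m, le_rfl, rfl⟩
  have hsub : ∀ m₁ m₂, Agree (.setNat a (.lit 0) (.lit 0)) m m₁ →
      Agree (.loop (.not (.realLt d (c (.add (.var a) (.lit 1)))))
        (.setNat a (.lit 0) (.add (.var a) (.lit 1)))) m₁ m₂ → Agree (locate a d c) m m₂ :=
    fun m₁ m₂ h1 h2 => (h1.mono (by simp [locate, Program.natWrites])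
      (by simp [Program.realWrites])).trans (h2.mono (by simp [locate, Program.natWrites])
      (by simp [Program.realWrites]))
  refine (h1.seq (L := (2 * M + 2) * ((Test.realLt d (c (.add (.var a) (.lit 1)))).cost + 8))
    fun m₁ hA₁ hm₁ => ?_).mono (by nlinarith) fun _ _ h => h
  refine (Reaches.loop (m := m₁) (K := 6)
    (I := fun m' => gridCoord s δ M (m'.nat a 0) ≤ x) (μ := fun m' => 2 * M + 1 - m'.nat a 0)
    ?_ ?_).mono ?_ ?_
  · simp only [hm₁, Memory.writeNat, Function.update_self, gridCoord]
    push_cast; linarith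
  · intro m₂ hA₂ hI hb
    obtain ⟨hd1, hd2⟩ := hd m₂ (hsub _ _ hA₁ hA₂)
    simp only [Test.Holds, hd1, hd2, not_lt] at hb
    refine ⟨_, _, .setNat a (.lit 0) (.add (.var a) (.lit 1)) m₂, by simp [NatExpr.cost], ?_⟩
    simp only [NatExpr.eval, Memory.writeNat, Function.update_self]
    refine ⟨hb, ?_⟩
    have h3 : ((m₂.nat a 0 + 1 : ℕ) : ℝ) * δ ≤ (2 * M : ℕ) * δ := by
      unfold gridCoord at hb; push_cast at hb ⊢; linarith
    have h4 : m₂.nat a 0 + 1 ≤ 2 * M := by exact_mod_cast le_of_mul_le_mul_right h3 hδ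
    omega
  · refine Nat.mul_le_mul (by omega) ?_
    simp only [Test.cost]; omega
  · rintro m₂ hA₂ ⟨hI, hb⟩
    obtain ⟨hd1, hd2⟩ := hd m₂ (hsub _ _ hA₁ hA₂)
    simp only [Test.Holds, hd1, hd2, not_not] at hb
    exact (snap_eq hδ (by linarith) hI hb).symm

theorem result_visit {c : NatExpr} {t x y : RealExpr} {C : ℕ}
    (hc : ∀ m', m'.nat = m.nat → c.eval m' = C)
    (hx : ∀ z, x.eval (m.writeReal 4 C z) = x.eval m)
    (hy : ∀ z z', y.eval ((m.writeReal 4 C z).writeReal 5 C z') = y.eval m) :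
    (visit c t x y).result m =
      ((m.writeReal 4 C (t.eval m)).writeReal 5 C (x.eval m)).writeReal 6 C (y.eval m) := by
  simp only [visit, Program.result, hc m rfl]
  rw [hc _ (by rfl), hx, hc _ (by rfl), hy]

theorem FullCtx.distTo_eq (h : FullCtx v p S D ε δ M o m) {r q r' q' : ℕ}
    (h13 : m.nat 13 0 = r) (h14 : m.nat 14 0 = q) (h16 : m.nat 16 0 = r') (h17 : m.nat 17 0 = q') :
    (distTo (coordX (.var 17)) (coordY (.var 16)) (coordX (.var 14)) (coordY (.var 13))).result m =
      (m.writeReal 11 0 |gridCoord (S 1) δ M r' - gridCoord (S 1) δ M r|).writeReal 10 0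
        (taxi (gridPt S δ M r' q') (gridPt S δ M r q)) := by
  rw [result_distTo (fun _ => rfl) (fun _ => rfl)]
  simp only [h.gridCtx.eval_coordX, h.gridCtx.eval_coordY, NatExpr.eval, h13, h14, h16, h17, taxi,
    gridPt, PiLp.toLp_apply, Matrix.cons_val_zero, Matrix.cons_val_one]

theorem FullCtx.distTo_goal_eq (h : FullCtx v p S D ε δ M o m) {x : BackState}
    (hx : HasState x m) :
    (distTo (coordX (.var 14)) (coordY (.var 13)) (.var 12) (.var 13)).result m =
      (m.writeReal 11 0 |gridCoord (S 1) δ M x.row - x.goal 1|).writeReal 10 0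
        (taxi (gridPt S δ M x.row x.col) x.goal) := by
  rw [result_distTo (fun _ => rfl) (fun _ => rfl)]
  simp only [h.gridCtx.eval_coordX, h.gridCtx.eval_coordY, NatExpr.eval, RealExpr.eval, hx.row,
    hx.col, hx.goalX, hx.goalY, taxi, gridPt, PiLp.toLp_apply, Matrix.cons_val_zero,
    Matrix.cons_val_one]

theorem backCell_spec (h : FullCtx v p S D ε δ M o m) {k : Fin n} (hk : n - 1 - m.nat 5 0 = k)
    {x : BackState} (hx : HasState x m) (hhome : stops m (o k) = [(0, p (o k)), (0, p (o k))]) :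
    let m' := backCell.result m
    let A := arrival M m
    let a := sourceRow M m
    let b := sourceCol M m
    HasState (x.prev S δ M (A k) (A (k + 1)) (a k) (b k)) m' ∧
      stops m' (o k) =
        roundWaypoints S δ M (v (o k)) (p (o k)) (A k) (A (k + 1)) (a k) (b k) x ∧
      ∀ i : ℕ, i ≠ o k → stops m' i = stops m i := by
  intro m' A a b
  have hA₁ : Agree loadRound m (loadRound.result m) :=
    Program.LoopFree.agree (P := loadRound) ⟨trivial, trivial, trivial⟩ m
  set m₁ := loadRound.result m with hm₁
  have h₁ : FullCtx v p S D ε δ M o m₁ := h.of_agree hA₁ (by decide) (by decide)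
  obtain ⟨h22, h20, h21⟩ : m₁.nat 22 0 = k ∧ m₁.nat 20 0 = tix (2 * M + 1) k x.row x.col ∧
      m₁.nat 21 0 = tix (2 * M + 1) (k + 1) x.row x.col := by
    simp [hm₁, loadRound, Program.result, NatExpr.eval, tableE, cellE, Memory.writeNat, h.count, hk,
      h.width, hx.row, hx.col, tix, ix]
  have hx₁ : HasState x m₁ := ⟨(congrFun (hA₁.nat 13 (by decide)) 0).trans hx.row,
    (congrFun (hA₁.nat 14 (by decide)) 0).trans hx.col, hx.goalX, hx.goalY⟩
  have hr₁ : m₁.real = m.real := rfl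
  have hst₁ : ∀ i, stops m₁ i = stops m i := fun i => rfl
  have hres : m' = if A (k + 1) x.row x.col < A k x.row x.col then
      moveBack.result (secondVisit.result (firstVisit.result (loadRobot.result m₁))) else m₁ := by
    simp only [m', backCell]
    rw [Program.result_seq, Program.result_cond (p := A (k + 1) x.row x.col < A k x.row x.col) (by
      simp only [Test.Holds, RealExpr.eval, NatExpr.eval, ← hm₁, h20, h21, hr₁, A, arrival])]
    rfl
  unfold roundWaypoints BackState.prev
  by_cases hlt : A (k + 1) x.row x.col < A k x.row x.col
  swap
  · rw [if_neg hlt] at hres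
    rw [if_neg hlt, if_neg hlt, hres]
    exact ⟨hx₁, hhome, fun i _ => rfl⟩
  rw [if_pos hlt] at hres
  rw [if_pos hlt, if_pos hlt, hres]
  clear hres hhome hlt m'
  -- the robot and its source
  have hA₂ : Agree loadRobot m₁ (loadRobot.result m₁) :=
    Program.LoopFree.agree (P := loadRobot) ⟨trivial, trivial, trivial⟩ m₁
  set m₂ := loadRobot.result m₁ with hm₂
  have h₂ : FullCtx v p S D ε δ M o m₂ := h₁.of_agree hA₂ (by decide) (by decide)
  obtain ⟨h12, h16, h17⟩ : m₂.nat 12 0 = o k ∧ m₂.nat 16 0 = a k x.row x.col ∧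
      m₂.nat 17 0 = b k x.row x.col := by
    have e10 : m₁.nat 10 = m.nat 10 := hA₁.nat 10 (by decide)
    have e11 : m₁.nat 11 = m.nat 11 := hA₁.nat 11 (by decide)
    simp [hm₂, loadRobot, Program.result, NatExpr.eval, Memory.writeNat, h22, h20, h₁.order, e10,
      e11, a, b, sourceRow, sourceCol]
  have h21₂ : m₂.nat 21 0 = tix (2 * M + 1) (k + 1) x.row x.col := by
    rw [hA₂.nat 21 (by decide), h21]
  have hx₂ : HasState x m₂ := ⟨(congrFun (hA₂.nat 13 (by decide)) 0).trans hx₁.row,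
    (congrFun (hA₂.nat 14 (by decide)) 0).trans hx₁.col, hx.goalX, hx.goalY⟩
  have hr₂ : m₂.real = m.real := rfl
  have hspeed : m.real 1 (o k) = v (o k) := by rw [h.speed, pad_coe]
  clear_value m₂
  clear hm₂ hA₂ hx₁ h₁ hst₁ hr₁ h20 h21 h22 hA₁ hm₁
  clear_value m₁
  -- the first waypoint
  set y := gridPt S δ M (a k x.row x.col) (b k x.row x.col) with hy
  set g := gridPt S δ M x.row x.col with hg
  set t := A (k + 1) x.row x.col with ht
  have hyX : gridCoord (S 0) δ M (b k x.row x.col) = y 0 := rfl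
  have hyY : gridCoord (S 1) δ M (a k x.row x.col) = y 1 := rfl
  obtain ⟨z₃, hm₃⟩ : ∃ z, firstVisit.result m₂ =
      ((((m₂.writeReal 11 0 z).writeReal 10 0 (taxi y g)).writeReal 4 (2 * o k)
        (t - taxi y g / v (o k))).writeReal 5 (2 * o k) (y 0)).writeReal 6 (2 * o k) (y 1) := by
    refine ⟨|gridCoord (S 1) δ M (a k x.row x.col) - gridCoord (S 1) δ M x.row|, ?_⟩
    rw [firstVisit, Program.result_seq, h₂.distTo_eq hx₂.row hx₂.col h16 h17]
    have hctx : ∀ z z', GridCtx S δ M ((m₂.writeReal 11 0 z).writeReal 10 0 z') := fun z z' =>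
      h₂.gridCtx.congr (fun _ _ => rfl) (by
        intro a ha
        have : a ≠ 10 ∧ a ≠ 11 := by revert ha; revert a; decide
        simp [Memory.writeReal, this])
    rw [result_visit (C := 2 * o k) (fun m' hm' => by
      simp [firstStop, NatExpr.eval, hm', Memory.writeReal, h12]) (fun _ => rfl) (fun _ _ => rfl),
      (hctx _ _).eval_coordX, (hctx _ _).eval_coordY]
    simp [RealExpr.eval, NatExpr.eval, Memory.writeReal, h12, h16, h17, h21₂, hr₂, hspeed, hyX, hyY,
      ← hy, ← hg, ht, A, arrival]
  set m₃ := firstVisit.result m₂ with hm₃'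
  have hn₃ : m₃.nat = m₂.nat := by rw [hm₃]; rfl
  have hr₃ : ∀ c ∉ [4, 5, 6, 10, 11], m₃.real c = m.real c := by
    intro c hc
    simp only [List.mem_cons, List.not_mem_nil, or_false, not_or] at hc
    simp [hm₃, Memory.writeReal, hc, hr₂]
  have h₃ : FullCtx v p S D ε δ M o m₃ := h₂.congr (fun _ _ => by rw [hn₃]) fun c hc => by
    rw [hr₃ c (by revert hc; revert c; decide), hr₂]
  have hx₃ : HasState x m₃ := ⟨by rw [hn₃, hx₂.row], by rw [hn₃, hx₂.col],
    by rw [hr₃ 12 (by decide), hx.goalX], by rw [hr₃ 13 (by decide), hx.goalY]⟩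
  -- the second waypoint
  obtain ⟨z₄, hm₄⟩ : ∃ z, secondVisit.result m₃ =
      ((((m₃.writeReal 11 0 z).writeReal 10 0 (taxi g x.goal)).writeReal 4 (2 * o k + 1)
        (t + taxi g x.goal / v (o k))).writeReal 5 (2 * o k + 1) (x.goal 0)).writeReal 6
        (2 * o k + 1) (x.goal 1) := by
    refine ⟨|gridCoord (S 1) δ M x.row - x.goal 1|, ?_⟩
    rw [secondVisit, Program.result_seq, h₃.distTo_goal_eq hx₃]
    rw [result_visit (C := 2 * o k + 1) (fun m' hm' => by
      simp [secondStop, NatExpr.eval, hm', Memory.writeReal, hn₃, h12]) (fun _ => rfl)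
      (fun _ _ => rfl)]
    simp [RealExpr.eval, NatExpr.eval, Memory.writeReal, hn₃, h12, h21₂, hr₃ 9, hr₃ 1, hspeed,
      ← hg, ht, A, arrival, hx₃.goalX, hx₃.goalY]
  set m₄ := secondVisit.result m₃ with hm₄'
  have hn₄ : m₄.nat = m₂.nat := by rw [hm₄]; exact hn₃
  have hr₄ : ∀ c ∉ [4, 5, 6, 10, 11], m₄.real c = m.real c := by
    intro c hc
    rw [← hr₃ c hc]
    simp only [List.mem_cons, List.not_mem_nil, or_false, not_or] at hc
    simp [hm₄, Memory.writeReal, hc]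
  have h₄ : FullCtx v p S D ε δ M o m₄ := h₂.congr (fun _ _ => by rw [hn₄]) fun c hc => by
    rw [hr₄ c (by revert hc; revert c; decide), hr₂]
  -- the new state
  have hst : ∀ i, stops (moveBack.result m₄) i = stops m₄ i := fun i => rfl
  have hst₄ : ∀ i, stops m₄ i = if i = o k then
      [(t - taxi y g / v (o k), y), (t + taxi g x.goal / v (o k), x.goal)] else stops m i := by
    intro i
    have e₄ : ∀ c ∈ [4, 5, 6], m₄.real c = Function.update (m₃.real c) (2 * o k + 1)
        (if c = 4 then t + taxi g x.goal / v (o k) else if c = 5 then x.goal 0 else x.goal 1) := by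
      intro c hc
      simp only [List.mem_cons, List.not_mem_nil, or_false] at hc
      rcases hc with rfl | rfl | rfl <;> simp [hm₄, Memory.writeReal]
    have e₃ : ∀ c ∈ [4, 5, 6], m₃.real c = Function.update (m.real c) (2 * o k)
        (if c = 4 then t - taxi y g / v (o k) else if c = 5 then y 0 else y 1) := by
      intro c hc
      simp only [List.mem_cons, List.not_mem_nil, or_false] at hc
      rcases hc with rfl | rfl | rfl <;> simp [hm₃, Memory.writeReal, hr₂]
    simp only [stops, e₄ 4 (by decide), e₄ 5 (by decide), e₄ 6 (by decide), e₃ 4 (by decide),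
      e₃ 5 (by decide), e₃ 6 (by decide)]
    by_cases hi : i = o k
    · simp [hi, plane_eta]
    · have n1 : 2 * i ≠ 2 * (o k : ℕ) + 1 := by omega
      have n2 : 2 * i + 1 ≠ 2 * (o k : ℕ) := by omega
      simp [n1, n2, hi]
  refine ⟨?_, ?_, fun i hi => ?_⟩
  · constructor
    · simp [moveBack, Program.result, Memory.writeNat, Memory.writeReal, NatExpr.eval, hn₄, h16]
    · simp [moveBack, Program.result, Memory.writeNat, Memory.writeReal, NatExpr.eval, hn₄, h17]
    · simp [moveBack, Program.result, Memory.writeNat, Memory.writeReal, NatExpr.eval, hn₄, h17,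
        coordX, RealExpr.eval, h₄.sourceX, h₂.half, h₄.mesh, ← hyX, gridCoord]
    · simp [moveBack, Program.result, Memory.writeNat, Memory.writeReal, NatExpr.eval, hn₄, h16,
        coordY, RealExpr.eval, h₄.sourceY, h₂.half, h₄.mesh, ← hyY, gridCoord]
  · rw [hst, hst₄, if_pos rfl]
  · rw [hst, hst₄, if_neg hi]

end

section

variable {n : ℕ} {v : Fin n → ℝ} {p : Fin n → Plane} {S D : Plane} {ε δ : ℝ} {M : ℕ}
  {o : Fin n ≃ Fin n} {m m' : Memory}

theorem back_reaches (h : FullCtx v p S D ε δ M o m) {x : BackState} (hx : HasState x m)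
    (hhome : ∀ i : Fin n, stops m i = [(0, p i), (0, p i)]) :
    Reaches (forLoop 5 (.var 0) backCell) m ((n + 1) * (backCell.cost + 15)) fun m' =>
      ∀ i : Fin n, stops m' i =
        planWaypoints v p S δ M o (arrival M m) (sourceRow M m) (sourceCol M m) x i := by
  set A := arrival M m
  set a := sourceRow M m
  set b := sourceCol M m
  refine (Reaches.forLoop (T := n) (K := backCell.cost) (I := fun j m' =>
    HasState (backtrack n S δ M A a b x j) m' ∧ ∀ i : Fin n, stops m' i =
      if n - j ≤ o.symm i then planWaypoints v p S δ M o A a b x i else [(0, p i), (0, p i)])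
    (by decide) ?_ ?_ ?_).mono ?_ fun m' _ ⟨_, h2⟩ i => ?_
  · intro m' hA
    rw [← h.count, NatExpr.eval, NatExpr.eval, hA.nat 0 (by decide)]
  · refine ⟨⟨hx.row, hx.col, hx.goalX, hx.goalY⟩, fun i => ?_⟩
    rw [if_neg (by have := (o.symm i).2; omega)]
    exact hhome i
  · rintro j m₁ hj hA₁ hj₁ ⟨h1, h2⟩
    have hin : FullCtx v p S D ε δ M o m₁ := h.of_agree hA₁ (by decide) (by decide)
    have eA : arrival M m₁ = A := by
      funext k r q; simp only [arrival, A, hA₁.real 9 (by decide)]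
    have ea : sourceRow M m₁ = a := by
      funext k r q; simp only [sourceRow, a, hA₁.nat 10 (by decide)]
    have eb : sourceCol M m₁ = b := by
      funext k r q; simp only [sourceCol, b, hA₁.nat 11 (by decide)]
    obtain ⟨k, hk⟩ : ∃ k : Fin n, n - 1 - j = k := ⟨⟨n - 1 - j, by omega⟩, rfl⟩
    have hkj : (k : ℕ) = n - 1 - j := hk.symm
    obtain ⟨h3, h4, h5⟩ := backCell_spec hin (k := k) (by rw [hj₁, hk]) h1 (by
      rw [h2, if_neg (by rw [Equiv.symm_apply_apply]; omega)])
    rw [eA, ea, eb] at h3 h4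
    have hf : backCell.LoopFree := by
      simp [backCell, loadRound, loadRobot, firstVisit, secondVisit, moveBack, visit, distTo,
        absDiff, Program.LoopFree]
    apply hf.reaches
    refine ⟨?_, fun i => ?_⟩
    · rw [backtrack, hk]
      exact ⟨h3.row, h3.col, h3.goalX, h3.goalY⟩
    · change stops (backCell.result m₁) i = _
      by_cases hi : i = o k
      · rw [hi, h4, Equiv.symm_apply_apply, if_pos (by omega), planWaypoints,
          Equiv.symm_apply_apply]
        have e : n - 1 - (k : ℕ) = j := by omega
        rw [e]
      · rw [h5 i (fun he => hi (Fin.ext he)), h2]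
        have hne : (o.symm i : ℕ) ≠ k := fun he => hi (by
          rw [← Fin.ext he, Equiv.apply_symm_apply])
        by_cases hle : n - j ≤ o.symm i
        · rw [if_pos hle, if_pos (by omega)]
        · rw [if_neg hle, if_neg (by omega)]
  · exact (Nat.add_le_add_left (by omega : 3 ≤ (n + 1) * 3) _).trans
      (by simp only [NatExpr.cost]; nlinarith)
  · rw [h2, if_pos (by omega)]

/-- The constant in the number of steps of the output. -/
def planCost : ℕ :=
  homeCell.cost + backCell.cost +
    (Test.realLt (.read 0 (.lit 3)) (coordX (.add (.var 14) (.lit 1)))).cost +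
    (Test.realLt (.read 0 (.lit 4)) (coordY (.add (.var 13) (.lit 1)))).cost + 100

theorem planProgram_reaches (hδ : 0 < δ) (h : FullCtx v p S D ε δ M o m)
    (h4 : m.real 4 = fun _ => 0) (hD : InSquare S δ M D) :
    Reaches planProgram m ((n + 1) * (2 * M + 2) ^ 2 * planCost) fun m' =>
      (∀ i : Fin n, m'.nat 1 i = 2) ∧ ∀ i : Fin n, stops m' i =
        planWaypoints v p S δ M o (arrival M m) (sourceRow M m) (sourceCol M m)
          ⟨snap (S 1) δ M (D 1), snap (S 0) δ M (D 0), D⟩ i := by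
  set c₁ := (Test.realLt (.read 0 (.lit 3)) (coordX (.add (.var 14) (.lit 1)))).cost
  set c₂ := (Test.realLt (.read 0 (.lit 4)) (coordY (.add (.var 13) (.lit 1)))).cost
  refine ((home_reaches h.toInputCtx h4).seq (L := (2 * M + 2) * (c₁ + 15) +
    ((2 * M + 2) * (c₂ + 15) + (8 + (n + 1) * (backCell.cost + 15))))
    fun m₁ hA₁ ⟨hcount, hhome⟩ => ?_).mono ?_ fun _ _ h => h
  · have hf₁ : FullCtx v p S D ε δ M o m₁ := h.of_agree hA₁ (by decide) (by decide)
    refine (locate_reaches (s := S 0) (x := D 0) hδ hD.1 fun m' hA => ?_).seq fun m₂ hA₂ hm₂ => ?_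
    · have hf := hf₁.of_agree hA (by decide) (by decide)
      exact ⟨hf.destX, by rw [hf.gridCtx.eval_coordX]; rfl⟩
    have hf₂ : FullCtx v p S D ε δ M o m₂ := hf₁.of_agree hA₂ (by decide) (by decide)
    refine (locate_reaches (s := S 1) (x := D 1) hδ hD.2 fun m' hA => ?_).seq fun m₃ hA₃ hm₃ => ?_
    · have hf := hf₂.of_agree hA (by decide) (by decide)
      exact ⟨hf.destY, by rw [hf.gridCtx.eval_coordY]; rfl⟩
    have hf₃ : FullCtx v p S D ε δ M o m₃ := hf₂.of_agree hA₃ (by decide) (by decide)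
    have hset : Reaches (.seq (.setReal 12 (.lit 0) (.read 0 (.lit 3)))
        (.setReal 13 (.lit 0) (.read 0 (.lit 4)))) m₃ 8 fun m' =>
        m' = (m₃.writeReal 12 0 (D 0)).writeReal 13 0 (D 1) := by
      refine Program.LoopFree.reaches (P := .seq (.setReal 12 (.lit 0) (.read 0 (.lit 3)))
        (.setReal 13 (.lit 0) (.read 0 (.lit 4)))) ⟨trivial, trivial⟩ ?_
      simp [Program.result, RealExpr.eval, NatExpr.eval, hf₃.destX, Memory.writeReal, hf₃.destY]
    refine hset.seq fun m₄ hA₄ hm₄ => ?_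
    have hf₄ : FullCtx v p S D ε δ M o m₄ := hf₃.of_agree hA₄ (by decide) (by decide)
    refine (back_reaches hf₄ (x := ⟨snap (S 1) δ M (D 1), snap (S 0) δ M (D 0), D⟩) ?_ ?_).mono
      le_rfl fun m₅ hA₅ h5 => ⟨fun i => ?_, fun i => ?_⟩
    · refine ⟨?_, ?_, ?_, ?_⟩
      · rw [hA₄.nat 13 (by decide), hm₃]
      · rw [hA₄.nat 14 (by decide), hA₃.nat 14 (by decide), hm₂]
      · rw [hm₄]; simp [Memory.writeReal]
      · rw [hm₄]; simp [Memory.writeReal]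
    · intro i
      rw [← hhome i]
      simp only [stops, hA₄.real 4 (by decide), hA₄.real 5 (by decide), hA₄.real 6 (by decide),
        hA₃.real 4 (by decide), hA₃.real 5 (by decide), hA₃.real 6 (by decide),
        hA₂.real 4 (by decide), hA₂.real 5 (by decide), hA₂.real 6 (by decide)]
    · rw [hA₅.nat 1 (by decide), hA₄.nat 1 (by decide), hA₃.nat 1 (by decide),
        hA₂.nat 1 (by decide), hcount i]
    · have eA : arrival M m₄ = arrival M m := by
        funext k r q
        simp only [arrival, hA₄.real 9 (by decide), hA₃.real 9 (by decide), hA₂.real 9 (by decide),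
          hA₁.real 9 (by decide)]
      have ea : sourceRow M m₄ = sourceRow M m := by
        funext k r q
        simp only [sourceRow, hA₄.nat 10 (by decide), hA₃.nat 10 (by decide),
          hA₂.nat 10 (by decide), hA₁.nat 10 (by decide)]
      have eb : sourceCol M m₄ = sourceCol M m := by
        funext k r q
        simp only [sourceCol, hA₄.nat 11 (by decide), hA₃.nat 11 (by decide),
          hA₂.nat 11 (by decide), hA₁.nat 11 (by decide)]
      rw [h5 i, eA, ea, eb]
  · rw [show planCost = homeCell.cost + backCell.cost + c₁ + c₂ + 100 from rfl]
    clear_value c₁ c₂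
    generalize homeCell.cost = a
    generalize backCell.cost = b
    have h1 : (n + 1) * 1 ≤ (n + 1) * (2 * M + 2) ^ 2 :=
      Nat.mul_le_mul_left _ (Nat.one_le_pow _ _ (by omega))
    have h2 : 1 * (2 * M + 2) ≤ (n + 1) * (2 * M + 2) ^ 2 :=
      Nat.mul_le_mul (by omega) (Nat.le_self_pow (by norm_num) _)
    have h3 := Nat.mul_le_mul_right (a + 15) h1
    have h4 := Nat.mul_le_mul_right (b + 15) h1
    have h5 := Nat.mul_le_mul_right (c₁ + 15) h2
    have h6 := Nat.mul_le_mul_right (c₂ + 15) h2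
    have h7 : 1 ≤ (n + 1) * (2 * M + 2) ^ 2 := le_trans (by omega) h1
    generalize (n + 1) * (2 * M + 2) ^ 2 = U at *
    nlinarith

/-! ### The algorithm -/

/-- The algorithm. The mesh of the grid is `ε / (4 * n)`. -/
def algorithm : Program :=
  .seq (.setReal 7 (.lit 0) (.div (.read 0 (.lit 0)) (.ofNat (.mul (.lit 4) (.var 0)))))
  (.seq sizeProgram
  (.seq (.setNat 3 (.lit 0) (.add (.mul (.lit 2) (.var 2)) (.lit 1)))
  (.seq orderProgram
  (.seq tableProgram planProgram))))

/-- The constant in the number of steps of the algorithm. -/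
def algorithmCost : ℕ :=
  sizeCost + (precedesTest.cost + 60) + (clearCell.cost + roundCost + 50) + planCost + 50

theorem algorithm_reaches (hn : 1 ≤ n) (hv : ∀ i, 1 ≤ v i) (hε : 0 < ε) {B : ℕ}
    (hB : ∀ i, InSquare S (ε / (4 * n)) B (p i)) (hBD : InSquare S (ε / (4 * n)) B D) :
    Reaches algorithm (input v p S D ε) ((n + 1) * ((2 * B + 2) ^ 2 + (n + 1)) * algorithmCost)
      fun m' => IsSchedule v p (output p m') ∧
        ∃ t, t ≤ √2 * optEucl v p S D + ε ∧ DeliversAt (output p m') S D t := by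
  set δ := ε / (4 * n) with hδ'
  have hn0 : (1:ℝ) ≤ n := by exact_mod_cast hn
  have hδ : 0 < δ := by positivity
  obtain ⟨o, ho, hrank⟩ := exists_speed_order v
  have hin := inputCtx_input (v := v) (p := p) (S := S) (D := D) (ε := ε)
  set m₀ := input v p S D ε with hm₀
  have hset : Reaches (.setReal 7 (.lit 0) (.div (.read 0 (.lit 0))
      (.ofNat (.mul (.lit 4) (.var 0))))) m₀ 10 fun m' => m' = m₀.writeReal 7 0 δ := by
    refine ⟨_, _, .setReal _ _ _ m₀, by simp [RealExpr.cost, NatExpr.cost], ?_⟩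
    simp [RealExpr.eval, NatExpr.eval, hin.eps, hin.count, hδ']
  refine (hset.seq (L := (n + 1) * (B + 1) * sizeCost + (10 +
    ((n + 1) ^ 2 * (precedesTest.cost + 60) +
    ((n + 1) * (2 * B + 2) ^ 2 * (clearCell.cost + roundCost + 50) +
      (n + 1) * (2 * B + 2) ^ 2 * planCost)))) fun m₁ hA₁ hm₁ => ?_).mono ?_ fun _ _ h => h
  · have hin₁ := hin.of_agree hA₁ (by decide) (by decide)
    refine (sizeProgram_reaches (B := B) hδ hin₁ (by rw [hm₁]; simp [Memory.writeReal]) hB hBD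
      (by rw [hm₁]; simp [Memory.writeReal, hm₀, input])).seq fun m₂ hA₂ ⟨hMB, hMD, hMp⟩ => ?_
    have hin₂ := hin₁.of_agree hA₂ (by decide) (by decide)
    obtain ⟨M, hM⟩ : ∃ M, m₂.nat 2 0 = M := ⟨_, rfl⟩
    rw [hM] at hMB hMD hMp
    have hset' : Reaches (.setNat 3 (.lit 0) (.add (.mul (.lit 2) (.var 2)) (.lit 1))) m₂ 10
        fun m' => m' = m₂.writeNat 3 0 (2 * M + 1) :=
      ⟨_, _, .setNat _ _ _ m₂, by simp [NatExpr.cost], by simp [NatExpr.eval, hM]⟩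
    refine hset'.seq fun m₃ hA₃ hm₃ => ?_
    have hin₃ := hin₂.of_agree hA₃ (by decide) (by decide)
    refine (orderProgram_reaches hin₃).seq fun m₄ hA₄ hm₄ => ?_
    have hfull : FullCtx v p S D ε δ M o m₄ :=
      { hin₃.of_agree hA₄ (by decide) (by decide) with
        half := by rw [hA₄.nat 2 (by decide), hA₃.nat 2 (by decide), hM]
        width := by rw [hA₄.nat 3 (by decide), hm₃]; simp [Memory.writeNat]
        mesh := by
          rw [hA₄.real 7 (by decide), hA₃.real 7 (by decide), hA₂.real 7 (by decide), hm₁]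
          simp [Memory.writeReal]
        order := fun k => by
          have := hm₄ (o k)
          rwa [← hrank, Equiv.symm_apply_apply] at this }
    have hM' : (n + 1) * (2 * M + 2) ^ 2 ≤ (n + 1) * (2 * B + 2) ^ 2 := by gcongr
    refine ((tableProgram_reaches hv hδ.le hfull).mono (Nat.mul_le_mul_right _ hM')
      fun _ _ h => h).seq fun m₅ hA₅ htable => ?_
    have hfull₅ := hfull.of_agree hA₅ (by decide) (by decide)
    refine (planProgram_reaches hδ hfull₅ ?_ hMD).mono (Nat.mul_le_mul_right _ hM')
      fun m₆ _ ⟨h1, h2⟩ => ?_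
    · rw [hA₅.real 4 (by decide), hA₄.real 4 (by decide), hA₃.real 4 (by decide),
        hA₂.real 4 (by decide), hm₁]
      rfl
    · have hout : output p m₆ = fun i => polygonal 0 (p i) (planWaypoints v p S δ M o
          (arrival M m₅) (sourceRow M m₅) (sourceCol M m₅)
          ⟨snap (S 1) δ M (D 1), snap (S 0) δ M (D 0), D⟩ i) := by
        funext i
        rw [output, waypoints_eq_stops h1, h2]
      obtain ⟨h3, t, ht, h4⟩ := plan_spec htable hδ hn hv ho hMp hMD
      rw [hout]
      refine ⟨h3, t, ht.trans (add_le_add_right ?_ _), h4⟩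
      have : δ * (4 * n) = ε := by rw [hδ']; field_simp
      nlinarith
  · rw [algorithmCost]
    generalize sizeCost = a
    generalize precedesTest.cost + 60 = b
    generalize clearCell.cost + roundCost + 50 = c
    generalize planCost = d
    set U := (n + 1) * ((2 * B + 2) ^ 2 + (n + 1)) with hU
    have h1 : (n + 1) * (B + 1) ≤ U := by
      rw [hU]; exact Nat.mul_le_mul_left _ (by nlinarith)
    have h2 : (n + 1) ^ 2 ≤ U := by
      rw [hU, pow_two]; exact Nat.mul_le_mul_left _ (Nat.le_add_left _ _)
    have h3 : (n + 1) * (2 * B + 2) ^ 2 ≤ U := by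
      rw [hU]; exact Nat.mul_le_mul_left _ (Nat.le_add_right _ _)
    have h4 : 1 ≤ U := le_trans (Nat.mul_pos (by omega) (by omega)) h1
    have e1 := Nat.mul_le_mul_right a h1
    have e2 := Nat.mul_le_mul_right b h2
    have e3 := Nat.mul_le_mul_right c h3
    have e4 := Nat.mul_le_mul_right d h3
    nlinarith

theorem inSquare_of_dist_le {x : Plane} {B : ℕ} (h : dist x S ≤ B * δ) : InSquare S δ B x :=
  ⟨(abs_coord_le_dist x S 0).trans h, (abs_coord_le_dist x S 1).trans h⟩

/-- The bound for the number of steps in terms of `x = n * Δ / ε`, since the grid has `O(x ^ 2)`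
points. -/
theorem cost_le {n B c : ℕ} {x : ℝ} (hn : 1 ≤ n) (hx : 2 ≤ x) (hnx : n ≤ x)
    (hB : (B : ℝ) ≤ 4 * x + 1) :
    (((n + 1) * ((2 * B + 2) ^ 2 + (n + 1)) * c : ℕ) : ℝ) ≤
      600 * c * (n * x ^ 2 * Real.log x) := by
  have hn0 : (1:ℝ) ≤ n := by exact_mod_cast hn
  have hlog : 1 / 2 ≤ Real.log x := by
    have h1 := Real.log_two_gt_d9
    have h2 := Real.log_le_log (by norm_num) hx
    linarith
  have hB0 : (0:ℝ) ≤ B := Nat.cast_nonneg B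
  have h1 : ((2 * B + 2) ^ 2 : ℝ) ≤ (10 * x) ^ 2 := by
    apply pow_le_pow_left₀ (by positivity); linarith
  have h2 : (n : ℝ) + 1 ≤ x ^ 2 := by nlinarith
  have h3 : ((n : ℝ) + 1) * ((2 * B + 2) ^ 2 + (n + 1)) ≤ (2 * n) * (101 * x ^ 2) := by
    apply mul_le_mul <;> nlinarith
  have h4 : (n * x ^ 2 : ℝ) * (1 / 2) ≤ n * x ^ 2 * Real.log x :=
    mul_le_mul_of_nonneg_left hlog (by positivity)
  push_cast
  calc ((n : ℝ) + 1) * ((2 * B + 2) ^ 2 + (n + 1)) * c ≤ (600 * (n * x ^ 2 * Real.log x)) * c := by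
        apply mul_le_mul_of_nonneg_right _ (Nat.cast_nonneg c)
        nlinarith
    _ = _ := by ring

end

end PonyExpress

end

theorem mainTheorem6 :
    ∃ (P : PonyExpress.Program) (C : ℝ),
      ∀ (n : ℕ), 1 ≤ n →
      ∀ (v : Fin n → ℝ) (p : Fin n → PonyExpress.Plane) (S D : PonyExpress.Plane) (ε : ℝ),
        (∀ i, 1 ≤ v i) → 0 < ε →
        ∃ (m : PonyExpress.Memory) (k : ℕ),
          PonyExpress.Runs P (PonyExpress.input v p S D ε) m k ∧
          PonyExpress.IsSchedule v p (PonyExpress.output p m) ∧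
          (∃ t, t ≤ Real.sqrt 2 * PonyExpress.optEucl v p S D + ε ∧
            PonyExpress.DeliversAt (PonyExpress.output p m) S D t) ∧
          (ε ≤ PonyExpress.diameter p S D → 2 * ε ≤ n * PonyExpress.diameter p S D →
            (k : ℝ) ≤ C * ((n : ℝ) ^ 3 * (PonyExpress.diameter p S D / ε) ^ 2 *
              Real.log (n * PonyExpress.diameter p S D / ε))) := by
  open PonyExpress in
  refine ⟨algorithm, 600 * algorithmCost, fun n hn v p S D ε hv hε => ?_⟩
  have hn0 : (1:ℝ) ≤ n := by exact_mod_cast hn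
  set Δ := diameter p S D with hΔ
  set x := n * Δ / ε with hx
  have hδ : 0 < ε / (4 * n) := by positivity
  have hB : Δ ≤ (⌈4 * x⌉₊ : ℝ) * (ε / (4 * n)) := by
    calc Δ = 4 * x * (ε / (4 * n)) := by rw [hx]; field_simp
      _ ≤ _ := mul_le_mul_of_nonneg_right (Nat.le_ceil _) hδ.le
  have hbdd : Bornology.IsBounded ({S, D} ∪ Set.range p) :=
    ((Set.toFinite {S, D}).union (Set.finite_range p)).isBounded
  have hsq : ∀ y ∈ ({S, D} ∪ Set.range p : Set Plane), InSquare S (ε / (4 * n)) ⌈4 * x⌉₊ y :=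
    fun y hy => inSquare_of_dist_le ((Metric.dist_le_diam_of_mem hbdd hy (by simp)).trans hB)
  obtain ⟨m, k, hrun, hk, hsched, hdel⟩ := algorithm_reaches (v := v) (p := p) (S := S) (D := D)
    (B := ⌈4 * x⌉₊) hn hv hε (fun i => hsq _ (by simp)) (hsq D (by simp))
  refine ⟨m, k, hrun, hsched, hdel, fun h1 h2 => ?_⟩
  have hx2 : 2 ≤ x := by rw [hx, le_div_iff₀ hε]; exact h2
  have hnx : (n : ℝ) ≤ x := by
    rw [hx, le_div_iff₀ hε]; exact mul_le_mul_of_nonneg_left h1 (by linarith)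
  calc (k : ℝ) ≤ (((n + 1) * ((2 * ⌈4 * x⌉₊ + 2) ^ 2 + (n + 1)) * algorithmCost : ℕ) : ℝ) := by
        exact_mod_cast hk
    _ ≤ 600 * algorithmCost * (n * x ^ 2 * Real.log x) :=
      cost_le hn hx2 hnx (Nat.ceil_lt_add_one (by linarith)).le
    _ = _ := by rw [hx]; ring
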